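/- **Theorem.** Let $p$ be a prime, $m\ge 1$ and $q=p^m$ with $8\mid q-1$, let $l\ge 3$, let $\mathbb F$ be an algebraic closure of $\mathbb F_p$, and let $\mathbf G=\mathrm{Spin}_{2l+1}(\mathbb F)$ be the simply connected simple group of type $\mathsf B_l$, with maximal torus $\mathbf T$, root system $\Phi$, simple roots $\alpha_1=e_1,\ \alpha_i=e_i-e_{i-1}$ ($2\le i\le l$), and root elements $x_\alpha(t)$ ($\alpha\in\Phi$, $t\in\mathbb F$) of a Chevalley system. For $t\in\mathbb F^\times$ put $n_\alpha(t)=x_\alpha(t)x_{-\alpha}(-t^{-1})x_\alpha(t)$ and $h_\alpha(t)=n_\alpha(t)n_\alpha(1)^{-1}$, so that $\mathbf T=\langle h_\alpha(t)\rangle$. Let $F_0$ be the Frobenius endomorphism of $\mathbf G$ with $F_0(x_\alpha(t))=x_\alpha(t^p)$ and $F=F_0^m$. Let $V=\langle n_\alpha(1)\mid\alpha\in\Phi\rangle$ be Tits' extended Weyl group, $H=\mathbf T\cap V$, and $v_0=n_{\alpha_1}(1)\cdots n_{\alpha_l}(1)$. Let $d\ge 1$ be a regular number for the Weyl group of type $\mathsf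 B_l$, i.e. a divisor of $2l$, put $v=v_0^{2l/d}$, let $vF$ denote the map $g\mapsto vF(g)v^{-1}$, and let $$V_d=V^{vF},\qquad H_d=V_d\cap\mathbf T=H^{vF}.$$ For finite groups $Y\unlhd X$, the inertia group of $\theta\in\mathrm{Irr}(Y)$ in $X$ is denoted by $X_\theta$. *Maximal extendibility* holds with respect to $Y\unlhd X$ if every $\theta\in\mathrm{Irr}(Y)$ is the restriction of some $\widetilde\theta\in\mathrm{Irr}(X_\theta)$. An *extension map* with respect to $Y\unlhd X$ is a map $\Lambda$ that sends each $\theta\in\mathrm{Irr}(Y)$ to a character $\Lambda(\theta)\in\mathrm{Irr}(X_\theta)$ which restricts to $\theta$. Then: 1. $H_d\unlhd V_d$, and maximal extendibility holds with respect to $H_d\unlhd V_d$. 2. Consequently the following condition holds. Let $e=|\mathrm{Aut}(\Delta)|\,|V|$, where $\mathrm{Aut}(\Delta)$, the group of permutations of the simple roots preserving lengths and angles, is trivial here. Let $\widehat E=C_{em}\times\mathrm{Aut}(\Delta)$, where a generator $\widehat F_0$ of the cyclic group $C_{em}$ of order $em$ acts on $\mathbf G^{F_0^{em}}$ by $F_0$,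 and put $\widehat F=\widehat F_0^{\,m}$. Let $\mathbf S$ be the Sylow (i.e. maximal) $d$-torus of $(\mathbf T,vF)$, where a $d$-torus is a $vF$-stable torus whose polynomial order is a power of the cyclotomic polynomial $\Phi_d$. Put $\mathbf N=\mathrm N_{\mathbf G}(\mathbf S)$, and inside $\mathbf G^{F_0^{em}}\rtimes\widehat E$ let $\widehat N=\mathrm C_{\mathbf N^{F_0^{em}}\widehat E}(v\widehat F)$ and $\widehat V_d=(V\widehat E)\cap\widehat N$. Let $E\le\mathrm{Aut}(\mathbf G^F)$ be generated by the restriction of $F_0$ and the graph automorphisms (which are trivial here). Then there is an extension map $\Lambda_0$ with respect to $H_d\unlhd V_d$ such that * $\Lambda_0$ is $\widehat V_d$-equivariant; * if $E$ is non-cyclic, then for every $\lambda\in\mathrm{Irr}(H_d)$ the character $\Lambda_0(\lambda)$ extends to some $\widehat\lambda\in\mathrm{Irr}((\widehat V_d)_\lambda)$ with $v\widehat F\in\ker(\widehat\lambda)$. -/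

import Mathlib

noncomputable section

namespace TypeB

/-! ### Characters, inertia groups, extension maps

Complex characters of a subgroup `Y` of a group `A` are regarded as functions on `A` that vanish
outside `Y`. -/

section Characters

variable {A : Type*} [Group A]

/-- `Irr(Y)`: the irreducible complex characters of the subgroup `Y`, extended by zero to `A`. -/
def Irr (Y : Subgroup A) : Set (A → ℂ) :=
  {χ | (∀ a, a ∉ Y → χ a = 0) ∧
    ∃ (n : ℕ) (ρ : Representation ℂ Y (Fin n → ℂ)), ρ.IsIrreducible ∧
      ∀ y : Y, χ y = ρ.character y}

/-- The conjugate `a ↦ θ (g⁻¹ a g)` of a function by `g`. -/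
def conjFun (g : A) (θ : A → ℂ) : A → ℂ := fun a => θ (g⁻¹ * a * g)

/-- The inertia group `X_θ`: the stabilizer of `θ` in `N_X(Y)`. -/
def inertia (Y X : Subgroup A) (θ : A → ℂ) : Subgroup A where
  carrier := {g | g ∈ X ∧ g ∈ Subgroup.normalizer (Y : Set A) ∧ conjFun g θ = θ}
  one_mem' := ⟨one_mem _, one_mem _, by funext a; simp [conjFun]⟩
  mul_mem' := by
    rintro a b ⟨h1, h2, h3⟩ ⟨k1, k2, k3⟩
    refine ⟨mul_mem h1 k1, mul_mem h2 k2, ?_⟩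
    funext x
    have e1 := congrFun k3 (a⁻¹ * x * a)
    have e2 := congrFun h3 x
    simp only [conjFun] at e1 e2 ⊢
    rw [← e2, ← e1]
    simp only [mul_inv_rev, mul_assoc]
  inv_mem' := by
    rintro a ⟨h1, h2, h3⟩
    refine ⟨inv_mem h1, inv_mem h2, ?_⟩
    funext x
    have e2 := congrFun h3 (a * x * a⁻¹)
    simp only [conjFun] at e2 ⊢
    rw [inv_inv, ← e2]
    congr 1
    group

/-- `Y ⊴ X`, for subgroups of a common group. -/
def NormalIn (Y X : Subgroup A) : Prop := Y ≤ X ∧ X ≤ Subgroup.normalizer (Y : Set A)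

/-- Maximal extendibility with respect to `Y ⊴ X`: every `θ ∈ Irr(Y)` extends to `X_θ`. -/
def MaximalExtendibility (Y X : Subgroup A) : Prop :=
  NormalIn Y X ∧ ∀ θ ∈ Irr Y, ∃ χ ∈ Irr (inertia Y X θ), ∀ y ∈ Y, χ y = θ y

/-- `Λ` is an extension map with respect to `Y ⊴ X` (only its values on `Irr(Y)` matter). -/
def IsExtensionMap (Y X : Subgroup A) (Λ : (A → ℂ) → (A → ℂ)) : Prop :=
  NormalIn Y X ∧ ∀ θ ∈ Irr Y, Λ θ ∈ Irr (inertia Y X θ) ∧ ∀ y ∈ Y, Λ θ y = θ y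

/-- Equivariance of `Λ` on `Irr(Y)` under conjugation by the elements of `B`. -/
def IsEquivariantOn (Y B : Subgroup A) (Λ : (A → ℂ) → (A → ℂ)) : Prop :=
  ∀ b ∈ B, ∀ θ ∈ Irr Y, Λ (conjFun b θ) = conjFun b (Λ θ)

/-- The subgroup of fixed points of an automorphism. -/
def fixedPoints (φ : MulAut A) : Subgroup A where
  carrier := {a | φ a = a}
  one_mem' := map_one φ
  mul_mem' := by
    intro a b ha hb
    simp only [Set.mem_ofPred_eq] at ha hb ⊢
    rw [map_mul, ha, hb]
  inv_mem' := by
    intro a ha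
    simp only [Set.mem_ofPred_eq] at ha ⊢
    rw [map_inv, ha]

theorem mem_fixedPoints {φ : MulAut A} {a : A} : a ∈ fixedPoints φ ↔ φ a = a := Iff.rfl

/-- The restriction of `φ` to the fixed points of `φ ^ n`. -/
def resFixed (φ : MulAut A) (n : ℕ) : MulAut (fixedPoints (φ ^ n)) where
  toFun a := ⟨φ a, by
    have h : (φ ^ n) a = a := a.2
    rw [mem_fixedPoints, ← MulAut.mul_apply, ← pow_succ, pow_succ', MulAut.mul_apply, h]⟩
  invFun a := ⟨φ⁻¹ a, by
    have h : (φ ^ n) a = a := a.2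
    have hc : φ ^ n * φ⁻¹ = φ⁻¹ * φ ^ n := ((Commute.refl φ).pow_left n).inv_right.eq
    rw [mem_fixedPoints, ← MulAut.mul_apply, hc, MulAut.mul_apply, h]⟩
  left_inv a := Subtype.ext (MulAut.inv_apply_self A φ a)
  right_inv a := Subtype.ext (MulAut.apply_inv_self A φ a)
  map_mul' a b := Subtype.ext (map_mul φ (a : A) (b : A))

theorem coe_resFixed_pow (φ : MulAut A) (n k : ℕ) (a : fixedPoints (φ ^ n)) :
    (((resFixed φ n) ^ k) a : A) = (φ ^ k) a := by
  induction k generalizing a with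
  | zero => rfl
  | succ k ih =>
    rw [pow_succ, pow_succ, MulAut.mul_apply, MulAut.mul_apply, ih]
    rfl

theorem resFixed_pow (φ : MulAut A) (n : ℕ) : (resFixed φ n) ^ n = 1 := by
  ext a
  rw [coe_resFixed_pow]
  exact a.2

/-- The action of the cyclic group `C_n` on the fixed points of `φ ^ n`, in which the generator
acts by `φ`. -/
def cyclicAction (φ : MulAut A) (n : ℕ) :
    Multiplicative (ZMod n) →* MulAut (fixedPoints (φ ^ n)) :=
  AddMonoidHom.toMultiplicativeLeft
    (ZMod.lift n ⟨zmultiplesHom _ (Additive.ofMul (resFixed φ n)), by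
      rw [zmultiplesHom_apply, natCast_zsmul, ← ofMul_pow, resFixed_pow, ofMul_one]⟩)

end Characters

/-! ### The roots of type `B_l`

The weights of the natural `(2l+1)`-dimensional module are listed in the order
`e_1, …, e_l, 0, -e_l, …, -e_1`, so that `Fin.rev` is negation. A root is a sum of two weights in
different positions that are not opposite to each other. -/

section Roots

variable (l : ℕ)

/-- Position of the weight `e_i`. -/
def pos {l : ℕ} (i : Fin l) : Fin (2 * l + 1) := ⟨i, by omega⟩

/-- Position of the weight `-e_i`. -/
def neg {l : ℕ} (i : Fin l) : Fin (2 * l + 1) := (pos i).rev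

/-- Position of the weight `0`. -/
def mid : Fin (2 * l + 1) := ⟨l, by omega⟩

/-- The weight in a given position, as a vector of `ℤ^l`. -/
def weight {l : ℕ} (a : Fin (2 * l + 1)) : Fin l → ℤ :=
  fun i => if a = pos i then 1 else if a = neg i then -1 else 0

/-- The root system `Φ = {± e_i} ∪ {± e_i ± e_j | i < j}`: each root is the sum of the weights in
positions `fst < snd`. -/
@[ext] structure Root where
  fst : Fin (2 * l + 1)
  snd : Fin (2 * l + 1)
  lt : fst < snd
  ne : snd ≠ fst.rev

variable {l}

/-- The root as a vector of `ℤ^l`. -/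
def Root.toVec (α : Root l) : Fin l → ℤ := weight α.fst + weight α.snd

/-- The root `-α`. -/
def Root.opp (α : Root l) : Root l where
  fst := α.snd.rev
  snd := α.fst.rev
  lt := Fin.rev_lt_rev.2 α.lt
  ne := by
    rw [Fin.rev_rev]
    intro h
    exact α.ne h.symm

/-- The simple roots `e_1, e_2 - e_1, …, e_l - e_{l-1}` (indexed from `0`). -/
def simpleRoot (i : Fin l) : Root l :=
  if h : i.val = 0 then
    ⟨pos i, mid l, by simp [pos, mid, Fin.lt_def], by
      have := i.2
      simp only [pos, mid, ne_eq, Fin.ext_iff, Fin.val_rev]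
      omega⟩
  else
    ⟨pos i, neg ⟨i.val - 1, by omega⟩, by
      have := i.2
      simp only [pos, neg, Fin.lt_def, Fin.val_rev]
      omega, by
      have := i.2
      simp only [pos, neg, ne_eq, Fin.ext_iff, Fin.val_rev]
      omega⟩

theorem simpleRoot_toVec (i j : Fin l) :
    (simpleRoot i).toVec j = if j = i then 1 else if j.val + 1 = i.val then -1 else 0 := by
  have := i.2
  have := j.2
  by_cases h : i.val = 0
  · simp only [simpleRoot, h, dite_true, Root.toVec, weight, Pi.add_apply, pos, neg, mid,
      Fin.ext_iff, Fin.val_rev]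
    split_ifs <;> first | contradiction | omega
  · simp only [simpleRoot, h, dite_false, Root.toVec, weight, Pi.add_apply, pos, neg,
      Fin.ext_iff, Fin.val_rev]
    split_ifs <;> omega

/-- `Aut(Δ)`: the permutations of the simple roots that preserve lengths and angles. -/
def AutDelta (l : ℕ) : Subgroup (Equiv.Perm (Fin l)) where
  carrier := {σ | ∀ i j, (simpleRoot (σ i)).toVec ⬝ᵥ (simpleRoot (σ j)).toVec =
    (simpleRoot i).toVec ⬝ᵥ (simpleRoot j).toVec}
  one_mem' := fun _ _ => rfl
  mul_mem' := fun {a b} ha hb i j => (ha (b i) (b j)).trans (hb i j)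
  inv_mem' := fun {a} ha i j => by
    have := ha (a⁻¹ i) (a⁻¹ j)
    simpa using this.symm

theorem simpleRoot_dotProduct (i : Fin l) (w : Fin l → ℤ) :
    (simpleRoot i).toVec ⬝ᵥ w =
      w i - if h : i.val = 0 then 0 else w ⟨i.val - 1, by omega⟩ := by
  have hi := i.2
  by_cases h : i.val = 0
  · have e : (simpleRoot i).toVec = Pi.single i 1 := by
      funext j
      rw [simpleRoot_toVec, Pi.single_apply]
      split_ifs <;> first | rfl | omega
    rw [e, single_dotProduct, dif_pos h]
    ring
  · have e : (simpleRoot i).toVec = Pi.single i 1 - Pi.single ⟨i.val - 1, by omega⟩ 1 := by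
      funext j
      rw [simpleRoot_toVec, Pi.sub_apply, Pi.single_apply, Pi.single_apply]
      simp only [Fin.ext_iff]
      split_ifs <;> first | rfl | omega
    rw [e, sub_dotProduct, single_dotProduct, single_dotProduct, dif_neg h]
    ring

/-- In type `B_l` there are no non-trivial graph automorphisms. -/
theorem autDelta_eq_bot (l : ℕ) : AutDelta l = ⊥ := by
  rw [eq_bot_iff]
  intro σ hσ
  rw [Subgroup.mem_bot]
  have key : ∀ k, ∀ hk : k < l, σ ⟨k, hk⟩ = ⟨k, hk⟩ := by
    intro k
    induction k using Nat.strong_induction_on with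
    | _ k ih =>
      intro hk
      rcases Nat.eq_zero_or_pos k with rfl | hpos
      · have h := hσ ⟨0, hk⟩ ⟨0, hk⟩
        rw [simpleRoot_dotProduct, simpleRoot_dotProduct] at h
        simp only [simpleRoot_toVec, Fin.ext_iff] at h
        rw [Fin.ext_iff]
        by_contra hne
        simp only [hne] at h
        simp at h
        split_ifs at h <;> omega
      · have hk1 : k - 1 < l := by omega
        have h := hσ ⟨k, hk⟩ ⟨k - 1, hk1⟩
        rw [ih (k - 1) (by omega) hk1, simpleRoot_dotProduct, simpleRoot_dotProduct] at h
        simp only [simpleRoot_toVec, Fin.ext_iff] at h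
        rw [Fin.ext_iff]
        by_contra hne
        have hlt : ¬ (σ ⟨k, hk⟩).val < k := by
          intro hlt
          have h1 := ih _ hlt (σ ⟨k, hk⟩).2
          have h2 := congrArg Fin.val (σ.injective h1)
          simp only at h2
          omega
        simp only at hne
        split_ifs at h <;> omega
  ext ⟨k, hk⟩
  rw [key k hk]
  rfl

end Roots

/-! ### The simply connected group of type `B_l` -/

section Group

variable (K : Type*) [Field K] (l : ℕ)

/-- The split quadratic form `∑ x_{e_i} x_{-e_i} + x_0²` in `2l+1` variables. -/
def quadForm : QuadraticForm K (Fin (2 * l + 1) → K) :=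
  (∑ i : Fin l, QuadraticMap.linMulLin (LinearMap.proj (pos i)) (LinearMap.proj (neg i))) +
    QuadraticMap.linMulLin (LinearMap.proj (mid l)) (LinearMap.proj (mid l))


theorem quadForm_apply (x : Fin (2 * l + 1) → K) :
    quadForm K l x = ∑ i : Fin l, x (pos i) * x (neg i) + x (mid l) * x (mid l) := by
  simp [quadForm]

/-- The Clifford algebra of the split form. -/
abbrev Cl : Type _ := CliffordAlgebra (quadForm K l)

/-- `G = Spin_{2l+1}(K)`. -/
abbrev Spin : Type _ := spinGroup (quadForm K l)

variable {K l}

/-- The basis vector of the weight in position `a`, in the Clifford algebra. -/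
def u (a : Fin (2 * l + 1)) : Cl K l := CliffordAlgebra.ι (quadForm K l) (Pi.single a 1)

theorem u_mul_self_of_ne {a : Fin (2 * l + 1)} (ha : a ≠ mid l) : (u a * u a : Cl K l) = 0 := by
  rw [u, CliffordAlgebra.ι_sq_scalar, quadForm_apply]
  have h : ∀ i : Fin l, (Pi.single a 1 : Fin (2 * l + 1) → K) (pos i) *
      (Pi.single a 1 : Fin (2 * l + 1) → K) (neg i) = 0 := by
    intro i
    by_cases h1 : pos i = a
    · have h2 : neg i ≠ a := by
        rw [← h1]
        have := i.2
        simp only [pos, neg, ne_eq, Fin.ext_iff, Fin.val_rev]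
        omega
      rw [Pi.single_eq_of_ne h2, mul_zero]
    · rw [Pi.single_eq_of_ne h1, zero_mul]
  rw [Finset.sum_eq_zero fun i _ => h i, Pi.single_eq_of_ne ha.symm]
  simp

theorem u_mid_mul_self : (u (mid l) * u (mid l) : Cl K l) = 1 := by
  rw [u, CliffordAlgebra.ι_sq_scalar, quadForm_apply]
  have h : ∀ i : Fin l, (Pi.single (mid l) 1 : Fin (2 * l + 1) → K) (pos i) *
      (Pi.single (mid l) 1 : Fin (2 * l + 1) → K) (neg i) = 0 := by
    intro i
    have h1 : pos i ≠ mid l := by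
      have := i.2
      simp only [pos, mid, ne_eq, Fin.ext_iff]
      omega
    rw [Pi.single_eq_of_ne h1, zero_mul]
  rw [Finset.sum_eq_zero fun i _ => h i, Pi.single_eq_same]
  simp

theorem u_anticomm {a b : Fin (2 * l + 1)} (h : b ≠ a.rev) :
    (u a * u b : Cl K l) = -(u b * u a) := by
  rw [eq_neg_iff_add_eq_zero, u, u, CliffordAlgebra.ι_mul_ι_add_swap, QuadraticMap.polar]
  simp only [quadForm_apply, Pi.add_apply]
  rw [← map_zero (algebraMap K (Cl K l))]
  congr 1
  have hne : ∀ c : Fin (2 * l + 1),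
      (Pi.single a 1 : Fin (2 * l + 1) → K) c * (Pi.single b 1 : Fin (2 * l + 1) → K) c.rev = 0 := by
    intro c
    by_cases h1 : c = a
    · have h2 : c.rev ≠ b := by rw [h1]; exact h.symm
      rw [Pi.single_eq_of_ne h2, mul_zero]
    · rw [Pi.single_eq_of_ne h1, zero_mul]
  have hsum : ∀ i : Fin l,
      ((Pi.single a 1 : Fin (2 * l + 1) → K) (pos i) + (Pi.single b 1 : Fin (2 * l + 1) → K) (pos i)) *
      ((Pi.single a 1 : Fin (2 * l + 1) → K) (neg i) + (Pi.single b 1 : Fin (2 * l + 1) → K) (neg i)) =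
      (Pi.single a 1 : Fin (2 * l + 1) → K) (pos i) * (Pi.single a 1 : Fin (2 * l + 1) → K) (neg i) +
      (Pi.single b 1 : Fin (2 * l + 1) → K) (pos i) * (Pi.single b 1 : Fin (2 * l + 1) → K) (neg i) := by
    intro i
    have e1 := hne (pos i)
    have e2 := hne (neg i)
    have e3 : (neg i).rev = pos i := Fin.rev_rev _
    rw [e3] at e2
    change _ * (Pi.single b 1 : Fin (2 * l + 1) → K) (neg i) = 0 at e1
    linear_combination e1 + e2
  have e4 := hne (mid l)
  have e5 : (mid l).rev = mid l := by
    simp only [mid, Fin.ext_iff, Fin.val_rev]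
    omega
  rw [e5] at e4
  rw [Finset.sum_congr rfl fun i _ => hsum i, Finset.sum_add_distrib]
  linear_combination 2 * e4

open CliffordAlgebra in
/-- A product of two vectors of norm one lies in the spin group. -/
theorem ι_mul_ι_mem_spin {x y : Fin (2 * l + 1) → K}
    (hx : ι (quadForm K l) x * ι (quadForm K l) x = 1)
    (hy : ι (quadForm K l) y * ι (quadForm K l) y = 1) :
    ι (quadForm K l) x * ι (quadForm K l) y ∈ spinGroup (quadForm K l) := by
  refine spinGroup.mem_iff.2 ⟨pinGroup.mem_iff.2 ⟨?_, ?_⟩, ι_mul_ι_mem_evenOdd_zero _ x y⟩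
  · refine ⟨(⟨_, _, hx, hx⟩ : (Cl K l)ˣ) * ⟨_, _, hy, hy⟩, mul_mem ?_ ?_, rfl⟩
    · exact Subgroup.subset_closure ⟨x, rfl⟩
    · exact Subgroup.subset_closure ⟨y, rfl⟩
  · have hs : star (ι (quadForm K l) x * ι (quadForm K l) y) =
        ι (quadForm K l) y * ι (quadForm K l) x := by
      rw [star_mul, star_ι, star_ι, neg_mul_neg]
    rw [Unitary.mem_iff, hs]
    constructor
    · rw [mul_assoc, ← mul_assoc (ι _ x), hx, one_mul, hy]
    · rw [mul_assoc, ← mul_assoc (ι _ y), hy, one_mul, hx]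

open CliffordAlgebra in
theorem one_add_mem_spin {x y : Fin (2 * l + 1) → K}
    (hx : ι (quadForm K l) x * ι (quadForm K l) x = 0)
    (hy : ι (quadForm K l) y * ι (quadForm K l) y = 1)
    (hxy : ι (quadForm K l) x * ι (quadForm K l) y = -(ι (quadForm K l) y * ι (quadForm K l) x))
    (t : K) :
    1 + t • (ι (quadForm K l) x * ι (quadForm K l) y) ∈ spinGroup (quadForm K l) := by
  have h1 : ι (quadForm K l) (y + t • x) * ι (quadForm K l) (y + t • x) = 1 := by
    simp only [map_add, map_smul, add_mul, mul_add, smul_mul_assoc, mul_smul_comm, hx, hy, hxy]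
    simp
  have h2 := ι_mul_ι_mem_spin h1 hy
  simpa only [map_add, map_smul, add_mul, smul_mul_assoc, hy] using h2

theorem rootElt_mem (α : Root l) (t : K) :
    1 + t • (u α.fst * u α.snd) ∈ spinGroup (quadForm K l) := by
  have hlt := α.lt
  have hanti := u_anticomm (K := K) α.ne
  by_cases h1 : α.fst = mid l
  · have h2 : α.snd ≠ mid l := by
      rw [← h1]
      exact hlt.ne'
    have := one_add_mem_spin (K := K) (u_mul_self_of_ne h2) (u_mid_mul_self (K := K))
      (by rw [← h1]; exact (neg_eq_iff_eq_neg.2 hanti).symm) (-t)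
    rw [hanti, h1, smul_neg, ← neg_smul]
    exact this
  by_cases h2 : α.snd = mid l
  · rw [h2] at hanti ⊢
    exact one_add_mem_spin (u_mul_self_of_ne h1) u_mid_mul_self hanti t
  · have hm : ∀ c : Fin (2 * l + 1), c ≠ mid l → (u c * u (mid l) : Cl K l) = -(u (mid l) * u c) := by
      intro c hc
      apply u_anticomm
      intro h
      apply hc
      rw [Fin.ext_iff] at h ⊢
      simp only [mid, Fin.val_rev] at h ⊢
      have := c.2
      omega
    have ha := hm _ h1
    have hb := hm _ h2
    have e0 := u_mul_self_of_ne (K := K) h1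
    have e1 := u_mul_self_of_ne (K := K) h2
    have e2 := u_mid_mul_self (K := K) (l := l)
    have k1 := one_add_mem_spin (K := K) e0 e2 ha (-t)
    have key : (CliffordAlgebra.ι (quadForm K l)
        (Pi.single α.snd 1 + Pi.single (mid l) 1) : Cl K l) = u α.snd + u (mid l) := map_add _ _ _
    have k2 := one_add_mem_spin (K := K) (x := Pi.single α.fst 1)
      (y := Pi.single α.snd 1 + Pi.single (mid l) 1) e0
      (by rw [key, add_mul, mul_add, mul_add, e1, e2, hb]; abel)
      (by
        rw [key, mul_add, add_mul]
        change u α.fst * u α.snd + u α.fst * u (mid l) =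
          -(u α.snd * u α.fst + u (mid l) * u α.fst)
        rw [hanti, ha]; abel) t
    have k3 := mul_mem k2 k1
    rw [key] at k3
    convert k3 using 1
    change _ = (1 + t • (u α.fst * (u α.snd + u (mid l)))) * (1 + -t • (u α.fst * u (mid l)))
    have z : (u α.fst * (u α.snd + u (mid l)) * (u α.fst * u (mid l)) : Cl K l) = 0 := by
      rw [← mul_assoc, mul_add, add_mul, hanti, ha, neg_mul, neg_mul, mul_assoc, mul_assoc, e0]
      simp
    rw [add_mul, mul_add, mul_add, smul_mul_smul_comm, z]
    simp only [mul_add, smul_add, one_mul, mul_one, smul_zero, add_zero, neg_smul]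
    abel

/-- The root element `x_α(t)`. -/
def rootElt (α : Root l) (t : K) : Spin K l := ⟨1 + t • (u α.fst * u α.snd), rootElt_mem α t⟩

/-- `n_α(t) = x_α(t) x_{-α}(-t⁻¹) x_α(t)`. -/
def nElt (α : Root l) (t : Kˣ) : Spin K l :=
  rootElt α (t : K) * rootElt α.opp (-(t⁻¹ : Kˣ) : K) * rootElt α (t : K)

/-- `h_α(t) = n_α(t) n_α(1)⁻¹`. -/
def hElt (α : Root l) (t : Kˣ) : Spin K l := nElt α t * (nElt α 1)⁻¹

variable (K l)

/-- The maximal torus `T`, generated by the `h_α(t)`. -/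
def torus : Subgroup (Spin K l) := Subgroup.closure {g | ∃ α t, g = hElt α t}

/-- Tits' extended Weyl group `V`, generated by the `n_α(1)`. -/
def extWeyl : Subgroup (Spin K l) := Subgroup.closure {g | ∃ α, g = nElt α 1}

/-- `H = T ∩ V`. -/
def toralPart : Subgroup (Spin K l) := torus K l ⊓ extWeyl K l

/-- `v₀ = n_{α_1}(1) ⋯ n_{α_l}(1)`. -/
def v₀ : Spin K l := (List.ofFn fun i : Fin l => nElt (simpleRoot i) 1).prod

/-- The Sylow `d`-twist `v = v₀^{2l/d}`. -/
def twist (d : ℕ) : Spin K l := v₀ K l ^ (2 * l / d)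

theorem v₀_mem : v₀ K l ∈ extWeyl K l := by
  refine Subgroup.list_prod_mem _ fun x hx => ?_
  obtain ⟨i, rfl⟩ := List.mem_ofFn.1 hx
  exact Subgroup.subset_closure ⟨_, rfl⟩

theorem twist_mem (d : ℕ) : twist K l d ∈ extWeyl K l := pow_mem (v₀_mem K l) _

end Group

/-! ### The Frobenius endomorphism -/

section Frobenius

variable {K : Type*} [Field K] {l : ℕ}

/-- The Clifford algebra with scalars acting through `σ`. -/
def TwistedCl (_σ : K →+* K) (l : ℕ) : Type _ := Cl K l

instance (σ : K →+* K) : Ring (TwistedCl σ l) := inferInstanceAs (Ring (Cl K l))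

/-- The structure map of the twisted algebra. -/
def twistedMap (σ : K →+* K) (l : ℕ) : K →+* TwistedCl σ l :=
  show K →+* Cl K l from (algebraMap K (Cl K l)).comp σ

instance (σ : K →+* K) : Algebra K (TwistedCl σ l) :=
  (twistedMap σ l).toAlgebra' fun c x => Algebra.commutes (A := Cl K l) (σ c) x

theorem quadForm_comp (σ : K →+* K) (x : Fin (2 * l + 1) → K) :
    quadForm K l (fun a => σ (x a)) = σ (quadForm K l x) := by
  simp [quadForm_apply]

/-- The linear map to the twisted Clifford algebra induced by `σ` on coordinates. -/
def twistedι (σ : K →+* K) : (Fin (2 * l + 1) → K) →ₗ[K] TwistedCl σ l where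
  toFun x := (CliffordAlgebra.ι (quadForm K l) (fun a => σ (x a)) : Cl K l)
  map_add' x y := by
    have : (fun a => σ ((x + y) a)) = (fun a => σ (x a)) + fun a => σ (y a) := by
      funext a; simp
    rw [this, map_add]
    rfl
  map_smul' c x := by
    have : (fun a => σ ((c • x) a)) = σ c • fun a => σ (x a) := by
      funext a; simp
    rw [this, map_smul]
    exact Algebra.smul_def (A := Cl K l) (σ c) _

/-- The ring endomorphism of the Clifford algebra induced by `σ` on coordinates. -/
def clHom (σ : K →+* K) : Cl K l →+* Cl K l :=
  (CliffordAlgebra.lift (quadForm K l) ⟨twistedι σ, fun x => by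
    refine (CliffordAlgebra.ι_sq_scalar (quadForm K l) (fun a => σ (x a))).trans ?_
    rw [quadForm_comp]
    rfl⟩ : Cl K l →ₐ[K] TwistedCl σ l).toRingHom

theorem clHom_algebraMap (σ : K →+* K) (c : K) :
    clHom σ (algebraMap K (Cl K l) c) = algebraMap K (Cl K l) (σ c) :=
  AlgHom.commutes (CliffordAlgebra.lift (quadForm K l) _ : Cl K l →ₐ[K] TwistedCl σ l) c

theorem clHom_ι (σ : K →+* K) (x : Fin (2 * l + 1) → K) :
    clHom σ (CliffordAlgebra.ι (quadForm K l) x) =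
      CliffordAlgebra.ι (quadForm K l) (fun a => σ (x a)) :=
  CliffordAlgebra.lift_ι_apply (A := TwistedCl σ l) (twistedι σ) _ x

theorem clHom_clHom {σ τ : K →+* K} (h : ∀ c, σ (τ c) = c) (x : Cl K l) :
    clHom σ (clHom τ x) = x := by
  induction x using CliffordAlgebra.induction with
  | algebraMap c => rw [clHom_algebraMap, clHom_algebraMap, h]
  | ι x => simp only [clHom_ι, h]
  | mul a b ha hb => rw [map_mul, map_mul, ha, hb]
  | add a b ha hb => rw [map_add, map_add, ha, hb]

theorem clHom_star (σ : K →+* K) (x : Cl K l) : clHom σ (star x) = star (clHom σ x) := by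
  induction x using CliffordAlgebra.induction with
  | algebraMap c => simp only [CliffordAlgebra.star_algebraMap, clHom_algebraMap]
  | ι x => simp only [CliffordAlgebra.star_ι, clHom_ι, map_neg]
  | mul a b ha hb => simp only [star_mul, map_mul, ha, hb]
  | add a b ha hb => simp only [star_add, map_add, ha, hb]

theorem clHom_mem_spin (σ : K →+* K) {x : Cl K l} (hx : x ∈ spinGroup (quadForm K l)) :
    clHom σ x ∈ spinGroup (quadForm K l) := by
  obtain ⟨⟨⟨y, hy, rfl⟩, h2⟩, h3⟩ := hx
  refine ⟨⟨⟨Units.map (clHom σ).toMonoidHom y, ?_, rfl⟩, ?_⟩, ?_⟩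
  · have : lipschitzGroup (quadForm K l) ≤
        (lipschitzGroup (quadForm K l)).comap (Units.map (clHom σ).toMonoidHom) := by
      refine (Subgroup.closure_le _).2 ?_
      rintro z ⟨w, hw⟩
      refine Subgroup.subset_closure ⟨fun a => σ (w a), ?_⟩
      rw [← clHom_ι, hw]
      rfl
    exact this hy
  · have h2' := Unitary.mem_iff.1 h2
    refine Unitary.mem_iff.2 ?_
    rw [← clHom_star, ← map_mul, ← map_mul, h2'.1, h2'.2, map_one]
    exact ⟨rfl, rfl⟩
  · have h3' : (y : Cl K l) ∈ CliffordAlgebra.evenOdd (quadForm K l) 0 := h3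
    change clHom σ (y : Cl K l) ∈ CliffordAlgebra.evenOdd (quadForm K l) 0
    generalize (y : Cl K l) = z at h3' ⊢
    induction z, h3' using CliffordAlgebra.even_induction with
    | algebraMap c =>
      rw [clHom_algebraMap]
      exact SetLike.algebraMap_mem_graded (CliffordAlgebra.evenOdd (quadForm K l)) _
    | add x y hx hy ihx ihy => rw [map_add]; exact add_mem ihx ihy
    | ι_mul_ι_mul m₁ m₂ x hx ih =>
      rw [map_mul, map_mul, clHom_ι, clHom_ι, ← zero_add (0 : ZMod 2)]
      exact SetLike.mul_mem_graded (CliffordAlgebra.ι_mul_ι_mem_evenOdd_zero _ _ _) ih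

variable (K l) (p : ℕ) [ExpChar K p] [PerfectRing K p]

/-- The Frobenius endomorphism `F₀` of `G`, which raises coordinates to the `p`-th power; it is
bijective, and hence an automorphism of the abstract group. -/
def F₀ : MulAut (Spin K l) where
  toFun g := ⟨clHom (frobeniusEquiv K p : K →+* K) g, clHom_mem_spin _ g.2⟩
  invFun g := ⟨clHom ((frobeniusEquiv K p).symm : K →+* K) g, clHom_mem_spin _ g.2⟩
  left_inv _ := Subtype.ext (clHom_clHom (fun c => (frobeniusEquiv K p).symm_apply_apply c) _)
  right_inv _ := Subtype.ext (clHom_clHom (fun c => (frobeniusEquiv K p).apply_symm_apply c) _)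
  map_mul' a b := Subtype.ext (map_mul (clHom _) (a : Cl K l) b)

theorem F₀_rootElt (α : Root l) (t : K) : F₀ K l p (rootElt α t) = rootElt α (t ^ p) := by
  apply Subtype.ext
  change clHom _ (1 + t • (u α.fst * u α.snd)) = 1 + t ^ p • (u α.fst * u α.snd)
  have hu : ∀ a : Fin (2 * l + 1), clHom (frobeniusEquiv K p : K →+* K) (u a : Cl K l) = u a := by
    intro a
    rw [u, clHom_ι]
    congr 1
    funext b
    rcases eq_or_ne b a with rfl | h
    · simp
    · simp [Pi.single_eq_of_ne h]
  rw [Algebra.smul_def, Algebra.smul_def, map_add, map_one, map_mul, map_mul, clHom_algebraMap,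
    hu, hu]
  rfl

theorem F₀_fixes_extWeyl {g : Spin K l} (hg : g ∈ extWeyl K l) : F₀ K l p g = g := by
  have : extWeyl K l ≤ fixedPoints (F₀ K l p) := by
    refine (Subgroup.closure_le _).2 ?_
    rintro _ ⟨α, rfl⟩
    have hp : ((-1 : K)) ^ p = -1 := by
      have := map_neg (frobenius K p) 1
      simpa [frobenius_def] using this
    change F₀ K l p _ = _
    simp only [nElt, map_mul, F₀_rootElt, inv_one, Units.val_one, one_pow, hp]
  exact this hg

theorem extWeyl_le_fixedPoints (n : ℕ) : extWeyl K l ≤ fixedPoints (F₀ K l p ^ n) := by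
  intro g hg
  rw [mem_fixedPoints]
  induction n with
  | zero => rfl
  | succ n ih => rw [pow_succ, MulAut.mul_apply, F₀_fixes_extWeyl K l p hg, ih]

/-- The map `vF : g ↦ v F(g) v⁻¹`, where `F = F₀ ^ m`. -/
def twistedF (m : ℕ) (v : Spin K l) : MulAut (Spin K l) := MulAut.conj v * F₀ K l p ^ m

/-- `V_d = V^{vF}`. -/
def Vd (m : ℕ) (v : Spin K l) : Subgroup (Spin K l) :=
  extWeyl K l ⊓ fixedPoints (twistedF K l p m v)

/-- `H_d = H^{vF} = V_d ∩ T`. -/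
def Hd (m : ℕ) (v : Spin K l) : Subgroup (Spin K l) :=
  toralPart K l ⊓ fixedPoints (twistedF K l p m v)

/-! ### Sylow `d`-tori of `(T, vF)` -/

variable {K l} in
/-- The cocharacter `∑ y_i α_i^∨` of `T`; by simple connectedness these are all of `Y(T)`. -/
def cochar (y : Fin l → ℤ) (t : Kˣ) : Spin K l :=
  (List.ofFn fun i => hElt (simpleRoot i) t ^ y i).prod

/-- `S` is a `d`-torus of `(T, vF)`: it is the subtorus attached to a sublattice `L` of `Y(T)` that
is stable under the finite-order map `φ` for which `vF` acts on `Y(T)` as `qφ`, and the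
characteristic polynomial of `φ` on `L` (equivalently the polynomial order of `S`) is a power of
the cyclotomic polynomial `Φ_d`. -/
def IsDTorus (m : ℕ) (v : Spin K l) (d : ℕ) (S : Subgroup (Spin K l)) : Prop :=
  ∃ (φ : (Fin l → ℤ) →ₗ[ℤ] (Fin l → ℤ)) (L : Submodule ℤ (Fin l → ℤ)) (hL : ∀ y ∈ L, φ y ∈ L),
    (∀ y t, twistedF K l p m v (cochar y t) = cochar (φ y) (t ^ p ^ m)) ∧
    (∃ k : ℕ, (φ.restrict hL).charpoly = Polynomial.cyclotomic d ℤ ^ k) ∧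
    S = Subgroup.closure {g | ∃ y ∈ L, ∃ t, g = cochar y t}

/-- A Sylow `d`-torus is a maximal `d`-torus. -/
def IsSylowDTorus (m : ℕ) (v : Spin K l) (d : ℕ) (S : Subgroup (Spin K l)) : Prop :=
  Maximal (IsDTorus K l p m v d) S

/-! ### The group `G^{F₀^{em}} ⋊ Ê` and its subgroups

By `autDelta_eq_bot` all graph automorphisms are trivial in type `B_l`; thus `F = F₀ ^ m`, and
`Aut(Δ)` acts trivially. -/

/-- The exponent `em`, where `e = |Aut(Δ)| |V|`. -/
def expo (m : ℕ) : ℕ := Nat.card (AutDelta l) * Nat.card (extWeyl K l) * m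

/-- `Ê = C_{em} × Aut(Δ)`. -/
abbrev Ehat (m : ℕ) : Type := Multiplicative (ZMod (expo K l m)) × AutDelta l

/-- The action of `Ê` on `G^{F₀^{em}}`: the generator of `C_{em}` acts by `F₀`. -/
def EhatAction (m : ℕ) : Ehat K l m →* MulAut (fixedPoints (F₀ K l p ^ expo K l m)) :=
  (cyclicAction (F₀ K l p) (expo K l m)).comp (MonoidHom.fst _ _)

/-- The group `G^{F₀^{em}} ⋊ Ê`. -/
abbrev BigGroup (m : ℕ) : Type _ :=
  SemidirectProduct (fixedPoints (F₀ K l p ^ expo K l m)) (Ehat K l m) (EhatAction K l p m)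

/-- The image in `G^{F₀^{em}} ⋊ Ê` of `X^{F₀^{em}}`, for a subgroup `X` of `G`. -/
def emb (m : ℕ) (X : Subgroup (Spin K l)) : Subgroup (BigGroup K l p m) :=
  (X.subgroupOf (fixedPoints (F₀ K l p ^ expo K l m))).map SemidirectProduct.inl

/-- The product `X^{F₀^{em}} Ê`, for an `F₀`-stable subgroup `X` of `G`. -/
def mulEhat (m : ℕ) (X : Subgroup (Spin K l)) : Subgroup (BigGroup K l p m) :=
  emb K l p m X ⊔ (SemidirectProduct.inr : Ehat K l m →* BigGroup K l p m).range

/-- The element `v F̂` with `F̂ = F̂₀ ^ m`. -/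
def vFhat (m : ℕ) (v : Spin K l) (hv : v ∈ extWeyl K l) : BigGroup K l p m :=
  SemidirectProduct.inl ⟨v, extWeyl_le_fixedPoints K l p _ hv⟩ *
    SemidirectProduct.inr (Multiplicative.ofAdd 1, 1) ^ m

/-- `N̂`, the centralizer of `v F̂` in `N^{F₀^{em}} Ê`, where `N = N_G(S)`. -/
def Nhat (m : ℕ) (v : Spin K l) (hv : v ∈ extWeyl K l) (S : Subgroup (Spin K l)) :
    Subgroup (BigGroup K l p m) :=
  mulEhat K l p m (Subgroup.normalizer (S : Set (Spin K l))) ⊓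
    Subgroup.centralizer {vFhat K l p m v hv}

/-- `V̂_d = V Ê ∩ N̂`. -/
def Vhatd (m : ℕ) (v : Spin K l) (hv : v ∈ extWeyl K l) (S : Subgroup (Spin K l)) :
    Subgroup (BigGroup K l p m) :=
  mulEhat K l p m (extWeyl K l) ⊓ Nhat K l p m v hv S

/-- The group `E` of automorphisms of `G^F` generated by the restriction of `F₀` (and the graph
automorphisms, which are trivial here). -/
def E (m : ℕ) : Subgroup (MulAut (fixedPoints (F₀ K l p ^ m))) :=
  Subgroup.closure {resFixed (F₀ K l p) m}

/-- The condition of the regular-case criterion on the inclusion `H_d ⊴ V_d`, for an element `v` of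
`V`: for the Sylow `d`-torus `S` of `(T, vF)` and the group `V̂_d` that it determines, there is an
extension map `Λ₀` with respect to `H_d ⊴ V_d` such that
* `Λ₀` is `V̂_d`-equivariant;
* if `E` is non-cyclic, `Λ₀(θ)` extends for every `θ ∈ Irr(H_d)` to a character of `(V̂_d)_θ` whose
  kernel contains `v F̂`.
Here `H_d` and `V_d` are viewed inside `G^{F₀^{em}} ⋊ Ê`. -/
def ExtensionMapCondition (m d : ℕ) (v : Spin K l) (hv : v ∈ extWeyl K l) : Prop :=
  ∀ S : Subgroup (Spin K l), IsSylowDTorus K l p m v d S →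
    ∃ Λ₀ : (BigGroup K l p m → ℂ) → (BigGroup K l p m → ℂ),
      IsExtensionMap (emb K l p m (Hd K l p m v)) (emb K l p m (Vd K l p m v)) Λ₀ ∧
      IsEquivariantOn (emb K l p m (Hd K l p m v)) (Vhatd K l p m v hv S) Λ₀ ∧
      (¬ IsCyclic (E K l p m) → ∀ θ ∈ Irr (emb K l p m (Hd K l p m v)),
        ∃ χ ∈ Irr (inertia (emb K l p m (Hd K l p m v)) (Vhatd K l p m v hv S) θ),
          (∀ x ∈ inertia (emb K l p m (Hd K l p m v)) (emb K l p m (Vd K l p m v)) θ,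
            χ x = Λ₀ θ x) ∧
          χ (vFhat K l p m v hv) = χ 1)

end Frobenius

/-- An algebraic closure of the field with `p` elements. -/
abbrev Fbar (p : ℕ) [Fact p.Prime] : Type := AlgebraicClosure (ZMod p)

end TypeB

/-!
The Frobenius map fixes `V` pointwise and `Ê` centralizes `V`. So `V_d` and `H_d` are the
centralizers of `v` in `V` and in `H`, and `V̂_d` acts on `V_d` by inner automorphisms of `V_d`. As
`H` is elementary abelian of exponent two, the irreducible characters of `H_d` are sign characters,
and it suffices to extend each of them to a linear character of its inertia group
(`SignExtendible`). An equivariant extension map is then obtained by choosing extensions for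
representatives of the `V_d`-orbits on `Irr(H_d)` (`MaximalExtendibility.exists_equivariant`). There
are no graph automorphisms, so `E` is cyclic, and there is no condition on `V̂_d` beyond
equivariance (`maximalExtendibility_and_extensionMapCondition`).

To extend sign characters, `V` is realized in the even Clifford algebra, which is generated by
anticommuting elements `F_i`, `G_i` (`1 ≤ i ≤ l`) with `F_i² = -1`, `G_i² = 1`
(`antiSystem_clF_clG`). The elements of `V` permute the `F_i`, and in the same way the `G_i`, up to
signs (`isMonomial_of_mem_extWeyl`), and `H` is generated by `-1` and the products `p_i p_j` of the
commuting involutions `p_i = F_i G_i` (`toralPart_eq_closure`). A linear character of a group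
arises from a line in the algebra that is stable under left multiplication, or under conjugation
(`exists_hom_of_semiinvariant`). So for a sign character `θ` of `H` one looks for a line that its
inertia group stabilizes and on which `H` acts by `θ`.

* If `θ(-1) = 1`, then `θ` is given by a partition of the indices into two parts. The product of the
  `G_i` over a part is semi-invariant under conjugation by `H`, with character `θ`. Elements of `V`
  that fix `θ` preserve or exchange the parts. If there is an exchange, a suitable combination of
  both products spans a stable line, as the product of all `G_i` commutes with `V`.
* If `θ(-1) = -1`, then `θ` prescribes the eigenvalues of the `p_i` up to a common sign. A common
  eigenvector `ω` for these eigenvalues is a vacuum vector of a Clifford algebra, so its line is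
  determined by the eigenvalues (`exists_eigenvector`), and a combination of `ω` and `z ω` spans a
  stable line, where `z` is an element that commutes with `V` and negates all `p_i`.

This argument only uses the properties collected in `BlockSystem`. It applies to `H ≤ V`
(`blockSystemExtWeyl`), and also to `H_d ≤ V_d` if `4 ∣ d` (`blockSystemTwist`). In the latter case
`l = a b` with `a = 2l / d` and `b = d / 2` even. The element `v₀` acts as a shift on suitably
signed `F_n`, `G_n`, which are indexed by all natural numbers and are periodic, respectively
antiperiodic, modulo `l` (`shiftSystem`). The role of the `p_i` is taken by their products over the
residue classes modulo `a`, that of the `G_i` by products of reflections in differences of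
neighbours `F_n - F_{n+a}`, and that of `z` by `v` itself. The product of all these reflections,
multiplied by the corresponding product for the `G_n`, acts like `v` if `a` is even, so that both
products commute with `V_d` (`ShiftSystem.mul_prod_blk_f`).

If `4 ∤ d`, then an odd power `vⁿ` is a power of `v₀ˡ`, which negates all `p_i` and centralizes `H`
(`v₀_pow_comm`). Then sign characters of `H_d` extend to `H` along the norm map
`h ↦ h · vhv⁻¹ ⋯ vⁿ⁻¹hv¹⁻ⁿ`, and the extension is fixed by all elements of `V_d` that fix the
original character, which reduces the assertion to `H ≤ V` (`SignExtendible.of_odd`).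
-/

namespace TypeB

/-! ### Linear characters from semi-invariant lines -/

section Lines

/-- The group `ℂˣ` is divisible, so the faithful character of `{±1} ≤ Kˣ` extends to `Kˣ`. -/
theorem exists_unitsHom_complex_neg_one (K : Type*) [Field K] (h2 : (2 : K) ≠ 0) :
    ∃ Ψ : Kˣ →* ℂˣ, Ψ (-1) = -1 := by
  have hroot : ∀ n : ℕ, n ≠ 0 → Function.Surjective fun z : Additive ℂˣ => n • z := by
    intro n hn z
    obtain ⟨w, hw⟩ := IsAlgClosed.exists_pow_nat_eq (z.toMul : ℂ) (Nat.pos_of_ne_zero hn)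
    have hw0 : w ≠ 0 := by
      rintro rfl
      rw [zero_pow hn] at hw
      exact z.toMul.ne_zero hw.symm
    refine ⟨Additive.ofMul (Units.mk0 w hw0), ?_⟩
    apply Additive.toMul.injective
    ext
    simpa using hw
  let _ : DivisibleBy (Additive ℂˣ) ℕ := divisibleByOfSMulRightSurj _ _ (fun {n} hn => hroot n hn)
  let _ : DivisibleBy (Additive ℂˣ) ℤ := AddGroup.divisibleByIntOfDivisibleByNat _
  let f : ℤˣ →* Kˣ := Units.map (Int.castRingHom K).toMonoidHom
  let g : ℤˣ →* ℂˣ := Units.map (Int.castRingHom ℂ).toMonoidHom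
  have hf1 : f (-1) = -1 := by ext; simp [f]
  have hg1 : g (-1) = -1 := by ext; simp [g]
  have hne : (-1 : Kˣ) ≠ 1 := by
    intro h
    have h' : (-1 : K) = 1 := by simpa using congrArg Units.val h
    apply h2
    linear_combination -h'
  have hf : Function.Injective (MonoidHom.toAdditive f) := by
    rw [injective_iff_map_eq_zero]
    intro x hx
    apply Additive.toMul.injective
    have hx' : f x.toMul = 1 := congrArg Additive.toMul hx
    rcases Int.units_eq_one_or x.toMul with h | h
    · exact h
    · rw [h, hf1] at hx'
      exact absurd hx' hne
  obtain ⟨h, hh⟩ := (Module.Baer.of_divisible (Additive ℂˣ)).extension_property_addMonoidHom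
    (MonoidHom.toAdditive f) hf (MonoidHom.toAdditive g)
  refine ⟨MonoidHom.toAdditive.symm h, ?_⟩
  have := DFunLike.congr_fun hh (Additive.ofMul (-1))
  rw [← hf1, ← hg1]
  exact congrArg Additive.toMul this

variable {K R A : Type*} [Field K] [Ring R] [Algebra K R] [Group A]

/-- If `ψ` spans a line that is stable under `r ↦ ρ(x) r ρ'(x)⁻¹` for all `x ∈ S`, then `S` acts on
this line through a linear character. -/
theorem exists_hom_of_semiinvariant (ρ ρ' : A →* R) (S : Subgroup A) {ψ : R} (hψ : ψ ≠ 0)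
    (h : ∀ x ∈ S, ∃ c : K, ρ x * ψ = c • (ψ * ρ' x)) :
    ∃ χ : S →* Kˣ, ∀ (x : S) (c : K), ρ x * ψ = c • (ψ * ρ' x) ↔ (χ x : K) = c := by
  have hinv : ∀ (σ : A →* R) (x : A), σ x * σ x⁻¹ = 1 ∧ σ x⁻¹ * σ x = 1 := fun σ x =>
    ⟨by rw [← map_mul, mul_inv_cancel, map_one], by rw [← map_mul, inv_mul_cancel, map_one]⟩
  have hne : ∀ x : A, ψ * ρ' x ≠ 0 := by
    intro x h0
    apply hψ
    have : ψ * ρ' x * ρ' x⁻¹ = 0 := by rw [h0, zero_mul]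
    rwa [mul_assoc, (hinv ρ' x).1, mul_one] at this
  have huniq : ∀ (x : A) (c c' : K), c • (ψ * ρ' x) = c' • (ψ * ρ' x) → c = c' :=
    fun x c c' hc => smul_left_injective K (hne x) hc
  choose! c hc using h
  let χ₀ : S →* K :=
    { toFun := fun x => c x
      map_one' := by
        apply huniq 1
        have := hc 1 S.one_mem
        simp only [OneMemClass.coe_one, map_one, mul_one, one_mul, one_smul] at this ⊢
        exact this.symm
      map_mul' := fun x y => by
        apply huniq (x * y)
        rw [Subgroup.coe_mul, ← hc _ (S.mul_mem x.2 y.2), map_mul, map_mul, mul_assoc, hc _ y.2,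
          mul_smul_comm, ← mul_assoc, hc _ x.2, smul_mul_assoc, smul_smul, mul_assoc, mul_comm] }
  refine ⟨χ₀.toHomUnits, fun x c' => ?_⟩
  change _ ↔ c x = c'
  rw [hc _ x.2]
  exact ⟨huniq x _ _, fun h => by rw [h]⟩

end Lines

/-! ### Vacuum vectors -/

section Vacuum

variable {K R ι : Type*} [Field K] [Ring R] [Algebra K R]

/-- Anticommuting elements of square zero have a common left annihilated element. -/
theorem exists_vacuum [Nontrivial R] [DecidableEq ι] (b : ι → R) (hsq : ∀ i, b i * b i = 0)
    (hanti : ∀ i j, i ≠ j → b i * b j = -(b j * b i)) (s : Finset ι) :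
    ∃ ω : R, ω ≠ 0 ∧ ∀ i ∈ s, b i * ω = 0 := by
  induction s using Finset.induction_on with
  | empty => exact ⟨1, one_ne_zero, by simp⟩
  | insert i s hi ih =>
    obtain ⟨ω, h0, h⟩ := ih
    by_cases hb : b i * ω = 0
    · refine ⟨ω, h0, fun j hj => ?_⟩
      rcases Finset.mem_insert.1 hj with rfl | hj
      exacts [hb, h j hj]
    · refine ⟨b i * ω, hb, fun j hj => ?_⟩
      rcases Finset.mem_insert.1 hj with rfl | hj
      · rw [← mul_assoc, hsq, zero_mul]
      · rw [← mul_assoc, hanti j i (fun e => hi (e ▸ hj)), neg_mul, mul_assoc, h j hj,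
          mul_zero, neg_zero]

/-- The span of the products of the creation operators `c i`, `i ∈ S`, applied to `ω`. -/
def fock (K : Type*) [Field K] [Algebra K R] (c : ι → R) (ω : R) : List ι → Submodule K R
  | [] => Submodule.span K {ω}
  | i :: S => fock K c ω S ⊔ (fock K c ω S).map (LinearMap.mulLeft K (c i))

theorem mem_fock_cons {c : ι → R} {ω : R} {i : ι} {S : List ι} {y : R} :
    y ∈ fock K c ω (i :: S) ↔ ∃ a ∈ fock K c ω S, ∃ d ∈ fock K c ω S, y = a + c i * d := by
  simp only [fock, Submodule.mem_sup, Submodule.mem_map, LinearMap.mulLeft_apply]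
  constructor
  · rintro ⟨a, ha, _, ⟨d, hd, rfl⟩, rfl⟩
    exact ⟨a, ha, d, hd, rfl⟩
  · rintro ⟨a, ha, d, hd, rfl⟩
    exact ⟨a, ha, _, ⟨d, hd, rfl⟩, rfl⟩

/-- For annihilation operators `b i` and creation operators `c i` satisfying the canonical
anticommutation relations, the vacuum vector is unique up to scalars in the module that it
generates. -/
theorem exists_smul_of_vacuum [Fintype ι] {b c : ι → R} {κ : ι → K} (hκ : ∀ i, κ i ≠ 0)
    (hcsq : ∀ i, c i * c i = 0) (hcc : ∀ i j, i ≠ j → c i * c j = -(c j * c i))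
    (hbc : ∀ i j, i ≠ j → b i * c j = -(c j * b i))
    (hii : ∀ i, b i * c i = algebraMap K R (κ i) - c i * b i)
    {ω : R} (hω : ∀ i, b i * ω = 0) {x : R}
    (hx : x ∈ Algebra.adjoin K (Set.range b ∪ Set.range c)) (hxω : ∀ i, b i * (x * ω) = 0) :
    ∃ k : K, x * ω = k • ω := by
  classical
  -- All `b j`, and the `c j` with `j ∈ S`, preserve `fock S`.
  have hb : ∀ j S, ∀ y ∈ fock K c ω S, b j * y ∈ fock K c ω S := by
    intro j S
    induction S with
    | nil =>
      intro y hy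
      obtain ⟨k, rfl⟩ := Submodule.mem_span_singleton.1 hy
      rw [mul_smul_comm, hω, smul_zero]
      exact zero_mem _
    | cons i S ih =>
      intro y hy
      obtain ⟨a, ha, d, hd, rfl⟩ := mem_fock_cons.1 hy
      by_cases hij : j = i
      · subst hij
        refine mem_fock_cons.2 ⟨b j * a + κ j • d, add_mem (ih a ha) (Submodule.smul_mem _ _ hd),
          -(b j * d), neg_mem (ih d hd), ?_⟩
        rw [mul_add, ← mul_assoc, hii, sub_mul, Algebra.smul_def]
        noncomm_ring
      · refine mem_fock_cons.2 ⟨b j * a, ih a ha, -(b j * d), neg_mem (ih d hd), ?_⟩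
        rw [mul_add, ← mul_assoc, hbc j i hij]
        noncomm_ring
  have hc : ∀ j S, j ∈ S → ∀ y ∈ fock K c ω S, c j * y ∈ fock K c ω S := by
    intro j S
    induction S with
    | nil => intro hj; simp at hj
    | cons i S ih =>
      intro hj y hy
      obtain ⟨a, ha, d, hd, rfl⟩ := mem_fock_cons.1 hy
      by_cases hij : j = i
      · subst hij
        refine mem_fock_cons.2 ⟨0, zero_mem _, a, ha, ?_⟩
        rw [mul_add, ← mul_assoc, hcsq, zero_mul, add_zero, zero_add]
      · have hj' : j ∈ S := by
          rcases List.mem_cons.1 hj with h | h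
          exacts [absurd h hij, h]
        refine mem_fock_cons.2 ⟨c j * a, ih hj' a ha, -(c j * d), neg_mem (ih hj' d hd), ?_⟩
        rw [mul_add, ← mul_assoc, hcc j i hij]
        noncomm_ring
  have hkill : ∀ i S, i ∉ S → ∀ y ∈ fock K c ω S, b i * y = 0 := by
    intro i S
    induction S with
    | nil =>
      intro _ y hy
      obtain ⟨k, rfl⟩ := Submodule.mem_span_singleton.1 hy
      rw [mul_smul_comm, hω, smul_zero]
    | cons k S ih =>
      intro hi y hy
      obtain ⟨a, ha, d, hd, rfl⟩ := mem_fock_cons.1 hy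
      rw [List.mem_cons, not_or] at hi
      rw [mul_add, ih hi.2 a ha, ← mul_assoc, hbc i k hi.1, neg_mul, mul_assoc, ih hi.2 d hd]
      simp
  -- A vector `a + c i * d` killed by `b i` has `d = 0`, so the factors can be removed one by one.
  have hpeel : ∀ S : List ι, S.Nodup → ∀ y ∈ fock K c ω S, (∀ i ∈ S, b i * y = 0) →
      ∃ k : K, y = k • ω := by
    intro S
    induction S with
    | nil =>
      intro _ y hy _
      obtain ⟨k, rfl⟩ := Submodule.mem_span_singleton.1 hy
      exact ⟨k, rfl⟩
    | cons i S ih =>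
      intro hS y hy h
      obtain ⟨hi, hS⟩ := List.nodup_cons.1 hS
      obtain ⟨a, ha, d, hd, rfl⟩ := mem_fock_cons.1 hy
      have h1 := h i (by simp)
      rw [mul_add, hkill i S hi a ha, ← mul_assoc, hii, sub_mul, mul_assoc, hkill i S hi d hd,
        mul_zero, zero_add, sub_zero, ← Algebra.smul_def] at h1
      have hd0 : d = 0 := (smul_eq_zero.1 h1).resolve_left (hκ i)
      rw [hd0, mul_zero, add_zero] at h ⊢
      exact ih hS a ha fun j hj => h j (List.mem_cons_of_mem _ hj)
  have hω' : ∀ S : List ι, ω ∈ fock K c ω S := by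
    intro S
    induction S with
    | nil => exact Submodule.mem_span_singleton_self _
    | cons i S ih => exact mem_fock_cons.2 ⟨ω, ih, 0, zero_mem _, by simp⟩
  refine hpeel Finset.univ.toList (Finset.nodup_toList _) _ ?_ fun i _ => hxω i
  suffices h : ∀ y ∈ fock K c ω Finset.univ.toList, x * y ∈ fock K c ω Finset.univ.toList from
    h ω (hω' _)
  clear hxω
  induction hx using Algebra.adjoin_induction with
  | mem x hx =>
    rcases hx with ⟨i, rfl⟩ | ⟨i, rfl⟩
    · exact hb i _
    · exact hc i _ (by simp)
  | algebraMap k =>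
    intro y hy
    rw [← Algebra.smul_def]
    exact Submodule.smul_mem _ _ hy
  | add x y _ _ ihx ihy =>
    intro w hw
    rw [add_mul]
    exact add_mem (ihx w hw) (ihy w hw)
  | mul x y _ _ ihx ihy =>
    intro w hw
    rw [mul_assoc]
    exact ihx _ (ihy w hw)

end Vacuum

/-! ### Products of anticommuting elements -/

section Products

variable {R ι : Type*} [Ring R]

theorem exists_sign_of_perm {Q : ι → R} (hQ : ∀ j k, j ≠ k → Q j * Q k = -(Q k * Q j))
    {L L' : List ι} (h : L.Perm L') : ∃ ε : ℤˣ, (L.map Q).prod = ε • (L'.map Q).prod := by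
  induction h with
  | nil => exact ⟨1, by simp⟩
  | cons a _ ih =>
    obtain ⟨ε, h⟩ := ih
    exact ⟨ε, by rw [List.map_cons, List.map_cons, List.prod_cons, List.prod_cons, h,
      mul_smul_comm]⟩
  | swap a b L =>
    by_cases hab : a = b
    · exact ⟨1, by rw [hab, one_smul]⟩
    · refine ⟨-1, ?_⟩
      simp only [List.map_cons, List.prod_cons]
      rw [← mul_assoc, ← mul_assoc, hQ a b hab, neg_mul, Units.neg_smul, one_smul, neg_neg]
  | trans _ _ ih ih' =>
    obtain ⟨ε, h⟩ := ih
    obtain ⟨ε', h'⟩ := ih'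
    exact ⟨ε * ε', by rw [h, h', mul_smul]⟩

theorem exists_sign_mul_prod {x : R} {Q Q' : ι → R} {ν : ι → ℤˣ}
    (h : ∀ j, x * Q j = ν j • (Q' j * x)) (L : List ι) :
    ∃ ε : ℤˣ, x * (L.map Q).prod = ε • ((L.map Q').prod * x) := by
  induction L with
  | nil => exact ⟨1, by simp⟩
  | cons a L ih =>
    obtain ⟨ε, ih⟩ := ih
    refine ⟨ν a * ε, ?_⟩
    simp only [List.map_cons, List.prod_cons]
    rw [← mul_assoc, h, smul_mul_assoc, mul_assoc, ih, mul_smul_comm, mul_assoc, mul_smul]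

/-- If `x` anticommutes with one factor and commutes with the others, then it anticommutes with the
product if and only if this factor occurs. -/
theorem mul_prod_of_anticomm_one [DecidableEq ι] {x : R} {Q : ι → R} {j : ι}
    (h : ∀ k, x * Q k = if j = k then -(Q k * x) else Q k * x) {L : List ι} (hL : L.Nodup) :
    x * (L.map Q).prod = if j ∈ L then -((L.map Q).prod * x) else (L.map Q).prod * x := by
  induction L with
  | nil => simp
  | cons a L ih =>
    obtain ⟨ha, hL⟩ := List.nodup_cons.1 hL
    have ih := ih hL
    simp only [List.map_cons, List.prod_cons]
    rw [← mul_assoc, h]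
    by_cases hja : j = a
    · subst hja
      rw [if_neg ha] at ih
      rw [if_pos rfl, if_pos (by simp), neg_mul, mul_assoc, ih, mul_assoc]
    · rw [if_neg hja, mul_assoc, ih]
      by_cases hjL : j ∈ L
      · rw [if_pos hjL, if_pos (List.mem_cons_of_mem _ hjL), mul_neg, mul_assoc]
      · rw [if_neg hjL, if_neg (by simp [hja, hjL]), mul_assoc]

theorem isUnit_list_prod_map {Q : ι → R} (h : ∀ j, IsUnit (Q j)) (L : List ι) :
    IsUnit (L.map Q).prod := by
  induction L with
  | nil => simp
  | cons a L ih =>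
    rw [List.map_cons, List.prod_cons]
    exact (h a).mul ih

end Products

/-! ### Extension of sign characters in a block system -/

theorem eq_zero_of_add_self {K R : Type*} [Field K] [Ring R] [Algebra K R]
    (h2 : (2 : K) ≠ 0) {r : R} (h : r + r = 0) : r = 0 := by
  have : (2 : K) • r = 0 := by rw [two_smul, h]
  exact (smul_eq_zero.1 this).resolve_left h2

/-- Signed involutions `± P j` with different indices are different, because `P j` anticommutes with
exactly one `Q k`. -/
theorem eq_of_smul_eq_smul {K R ι : Type*} [Field K] [Ring R] [Algebra K R] [DecidableEq ι]
    [Nontrivial R] (h2 : (2 : K) ≠ 0) {P Q : ι → R} (hP : ∀ j, P j * P j = 1)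
    (hPQ : ∀ j k, P j * Q k = if j = k then -(Q k * P j) else Q k * P j) (hQ : ∀ j, IsUnit (Q j))
    {j k : ι} {u u' : ℤˣ} (h : u • P j = u' • P k) : j = k := by
  by_contra hjk
  have h1 := hPQ j j
  have h3 := hPQ k j
  rw [if_pos rfl] at h1
  rw [if_neg (Ne.symm hjk)] at h3
  have h4 : (u • P j) * Q j = -(Q j * (u • P j)) := by
    rw [smul_mul_assoc, h1, mul_smul_comm, smul_neg]
  rw [h, smul_mul_assoc, h3, mul_smul_comm, eq_neg_iff_add_eq_zero] at h4
  have h5 := eq_zero_of_add_self h2 h4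
  rw [smul_eq_zero_iff_eq, (hQ j).mul_right_eq_zero] at h5
  have h6 := hP k
  rw [h5, mul_zero] at h6
  exact zero_ne_one h6

theorem units_eq_of_smul_eq {K R : Type*} [Field K] [Ring R] [Algebra K R] [Nontrivial R]
    (h2 : (2 : K) ≠ 0) {r : R} (hr : IsUnit r) {u u' : ℤˣ} (h : u • r = u' • r) : u = u' := by
  have hne : r ≠ -r := fun h0 =>
    hr.ne_zero (eq_zero_of_add_self h2 (by nth_rw 2 [h0]; rw [add_neg_cancel]))
  rcases Int.units_eq_one_or u with rfl | rfl <;> rcases Int.units_eq_one_or u' with rfl | rfl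
  · rfl
  · rw [Units.neg_smul, one_smul] at h
    exact absurd h hne
  · rw [Units.neg_smul, one_smul] at h
    exact absurd h.symm hne
  · rfl

/-- A block system for subgroups `H ≤ V` of a group `A` represented in a `K`-algebra `R`: commuting
involutions `P j` and anticommuting units `Q j`, indexed by the blocks `j`, which `V` permutes up to
signs, where `H` is generated by `-1` and the products `P j * P k`. The element `flip` negates all
`P j` and commutes with `V`; for each choice of signs `s` there is a simultaneous eigenvector `ω` of
the `P j`, whose line is stable under those products of elements of `V` and `flip` that permute the
elements `s j • P j`. -/
structure BlockSystem (K : Type*) {R A : Type*} (ι : Type*) [Field K] [Ring R] [Algebra K R]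
    [Group A] [Fintype ι] [DecidableEq ι] (ρ : A →* R) (V H : Subgroup A) where
  /-- The involution attached to a block. -/
  P : ι → R
  /-- The odd unit attached to a block. -/
  Q : ι → R
  /-- The element `-1`. -/
  neg : A
  /-- The element `P j * P k`. -/
  pair : ι → ι → A
  /-- An element that negates all the involutions. -/
  flip : R
  P_sq : ∀ j, P j * P j = 1
  P_comm : ∀ j k, P j * P k = P k * P j
  P_Q : ∀ j k, P j * Q k = if j = k then -(Q k * P j) else Q k * P j
  Q_anti : ∀ j k, j ≠ k → Q j * Q k = -(Q k * Q j)
  Q_unit : ∀ j, IsUnit (Q j)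
  coe_neg : ρ neg = -1
  coe_pair : ∀ j k, ρ (pair j k) = P j * P k
  H_eq : H = Subgroup.closure (insert neg {g | ∃ j k, g = pair j k})
  H_le : H ≤ V
  monomial : ∀ x ∈ V, ∃ (π : ι → ι) (μ ν : ι → ℤˣ), ∀ j,
    ρ x * P j = μ j • (P (π j) * ρ x) ∧ ρ x * Q j = ν j • (Q (π j) * ρ x)
  prod_comm : Even (Fintype.card ι) → ∀ x ∈ V,
    ρ x * (Finset.univ.toList.map Q).prod = (Finset.univ.toList.map Q).prod * ρ x
  flip_unit : IsUnit flip
  flip_P : ∀ j, flip * P j = -(P j * flip)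
  flip_comm : ∀ x ∈ V, flip * ρ x = ρ x * flip
  vacuum : ∀ s : ι → ℤˣ, ∃ ω : R, ω ≠ 0 ∧ (∃ c : ℤˣ, ∀ j, P j * ω = (c * s j) • ω) ∧
    ∀ y ∈ Submonoid.closure (insert flip (ρ '' V)),
      (∀ j, ∃ k, y * (s j • P j) = (s k • P k) * y) → ∃ c : K, y * ω = c • ω

namespace BlockSystem

variable {K R A ι : Type*} [Field K] [Ring R] [Algebra K R] [Group A] [Fintype ι] [DecidableEq ι]
  {ρ : A →* R} {V H : Subgroup A} (B : BlockSystem K ι ρ V H)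

theorem neg_mem : B.neg ∈ H :=
  B.H_eq.ge (Subgroup.subset_closure (Set.mem_insert _ _))

theorem pair_mem (j k : ι) : B.pair j k ∈ H :=
  B.H_eq.ge (Subgroup.subset_closure (Set.mem_insert_of_mem _ ⟨j, k, rfl⟩))

theorem P_unit (j : ι) : IsUnit (B.P j) := ⟨⟨B.P j, B.P j, B.P_sq j, B.P_sq j⟩, rfl⟩

theorem coe_unit (ρ : A →* R) (x : A) : IsUnit (ρ x) := (Group.isUnit x).map ρ

/-- An element of `A` mapped to the sign `u`. -/
def signElt (u : ℤˣ) : A := if u = 1 then 1 else B.neg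

theorem coe_signElt (u : ℤˣ) : ρ (B.signElt u) = u • (1 : R) := by
  rcases Int.units_eq_one_or u with rfl | rfl
  · simp [signElt]
  · rw [signElt, if_neg (by decide), B.coe_neg, Units.neg_smul, one_smul]

theorem signElt_mem (u : ℤˣ) : B.signElt u ∈ H := by
  rw [signElt]
  split_ifs
  exacts [H.one_mem, B.neg_mem]

/-- The involutions `± P j` are pairwise different. -/
theorem eq_of_smul_P [Nontrivial R] (h2 : (2 : K) ≠ 0) {j k : ι} {u u' : ℤˣ}
    (h : u • B.P j = u' • B.P k) : j = k ∧ u = u' := by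
  obtain rfl := eq_of_smul_eq_smul h2 B.P_sq B.P_Q B.Q_unit h
  exact ⟨rfl, units_eq_of_smul_eq h2 (B.P_unit j) h⟩

theorem perm_injective [Nontrivial R] (h2 : (2 : K) ≠ 0) {x : A} {π : ι → ι} {μ : ι → ℤˣ}
    (h : ∀ j, ρ x * B.P j = μ j • (B.P (π j) * ρ x)) : Function.Injective π := by
  intro j k hjk
  have hj := h j
  have hk := h k
  rw [← hjk] at hk
  have h3 : ρ x * (μ j • B.P j) = ρ x * (μ k • B.P k) := by
    rw [mul_smul_comm, mul_smul_comm, hj, hk, smul_smul, smul_smul, Int.units_mul_self,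
      Int.units_mul_self]
  exact (B.eq_of_smul_P h2 ((coe_unit ρ x).mul_left_cancel h3)).1

/-- It suffices to compare a semi-invariant of `H` with a character on the generators of `H`. -/
theorem semiinvariant_of_generators (ρ' : A →* R) {ψ : R} (θ : H →* ℤˣ)
    (hneg : ρ B.neg * ψ = θ ⟨_, B.neg_mem⟩ • (ψ * ρ' B.neg))
    (hpair : ∀ j k, ρ (B.pair j k) * ψ = θ ⟨_, B.pair_mem j k⟩ • (ψ * ρ' (B.pair j k)))
    (h : H) : ρ h * ψ = θ h • (ψ * ρ' h) := by
  obtain ⟨h, hh⟩ := h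
  have key : ∀ g (hg : g ∈ Subgroup.closure (insert B.neg {g | ∃ j k, g = B.pair j k})),
      ρ g * ψ = θ ⟨g, B.H_eq ▸ hg⟩ • (ψ * ρ' g) := by
    intro g hg
    induction hg using Subgroup.closure_induction with
    | mem g hg =>
      rcases hg with rfl | ⟨j, k, rfl⟩
      · exact hneg
      · exact hpair j k
    | one =>
      have : θ ⟨1, H.one_mem⟩ = 1 := map_one θ
      rw [this, map_one, map_one, one_smul, one_mul, mul_one]
    | mul x y hx hy ihx ihy =>
      have hx' : x ∈ H := B.H_eq ▸ hx
      have hy' : y ∈ H := B.H_eq ▸ hy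
      have : θ ⟨x * y, H.mul_mem hx' hy'⟩ = θ ⟨x, hx'⟩ * θ ⟨y, hy'⟩ := map_mul θ ⟨x, hx'⟩ ⟨y, hy'⟩
      rw [this, map_mul, map_mul, mul_assoc, ihy, mul_smul_comm, ← mul_assoc, ihx, smul_mul_assoc,
        smul_smul, mul_assoc, mul_comm]
    | inv x hx ihx =>
      have hx' : x ∈ H := B.H_eq ▸ hx
      have : θ ⟨x⁻¹, H.inv_mem hx'⟩ = (θ ⟨x, hx'⟩)⁻¹ := map_inv θ ⟨x, hx'⟩
      rw [this]
      apply (coe_unit ρ x).mul_left_cancel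
      apply (coe_unit ρ' x).mul_right_cancel
      have e1 : ρ x * ρ x⁻¹ = 1 := by rw [← map_mul, mul_inv_cancel, map_one]
      have e2 : ρ' x⁻¹ * ρ' x = 1 := by rw [← map_mul, inv_mul_cancel, map_one]
      have e3 : ρ x * (ψ * ρ' x⁻¹) * ρ' x = ρ x * ψ * (ρ' x⁻¹ * ρ' x) := by
        simp only [mul_assoc]
      rw [mul_smul_comm, smul_mul_assoc, e3, e2, mul_one, ← mul_assoc, e1, one_mul, ihx,
        smul_smul, inv_mul_cancel, one_smul]
  exact key h (B.H_eq ▸ hh)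

theorem conj_pair (hρ : Function.Injective ρ) {x : A} {π : ι → ι} {μ : ι → ℤˣ}
    (h : ∀ j, ρ x * B.P j = μ j • (B.P (π j) * ρ x)) (j k : ι) :
    x * B.pair j k * x⁻¹ = B.signElt (μ j * μ k) * B.pair (π j) (π k) := by
  rw [mul_inv_eq_iff_eq_mul]
  apply hρ
  rw [map_mul, map_mul, map_mul, B.coe_pair, B.coe_pair, B.coe_signElt, ← mul_assoc, h,
    smul_mul_assoc, mul_assoc, h, mul_smul_comm, smul_smul, smul_mul_assoc, one_mul,
    smul_mul_assoc, mul_assoc]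

theorem pair_eq (hρ : Function.Injective ρ) (i j k : ι) :
    B.pair j k = B.pair i j * B.pair i k := by
  apply hρ
  rw [map_mul, B.coe_pair, B.coe_pair, B.coe_pair, B.P_comm i j, mul_assoc, ← mul_assoc (B.P i),
    B.P_sq, one_mul]

theorem map_signElt (θ : H →* ℤˣ) (u : ℤˣ) :
    θ ⟨B.signElt u, B.signElt_mem u⟩ = if θ ⟨_, B.neg_mem⟩ = 1 then 1 else u := by
  rcases Int.units_eq_one_or u with rfl | rfl
  · have : (⟨B.signElt 1, B.signElt_mem 1⟩ : H) = 1 := Subtype.ext (by simp [signElt])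
    rw [this, map_one]
    simp
  · have : (⟨B.signElt (-1), B.signElt_mem (-1)⟩ : H) = ⟨_, B.neg_mem⟩ :=
      Subtype.ext (by simp only [signElt]; exact if_neg (by decide))
    rw [this]
    split_ifs with h
    · exact h
    · exact (Int.units_eq_one_or _).resolve_left h

theorem intUnits_smul (u : ℤˣ) (r : R) : u • r = ((u : ℤ) : K) • r := by
  rcases Int.units_eq_one_or u with rfl | rfl <;> simp [Units.neg_smul]

/-- A nonzero semi-invariant on which `H` acts through `θ` yields an extension of `θ`. -/
theorem exists_hom_of_line (ρ' : A →* R) {S : Subgroup A} {ψ : R} (hψ : ψ ≠ 0)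
    (h : ∀ x ∈ S, ∃ c : K, ρ x * ψ = c • (ψ * ρ' x)) (θ : H →* ℤˣ)
    (hθ : ∀ h : H, ρ h * ψ = θ h • (ψ * ρ' h)) :
    ∃ χ : S →* Kˣ, ∀ (h : H) (hs : (h : A) ∈ S), (χ ⟨h, hs⟩ : K) = ((θ h : ℤ) : K) := by
  obtain ⟨χ, hχ⟩ := exists_hom_of_semiinvariant ρ ρ' S hψ h
  exact ⟨χ, fun h hs => (hχ ⟨h, hs⟩ _).1 (by rw [hθ, intUnits_smul (K := K)])⟩

/-- The product of the odd units over a set of blocks. -/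
def blockProd (D : Finset ι) : R := (D.toList.map B.Q).prod

theorem blockProd_unit (D : Finset ι) : IsUnit (B.blockProd D) := isUnit_list_prod_map B.Q_unit _

theorem P_mul_blockProd (j : ι) (D : Finset ι) :
    B.P j * B.blockProd D = if j ∈ D then -(B.blockProd D * B.P j) else B.blockProd D * B.P j := by
  have := mul_prod_of_anticomm_one (x := B.P j) (j := j) (B.P_Q j) (Finset.nodup_toList D)
  by_cases h : j ∈ D
  · rw [if_pos (by simpa using h)] at this
    rw [if_pos h]
    exact this
  · rw [if_neg (by simpa using h)] at this
    rw [if_neg h]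
    exact this

theorem exists_sign_mul_blockProd {x : A} {π : ι → ι} {ν : ι → ℤˣ} (hπ : Function.Injective π)
    (h : ∀ j, ρ x * B.Q j = ν j • (B.Q (π j) * ρ x)) {D D' : Finset ι} (hD : D.image π = D') :
    ∃ ε : ℤˣ, ρ x * B.blockProd D = ε • (B.blockProd D' * ρ x) := by
  obtain ⟨ε, hε⟩ := exists_sign_mul_prod (Q' := fun j => B.Q (π j)) h D.toList
  have hperm : (D.toList.map π).Perm D'.toList := by
    rw [List.perm_ext_iff_of_nodup ((Finset.nodup_toList D).map hπ) (Finset.nodup_toList D')]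
    intro a
    rw [← hD]
    simp
  obtain ⟨ε', hε'⟩ := exists_sign_of_perm B.Q_anti hperm
  refine ⟨ε * ε', ?_⟩
  rw [List.map_map] at hε'
  change ((D.toList.map fun j => B.Q (π j)).prod) = _ at hε'
  rw [blockProd, hε, hε', mul_smul, smul_mul_assoc, blockProd]

theorem exists_sign_blockProd_mul (D D' : Finset ι) (h : Disjoint D D') :
    ∃ ε : ℤˣ, B.blockProd D * B.blockProd D' = ε • B.blockProd (D ∪ D') := by
  have hperm : (D.toList ++ D'.toList).Perm (D ∪ D').toList := by
    rw [List.perm_ext_iff_of_nodup ?_ (Finset.nodup_toList _)]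
    · simp
    · rw [List.nodup_append']
      refine ⟨Finset.nodup_toList _, Finset.nodup_toList _, ?_⟩
      intro a ha hb
      exact Finset.disjoint_left.1 h (by simpa using ha) (by simpa using hb)
  obtain ⟨ε, hε⟩ := exists_sign_of_perm B.Q_anti hperm
  exact ⟨ε, by rw [blockProd, blockProd, blockProd, ← hε, List.map_append, List.prod_append]⟩

variable [Nonempty ι]

/-- The case of a character that is nontrivial on `-1`: the vacuum line attached to the signs
`s j = θ (P i * P j)` is stable up to `flip`, and a suitable combination of the two vacuum vectors
is semi-invariant. -/
theorem exists_extension_of_neg [IsAlgClosed K] (hρ : Function.Injective ρ) (h2 : (2 : K) ≠ 0)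
    {S : Subgroup A} (hSV : S ≤ V) (θ : H →* ℤˣ) (hneg : θ ⟨_, B.neg_mem⟩ = -1)
    (hS : ∀ x ∈ S, ∀ h : H, ∃ hx : x * h * x⁻¹ ∈ H, θ ⟨_, hx⟩ = θ h) :
    ∃ χ : S →* Kˣ, ∀ (h : H) (hs : (h : A) ∈ S), (χ ⟨h, hs⟩ : K) = ((θ h : ℤ) : K) := by
  classical
  let i : ι := Classical.arbitrary ι
  let s : ι → ℤˣ := fun j => θ ⟨_, B.pair_mem i j⟩
  have hs : ∀ j k, θ ⟨_, B.pair_mem j k⟩ = s j * s k := by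
    intro j k
    rw [← map_mul]
    congr 1
    exact Subtype.ext (B.pair_eq hρ i j k)
  obtain ⟨ω, hω0, ⟨c, hPω⟩, hω⟩ := B.vacuum s
  have hflip : B.flip ∈ Submonoid.closure (insert B.flip (ρ '' V)) :=
    Submonoid.subset_closure (Set.mem_insert _ _)
  have hmem : ∀ x ∈ V, ρ x ∈ Submonoid.closure (insert B.flip (ρ '' V)) := fun x hx =>
    Submonoid.subset_closure (Set.mem_insert_of_mem _ ⟨x, hx, rfl⟩)
  -- The square of `flip` fixes the vacuum line.
  obtain ⟨β, hβ⟩ := hω (B.flip * B.flip) (mul_mem hflip hflip) fun j => ⟨j, by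
    rw [mul_smul_comm, smul_mul_assoc, mul_assoc, B.flip_P, mul_neg, ← mul_assoc, B.flip_P,
      neg_mul, neg_neg, mul_assoc]⟩
  have hβ0 : β ≠ 0 := by
    rintro rfl
    rw [zero_smul] at hβ
    exact hω0 ((B.flip_unit.mul B.flip_unit).mul_right_eq_zero.1 hβ)
  -- `κ² = β⁻¹` makes `ω + κ • flip * ω` an eigenvector of `flip`.
  obtain ⟨κ, hκ⟩ := IsAlgClosed.exists_pow_nat_eq β⁻¹ (n := 2) (by norm_num)
  have hκ0 : κ ≠ 0 := by
    rintro rfl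
    rw [zero_pow (by norm_num)] at hκ
    exact inv_ne_zero hβ0 hκ.symm
  refine exists_hom_of_line (ρ := ρ) (1 : A →* R) (ψ := ω + κ • (B.flip * ω)) ?_ ?_ θ ?_
  · intro h0
    have h1 : B.P i * (ω + κ • (B.flip * ω)) = (c * s i) • (ω - κ • (B.flip * ω)) := by
      have h3 : B.P i * B.flip = -(B.flip * B.P i) := by rw [B.flip_P, neg_neg]
      rw [mul_add, hPω, mul_smul_comm, ← mul_assoc, h3, neg_mul, mul_assoc, hPω,
        mul_smul_comm, smul_neg, smul_sub, smul_comm κ, sub_eq_add_neg]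
    rw [h0, mul_zero, eq_comm, smul_eq_zero_iff_eq, sub_eq_zero] at h1
    rw [← h1] at h0
    exact hω0 (eq_zero_of_add_self h2 h0)
  · intro x hx
    simp only [MonoidHom.one_apply, mul_one]
    obtain ⟨π, μ, ν, hπ⟩ := B.monomial x (hSV hx)
    have hP := fun j => (hπ j).1
    -- Invariance of `θ` under `x` means that `x` preserves the signs up to a common sign.
    have hinv : ∀ j k, μ j * μ k * (s (π j) * s (π k)) = s j * s k := by
      intro j k
      obtain ⟨h1, h3⟩ := hS x hx ⟨_, B.pair_mem j k⟩
      rw [hs] at h3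
      rw [← h3, ← hs]
      have h4 : (⟨x * B.pair j k * x⁻¹, h1⟩ : H) =
          ⟨_, B.signElt_mem (μ j * μ k)⟩ * ⟨_, B.pair_mem (π j) (π k)⟩ :=
        Subtype.ext (B.conj_pair hρ hP j k)
      rw [h4, map_mul, B.map_signElt, hneg, if_neg (by decide)]
    have hcom := B.flip_comm x (hSV hx)
    have hconst : ∀ j, s (π j) = μ i * s (π i) * s i * (μ j * s j) := by
      intro j
      have := hinv i j
      generalize s i = a at *
      generalize s j = b at *
      generalize s (π i) = a' at *
      generalize s (π j) = b' at *
      generalize μ i = m at *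
      generalize μ j = m' at *
      revert a b a' b' m m'
      decide
    rcases Int.units_eq_one_or (μ i * s (π i) * s i) with ht | ht
    · obtain ⟨α, hα⟩ := hω (ρ x) (hmem x (hSV hx)) fun j => ⟨π j, by
        rw [mul_smul_comm, hP, smul_smul, hconst, ht, one_mul, smul_mul_assoc, mul_comm]⟩
      refine ⟨α, ?_⟩
      rw [mul_add, mul_smul_comm, ← mul_assoc, ← hcom, mul_assoc, hα, mul_smul_comm, smul_add,
        smul_comm κ]
    · obtain ⟨α, hα⟩ := hω (B.flip * ρ x) (mul_mem hflip (hmem x (hSV hx))) fun j => ⟨π j, by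
        rw [mul_smul_comm, mul_assoc, hP, mul_smul_comm, smul_smul, hconst, ht, ← mul_assoc,
          B.flip_P, smul_mul_assoc, neg_mul, smul_neg, mul_comm (s j), neg_one_mul,
          Units.neg_smul, mul_assoc]⟩
      have h3 : ρ x * (B.flip * ω) = α • ω := by rw [← mul_assoc, ← hcom, hα]
      have h4 : ρ x * ω = (β⁻¹ * α) • (B.flip * ω) := by
        have h5 : β • (ρ x * ω) = α • (B.flip * ω) := by
          rw [← mul_smul_comm, ← hβ, ← mul_smul_comm, ← hα]
          simp only [← mul_assoc]
          rw [← hcom, mul_assoc B.flip, ← hcom, ← mul_assoc]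
        rw [mul_smul, ← h5, smul_smul, inv_mul_cancel₀ hβ0, one_smul]
      refine ⟨κ * α, ?_⟩
      rw [mul_add, h4, mul_smul_comm, h3, smul_add, smul_smul, smul_smul, add_comm, ← hκ]
      congr 2
      ring
  · have hpair : ∀ j k, ρ (B.pair j k) * ω = (s j * s k) • ω := by
      intro j k
      rw [B.coe_pair, mul_assoc, hPω, mul_smul_comm, hPω, smul_smul]
      congr 1
      rw [mul_mul_mul_comm, Int.units_mul_self, one_mul, mul_comm]
    refine B.semiinvariant_of_generators (1 : A →* R) θ ?_ ?_
    · rw [hneg, B.coe_neg, Units.neg_smul, one_smul, neg_one_mul, MonoidHom.one_apply, mul_one]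
    · intro j k
      rw [hs, MonoidHom.one_apply, mul_one, mul_add, hpair, mul_smul_comm, ← mul_assoc,
        ← B.flip_comm _ (B.H_le (B.pair_mem j k)), mul_assoc, hpair, mul_smul_comm, smul_add,
        smul_comm κ]

/-- The case of a character that is trivial on `-1`: it is given by a partition of the blocks into
two parts, and the products of the `Q j` over the parts are semi-invariant under conjugation, up to
the possible exchange of the two parts. -/
theorem exists_extension_of_pos [IsAlgClosed K] [Nontrivial R] (hρ : Function.Injective ρ)
    (h2 : (2 : K) ≠ 0) {S : Subgroup A} (hSV : S ≤ V) (θ : H →* ℤˣ) (hneg : θ ⟨_, B.neg_mem⟩ = 1)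
    (hS : ∀ x ∈ S, ∀ h : H, ∃ hx : x * h * x⁻¹ ∈ H, θ ⟨_, hx⟩ = θ h) :
    ∃ χ : S →* Kˣ, ∀ (h : H) (hs : (h : A) ∈ S), (χ ⟨h, hs⟩ : K) = ((θ h : ℤ) : K) := by
  classical
  let i : ι := Classical.arbitrary ι
  let s : ι → ℤˣ := fun j => θ ⟨_, B.pair_mem i j⟩
  have hs : ∀ j k, θ ⟨_, B.pair_mem j k⟩ = s j * s k := by
    intro j k
    rw [← map_mul]
    congr 1
    exact Subtype.ext (B.pair_eq hρ i j k)
  let D : Finset ι := Finset.univ.filter fun j => s j = -1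
  let D' : Finset ι := Finset.univ.filter fun j => s j = 1
  have hDD : Disjoint D D' := by
    rw [Finset.disjoint_filter]
    intro j _ h1 h3
    rw [h1] at h3
    exact absurd h3 (by decide)
  have hun : D ∪ D' = Finset.univ := by
    ext j
    simp only [D, D', Finset.mem_union, Finset.mem_filter, Finset.mem_univ, true_and, iff_true]
    exact (Int.units_eq_one_or _).symm
  have hPD : ∀ j, B.P j * B.blockProd D = s j • (B.blockProd D * B.P j) := by
    intro j
    rw [P_mul_blockProd]
    rcases Int.units_eq_one_or (s j) with h | h
    · rw [if_neg (by simp [D, h]), h, one_smul]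
    · rw [if_pos (by simp [D, h]), h, Units.neg_smul, one_smul]
  have hPD' : ∀ j, B.P j * B.blockProd D' = -(s j • (B.blockProd D' * B.P j)) := by
    intro j
    rw [P_mul_blockProd]
    rcases Int.units_eq_one_or (s j) with h | h
    · rw [if_pos (by simp [D', h]), h, one_smul]
    · rw [if_neg (by simp [D', h]), h, Units.neg_smul, one_smul, neg_neg]
  have hpair : ∀ j k, ρ (B.pair j k) * B.blockProd D =
      (s j * s k) • (B.blockProd D * ρ (B.pair j k)) := by
    intro j k
    rw [B.coe_pair, mul_assoc, hPD, mul_smul_comm, ← mul_assoc, hPD, smul_mul_assoc, smul_smul,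
      mul_assoc, mul_comm]
  have hpair' : ∀ j k, ρ (B.pair j k) * B.blockProd D' =
      (s j * s k) • (B.blockProd D' * ρ (B.pair j k)) := by
    intro j k
    rw [B.coe_pair, mul_assoc, hPD', mul_neg, mul_smul_comm, ← mul_assoc, hPD', neg_mul, smul_neg,
      neg_neg, smul_mul_assoc, smul_smul, mul_assoc, mul_comm]
  -- An element that fixes `θ` preserves or exchanges the two parts.
  have hdata : ∀ x ∈ S, ∃ (π : ι → ι) (ν : ι → ℤˣ) (η : ℤˣ), Function.Injective π ∧
      (∀ j, ρ x * B.Q j = ν j • (B.Q (π j) * ρ x)) ∧ ∀ j, s (π j) = η * s j := by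
    intro x hx
    obtain ⟨π, μ, ν, hπ⟩ := B.monomial x (hSV hx)
    have hP := fun j => (hπ j).1
    refine ⟨π, ν, s (π i) * s i, B.perm_injective h2 hP, fun j => (hπ j).2, fun j => ?_⟩
    obtain ⟨h1, h3⟩ := hS x hx ⟨_, B.pair_mem i j⟩
    have h4 : (⟨x * B.pair i j * x⁻¹, h1⟩ : H) =
        ⟨_, B.signElt_mem (μ i * μ j)⟩ * ⟨_, B.pair_mem (π i) (π j)⟩ :=
      Subtype.ext (B.conj_pair hρ hP i j)
    rw [h4, map_mul, B.map_signElt, hneg, if_pos rfl, one_mul, hs, hs] at h3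
    generalize s i = a at *
    generalize s j = b at *
    generalize s (π i) = a' at *
    generalize s (π j) = b' at *
    revert a b a' b'
    decide
  have himage : ∀ (π : ι → ι) (E E' : Finset ι), Function.Injective π → (∀ j ∈ E, π j ∈ E') →
      E'.card ≤ E.card → E.image π = E' := by
    intro π E E' hπ hE hcard
    refine Finset.eq_of_subset_of_card_le (fun j hj => ?_) ?_
    · obtain ⟨k, hk, rfl⟩ := Finset.mem_image.1 hj
      exact hE k hk
    · rwa [Finset.card_image_of_injective _ hπ]
  have hfix : ∀ x ∈ S, ∀ (π : ι → ι) (ν : ι → ℤˣ), Function.Injective π →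
      (∀ j, ρ x * B.Q j = ν j • (B.Q (π j) * ρ x)) → (∀ j, s (π j) = s j) →
      (∃ ε : ℤˣ, ρ x * B.blockProd D = ε • (B.blockProd D * ρ x)) ∧
      ∃ ε : ℤˣ, ρ x * B.blockProd D' = ε • (B.blockProd D' * ρ x) := by
    intro x hx π ν hπ hν hsπ
    exact ⟨B.exists_sign_mul_blockProd hπ hν (himage π D D hπ (fun j hj => by
        simpa [D, hsπ] using hj) le_rfl),
      B.exists_sign_mul_blockProd hπ hν (himage π D' D' hπ (fun j hj => by
        simpa [D', hsπ] using hj) le_rfl)⟩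
  by_cases hswap : ∃ x ∈ S, ∃ (π : ι → ι), Function.Injective π ∧ ∀ j, s (π j) = -1 * s j
  · obtain ⟨x₀, hx₀, π₀, hπ₀, hsπ₀⟩ := hswap
    have hle : ∀ E E' : Finset ι, (∀ j ∈ E, π₀ j ∈ E') → E.card ≤ E'.card := by
      intro E E' h
      rw [← Finset.card_image_of_injective E hπ₀]
      refine Finset.card_le_card fun j hj => ?_
      obtain ⟨k, hk, rfl⟩ := Finset.mem_image.1 hj
      exact h k hk
    have hcard : D.card = D'.card := by
      refine le_antisymm (hle D D' fun j hj => ?_) (hle D' D fun j hj => ?_)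
      · have : s j = -1 := by simpa [D] using hj
        simp [D', hsπ₀, this]
      · have : s j = 1 := by simpa [D'] using hj
        simp [D, hsπ₀, this]
    have heven : Even (Fintype.card ι) := by
      rw [← Finset.card_univ, ← hun, Finset.card_union_of_disjoint hDD, hcard]
      exact ⟨_, rfl⟩
    obtain ⟨ε₁, hε₁⟩ := B.exists_sign_blockProd_mul D D' hDD
    obtain ⟨ε₂, hε₂⟩ := B.exists_sign_blockProd_mul D' D hDD.symm
    rw [Finset.union_comm, hun] at hε₂
    rw [hun] at hε₁
    have hcom : ∀ x ∈ S, ρ x * (B.blockProd D * B.blockProd D') =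
        B.blockProd D * B.blockProd D' * ρ x := by
      intro x hx
      rw [hε₁, mul_smul_comm, smul_mul_assoc]
      congr 1
      exact B.prod_comm heven x (hSV hx)
    -- `κ` is the sign by which the two products commute.
    obtain ⟨κ, hκ⟩ : ∃ κ : ℤˣ, B.blockProd D' * B.blockProd D =
        κ • (B.blockProd D * B.blockProd D') :=
      ⟨ε₂ * ε₁, by rw [hε₁, hε₂, smul_smul, mul_assoc, Int.units_mul_self, mul_one]⟩
    have hunit : ∀ x, IsUnit (B.blockProd D * B.blockProd D' * ρ x) := fun x =>
      ((B.blockProd_unit D).mul (B.blockProd_unit D')).mul (coe_unit ρ x)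
    have hone : ∀ (x : A) (u : ℤˣ), u • (B.blockProd D * B.blockProd D' * ρ x) =
        B.blockProd D * B.blockProd D' * ρ x → u = 1 := by
      intro x u hu
      rcases Int.units_eq_one_or u with h | h
      · exact h
      · rw [h, Units.neg_smul, one_smul] at hu
        exact absurd (eq_zero_of_add_self h2 (by nth_rw 1 [← hu]; simp)) (hunit x).ne_zero
    -- `ξ² = κ` makes an exchange of the two parts multiply the combination by a scalar.
    obtain ⟨ξ, hξ⟩ := IsAlgClosed.exists_pow_nat_eq ((κ : ℤ) : K) (n := 2) (by norm_num)
    refine exists_hom_of_line (ρ := ρ) ρ (ψ := B.blockProd D + ξ • B.blockProd D') ?_ ?_ θ ?_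
    · intro h0
      have hne : D.Nonempty := by
        rw [← Finset.card_pos]
        have h5 : 0 < Fintype.card ι := Fintype.card_pos
        rw [← Finset.card_univ, ← hun, Finset.card_union_of_disjoint hDD, ← hcard] at h5
        omega
      obtain ⟨j, hj⟩ := hne
      have hj' : s j = -1 := by simpa [D] using hj
      have h6 : B.P j * (B.blockProd D + ξ • B.blockProd D') =
          -((B.blockProd D - ξ • B.blockProd D') * B.P j) := by
        rw [mul_add, mul_smul_comm, hPD, hPD', hj']
        simp only [Units.neg_smul, one_smul, sub_mul, smul_mul_assoc, neg_neg]
        abel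
      rw [h0, mul_zero, eq_comm, neg_eq_zero, (B.P_unit j).mul_left_eq_zero, sub_eq_zero] at h6
      rw [← h6] at h0
      exact (B.blockProd_unit D).ne_zero (eq_zero_of_add_self h2 h0)
    · intro x hx
      obtain ⟨π, ν, η, hπ, hν, hsπ⟩ := hdata x hx
      rcases Int.units_eq_one_or η with rfl | rfl
      · obtain ⟨⟨e, he⟩, ⟨e', he'⟩⟩ := hfix x hx π ν hπ hν fun j => by rw [hsπ, one_mul]
        have h7 : e * e' = 1 := by
          apply hone x
          conv_rhs => rw [← hcom x hx]
          rw [← mul_assoc (ρ x), he, smul_mul_assoc, mul_assoc _ (ρ x), he',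
            mul_smul_comm, smul_smul, mul_assoc]
        refine ⟨((e : ℤ) : K), ?_⟩
        have h8 : e' = e := by
          rw [← one_mul e', ← Int.units_mul_self e, mul_assoc, h7, mul_one]
        rw [mul_add, mul_smul_comm, he, he', h8, intUnits_smul (K := K) e, intUnits_smul (K := K) e,
          add_mul, smul_mul_assoc, smul_add, smul_comm ξ]
      · obtain ⟨e, he⟩ := B.exists_sign_mul_blockProd hπ hν (himage π D D' hπ (fun j hj => by
          have : s j = -1 := by simpa [D] using hj
          simp [D', hsπ, this]) hcard.ge)
        obtain ⟨e', he'⟩ := B.exists_sign_mul_blockProd hπ hν (himage π D' D hπ (fun j hj => by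
          have : s j = 1 := by simpa [D'] using hj
          simp [D, hsπ, this]) hcard.le)
        have h7 : e * e' * κ = 1 := by
          apply hone x
          rw [mul_smul, ← smul_mul_assoc κ, ← hκ, ← hcom x hx, ← mul_assoc (ρ x), he,
            smul_mul_assoc, mul_assoc _ (ρ x), he', mul_smul_comm, smul_smul, mul_assoc]
        have h8 : e = e' * κ := by
          rw [← one_mul (e' * κ), ← Int.units_mul_self e, mul_assoc, ← mul_assoc e e', h7, mul_one]
        refine ⟨ξ * ((e' : ℤ) : K), ?_⟩
        have h9 : ((e : ℤ) : K) = ((e' : ℤ) : K) * ξ ^ 2 := by rw [h8, hξ]; push_cast; ring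
        rw [mul_add, mul_smul_comm, he, he', intUnits_smul (K := K) e,
          intUnits_smul (K := K) e', h9, add_mul, smul_mul_assoc, smul_add, smul_smul, smul_smul,
          add_comm]
        congr 2
        ring
    · refine B.semiinvariant_of_generators ρ θ ?_ ?_
      · rw [hneg, B.coe_neg]
        simp
      · intro j k
        rw [hs, mul_add, mul_smul_comm, hpair, hpair', add_mul, smul_mul_assoc, smul_add,
          smul_comm ξ]
  · refine exists_hom_of_line (ρ := ρ) ρ (ψ := B.blockProd D) (B.blockProd_unit D).ne_zero ?_ θ ?_
    · intro x hx
      obtain ⟨π, ν, η, hπ, hν, hsπ⟩ := hdata x hx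
      rcases Int.units_eq_one_or η with rfl | rfl
      · obtain ⟨⟨e, he⟩, -⟩ := hfix x hx π ν hπ hν fun j => by rw [hsπ, one_mul]
        exact ⟨((e : ℤ) : K), by rw [he, intUnits_smul (K := K)]⟩
      · exact absurd ⟨x, hx, π, hπ, hsπ⟩ hswap
    · refine B.semiinvariant_of_generators ρ θ ?_ ?_
      · rw [hneg, B.coe_neg]
        simp
      · intro j k
        rw [hs, hpair]

/-- In a block system every sign character of `H` extends to each subgroup of `V` that fixes it. -/
theorem exists_extension [IsAlgClosed K] [Nontrivial R] (B : BlockSystem K ι ρ V H)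
    (hρ : Function.Injective ρ) (h2 : (2 : K) ≠ 0)
    {S : Subgroup A} (hSV : S ≤ V) (θ : H →* ℤˣ)
    (hS : ∀ x ∈ S, ∀ h : H, ∃ hx : x * h * x⁻¹ ∈ H, θ ⟨_, hx⟩ = θ h) :
    ∃ χ : S →* Kˣ, ∀ (h : H) (hs : (h : A) ∈ S), (χ ⟨h, hs⟩ : K) = ((θ h : ℤ) : K) := by
  rcases Int.units_eq_one_or (θ ⟨_, B.neg_mem⟩) with h | h
  exacts [B.exists_extension_of_pos hρ h2 hSV θ h hS, B.exists_extension_of_neg hρ h2 hSV θ h hS]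

end BlockSystem

/-! ### Linear characters, maximal extendibility and equivariant extension maps -/

section Representations

theorem isIrreducible_iff {G M : Type*} [Group G] [AddCommGroup M] [Module ℂ M]
    (ρ : Representation ℂ G M) :
    ρ.IsIrreducible ↔ Nontrivial M ∧
      ∀ W : Submodule ℂ M, (∀ g, ∀ v ∈ W, ρ g v ∈ W) → W = ⊥ ∨ W = ⊤ := by
  have hbot : ∀ σ : Subrepresentation ρ, σ = ⊥ ↔ σ.toSubmodule = ⊥ := fun σ =>
    ⟨fun h => h ▸ rfl, fun h => Subrepresentation.toSubmodule_injective h⟩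
  have htop : ∀ σ : Subrepresentation ρ, σ = ⊤ ↔ σ.toSubmodule = ⊤ := fun σ =>
    ⟨fun h => h ▸ rfl, fun h => Subrepresentation.toSubmodule_injective h⟩
  constructor
  · intro h
    refine ⟨?_, fun W hW => ?_⟩
    · by_contra hM
      rw [not_nontrivial_iff_subsingleton] at hM
      apply bot_ne_top (α := Subrepresentation ρ)
      exact Subrepresentation.toSubmodule_injective (Subsingleton.elim _ _)
    · have := h.eq_bot_or_eq_top ⟨W, fun g v hv => hW g v hv⟩
      rwa [hbot, htop] at this
  · rintro ⟨h1, h2⟩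
    refine { exists_pair_ne := ⟨⊥, ⊤, ?_⟩, eq_bot_or_eq_top := fun σ => ?_ }
    · intro h
      exact bot_ne_top (α := Submodule ℂ M) ((htop ⊥).1 h)
    · rw [hbot, htop]
      exact h2 _ fun g v hv => σ.apply_mem_toSubmodule g hv

variable {A : Type*} [Group A]

/-- The function on `A` that a linear character of the subgroup `Y` defines. -/
def linFun {Y : Subgroup A} (φ : Y →* ℂˣ) : A → ℂ := by
  classical
  exact fun a => if h : a ∈ Y then φ ⟨a, h⟩ else 0

theorem linFun_apply {Y : Subgroup A} (φ : Y →* ℂˣ) (y : Y) : linFun φ y = φ y := by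
  rw [linFun, dif_pos y.2]

/-- A linear character is the character of a one-dimensional representation. -/
theorem linFun_mem_irr {Y : Subgroup A} (φ : Y →* ℂˣ) : linFun φ ∈ Irr Y := by
  refine ⟨fun a ha => dif_neg ha, 1, ?_⟩
  let ρ : Representation ℂ Y (Fin 1 → ℂ) :=
    { toFun := fun y => (φ y : ℂ) • LinearMap.id
      map_one' := by simp; rfl
      map_mul' := fun x y => by
        ext; simp; ring }
  refine ⟨ρ, ?_, fun y => ?_⟩
  · rw [isIrreducible_iff]
    refine ⟨inferInstance, fun W _ => ?_⟩
    have : IsSimpleModule ℂ (Fin 1 → ℂ) := isSimpleModule_iff_finrank_eq_one.2 (by simp)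
    exact eq_bot_or_eq_top W
  · rw [linFun_apply, Representation.character]
    change _ = LinearMap.trace ℂ (Fin 1 → ℂ) ((φ y : ℂ) • LinearMap.id)
    rw [map_smul, LinearMap.trace_id]
    simp

/-- By Schur's lemma, the irreducible characters of an abelian subgroup are linear. -/
theorem exists_hom_of_mem_irr {Y : Subgroup A} (hY : ∀ a ∈ Y, ∀ b ∈ Y, a * b = b * a) {θ : A → ℂ}
    (hθ : θ ∈ Irr Y) : ∃ φ : Y →* ℂˣ, ∀ y : Y, θ y = φ y := by
  obtain ⟨-, n, ρ, hρ, h⟩ := hθ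
  have : IsMulCommutative Y := ⟨⟨fun a b => Subtype.ext (hY a a.2 b b.2)⟩⟩
  have h1 : Module.finrank ℂ (Fin n → ℂ) = 1 :=
    Representation.IsIrreducible.finrank_eq_one_of_isMulCommutative ρ
  obtain ⟨v, hv, hspan⟩ := finrank_eq_one_iff'.1 h1
  have hc : ∀ y, ∃ c : ℂ, ρ y = c • LinearMap.id := by
    intro y
    obtain ⟨c, hc⟩ := hspan (ρ y v)
    refine ⟨c, LinearMap.ext fun w => ?_⟩
    obtain ⟨k, rfl⟩ := hspan w
    rw [map_smul, ← hc]
    simp only [LinearMap.smul_apply, LinearMap.id_apply]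
    rw [smul_comm]
  choose c hc using hc
  have hθc : ∀ y : Y, θ y = c y := by
    intro y
    rw [h, Representation.character, hc, map_smul, LinearMap.trace_id, h1]
    simp
  let χ : Y →* ℂ :=
    { toFun := c
      map_one' := by
        have := hc 1
        rw [map_one] at this
        have := LinearMap.congr_fun this v
        exact smul_left_injective ℂ hv (by simpa using this.symm)
      map_mul' := fun x y => by
        have := hc (x * y)
        rw [map_mul, hc, hc] at this
        have := LinearMap.congr_fun this v
        exact smul_left_injective ℂ hv (by simpa [smul_smul, mul_comm] using this.symm) }
  exact ⟨χ.toHomUnits, hθc⟩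

theorem irr_conj_mem {Z Z' : Subgroup A} {g : A} (hZ : ∀ a, a ∈ Z' ↔ g⁻¹ * a * g ∈ Z) {χ : A → ℂ}
    (hχ : χ ∈ Irr Z) : conjFun g χ ∈ Irr Z' := by
  obtain ⟨h0, n, ρ, hρ, h⟩ := hχ
  refine ⟨fun a ha => h0 _ fun h => ha ((hZ a).2 h), n, ?_⟩
  let f : Z' →* Z :=
    { toFun := fun a => ⟨g⁻¹ * a * g, (hZ a).1 a.2⟩
      map_one' := Subtype.ext (by simp)
      map_mul' := fun a b => Subtype.ext (by simp [mul_assoc]) }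
  have hf : Function.Surjective f := by
    rintro ⟨z, hz⟩
    exact ⟨⟨g * z * g⁻¹, (hZ _).2 (by simpa [mul_assoc] using hz)⟩,
      Subtype.ext (by simp [f, mul_assoc])⟩
  refine ⟨ρ.comp f, ?_, fun y => h (f y)⟩
  rw [isIrreducible_iff] at hρ ⊢
  refine ⟨hρ.1, fun W hW => hρ.2 W fun z v hv => ?_⟩
  obtain ⟨y, rfl⟩ := hf z
  exact hW y v hv

theorem conjFun_eq_self {Z : Subgroup A} {χ : A → ℂ} (hχ : χ ∈ Irr Z) {z : A} (hz : z ∈ Z) :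
    conjFun z χ = χ := by
  obtain ⟨h0, n, ρ, -, h⟩ := hχ
  funext a
  by_cases ha : a ∈ Z
  · have h1 := h ⟨a, ha⟩
    have h2 := h (⟨z, hz⟩⁻¹ * ⟨a, ha⟩ * ⟨z, hz⟩)
    have h3 := Representation.char_conj ρ ⟨a, ha⟩ ⟨z, hz⟩⁻¹
    rw [inv_inv] at h3
    rw [h3, ← h1] at h2
    exact h2
  · rw [h0 a ha]
    refine h0 _ fun h => ha ?_
    have := Z.mul_mem (Z.mul_mem hz h) (Z.inv_mem hz)
    simpa [mul_assoc] using this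

theorem conjFun_mul (g h : A) (θ : A → ℂ) : conjFun (g * h) θ = conjFun g (conjFun h θ) := by
  funext a
  simp [conjFun, mul_assoc]

theorem conjFun_one (θ : A → ℂ) : conjFun 1 θ = θ := by
  funext a
  simp [conjFun]

end Representations

section Extendibility

variable {A : Type*} [Group A]

theorem normalIn_iff {Y X : Subgroup A} :
    NormalIn Y X ↔ Y ≤ X ∧ ∀ x ∈ X, ∀ y ∈ Y, x * y * x⁻¹ ∈ Y := by
  refine and_congr_right fun _ => ⟨fun h x hx y hy => ?_, fun h x hx => ?_⟩
  · exact (Subgroup.mem_normalizer_iff.1 (h hx) y).1 hy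
  · refine Subgroup.mem_normalizer_iff.2 fun y => ⟨fun hy => h x hx y hy, fun hy => ?_⟩
    have := h x⁻¹ (X.inv_mem hx) _ hy
    simpa [mul_assoc] using this

/-- Every character `Y → {±1}` extends to a `Kˣ`-valued character of each subgroup of `X` that fixes
it. -/
def SignExtendible (K : Type*) [Field K] (Y X : Subgroup A) : Prop :=
  ∀ (θ : Y →* ℤˣ) (S : Subgroup A), S ≤ X →
    (∀ x ∈ S, ∀ y : Y, ∃ hx : x * y * x⁻¹ ∈ Y, θ ⟨_, hx⟩ = θ y) →
    ∃ χ : S →* Kˣ, ∀ (y : Y) (hs : (y : A) ∈ S), (χ ⟨y, hs⟩ : K) = ((θ y : ℤ) : K)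

/-- If `Y` has exponent two, its irreducible characters are sign characters, and the values of
their extensions can be transported from `Kˣ` to `ℂˣ`. -/
theorem SignExtendible.maximalExtendibility {K : Type*} [Field K] (h2 : (2 : K) ≠ 0)
    {Y X : Subgroup A} (hYX : NormalIn Y X) (hsq : ∀ y ∈ Y, y * y = 1)
    (h : SignExtendible K Y X) : MaximalExtendibility Y X := by
  have hc : ∀ a ∈ Y, ∀ b ∈ Y, a * b = b * a := by
    intro a ha b hb
    have h1 := hsq _ (Y.mul_mem ha hb)
    rw [mul_eq_one_iff_eq_inv, mul_inv_rev, inv_eq_of_mul_eq_one_right (hsq a ha),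
      inv_eq_of_mul_eq_one_right (hsq b hb)] at h1
    exact h1
  refine ⟨hYX, fun θ hθ => ?_⟩
  obtain ⟨φ, hφ⟩ := exists_hom_of_mem_irr hc hθ
  have hval : ∀ y, φ y = 1 ∨ φ y = -1 := by
    intro y
    have h1 : φ y * φ y = 1 := by
      rw [← map_mul, show y * y = 1 from Subtype.ext (hsq y y.2), map_one]
    have h3 : (φ y : ℂ) * φ y = 1 := by rw [← Units.val_mul, h1, Units.val_one]
    rcases mul_self_eq_one_iff.1 h3 with h4 | h4
    · exact Or.inl (Units.ext h4)
    · exact Or.inr (Units.ext h4)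
  have hne : (-1 : ℂˣ) ≠ 1 := by
    intro h
    have := congrArg Units.val h
    norm_num at this
  classical
  let θ' : Y →* ℤˣ :=
    { toFun := fun y => if φ y = 1 then 1 else -1
      map_one' := by simp
      map_mul' := fun x y => by
        rcases hval x with hx | hx <;> rcases hval y with hy | hy <;> simp [hx, hy, hne] }
  have hθ' : ∀ y, (φ y : ℂ) = ((θ' y : ℤ) : ℂ) := by
    intro y
    rcases hval y with hy | hy <;> simp [θ', hy, hne]
  have hSX : inertia Y X θ ≤ X := fun x hx => hx.1
  obtain ⟨χ, hχ⟩ := h θ' (inertia Y X θ) hSX fun x hx y => by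
    have hxy := (normalIn_iff.1 hYX).2 x hx.1 y y.2
    refine ⟨hxy, ?_⟩
    have h1 := congrFun hx.2.2 (x * y * x⁻¹)
    have h3 : φ ⟨_, hxy⟩ = φ y := by
      apply Units.ext
      rw [← hφ, ← hφ]
      simp only [conjFun] at h1
      rw [← h1]
      congr 1
      group
    simp only [θ', MonoidHom.coe_mk, OneHom.coe_mk, h3]
  obtain ⟨Ψ, hΨ⟩ := exists_unitsHom_complex_neg_one K h2
  refine ⟨linFun (Ψ.comp χ), linFun_mem_irr _, fun y hy => ?_⟩
  have hyS : y ∈ inertia Y X θ := by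
    refine ⟨hYX.1 hy, Subgroup.le_normalizer hy, ?_⟩
    exact conjFun_eq_self hθ hy
  rw [show y = ((⟨y, hyS⟩ : inertia Y X θ) : A) from rfl, linFun_apply]
  have h1 := hχ ⟨y, hy⟩ hyS
  have h3 := hφ ⟨y, hy⟩
  rw [hθ'] at h3
  change ((Ψ (χ ⟨y, hyS⟩) : ℂˣ) : ℂ) = θ y
  change θ y = _ at h3
  rw [h3]
  rcases Int.units_eq_one_or (θ' ⟨y, hy⟩) with h4 | h4
  · rw [h4] at h1 ⊢
    have : χ ⟨y, hyS⟩ = 1 := Units.ext (by simpa using h1)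
    rw [this]
    simp
  · rw [h4] at h1 ⊢
    have : χ ⟨y, hyS⟩ = -1 := Units.ext (by simpa using h1)
    rw [this, hΨ]
    simp

/-- Transport of `SignExtendible` along an injective homomorphism. -/
theorem SignExtendible.map {B : Type*} [Group B] {K : Type*} [Field K] {Y X : Subgroup A}
    (hYX : Y ≤ X) (h : SignExtendible K Y X) (g : X →* B) (hg : Function.Injective g) :
    SignExtendible K ((Y.subgroupOf X).map g) g.range := by
  intro θ S hS hinv
  let θ₀ : Y →* ℤˣ := θ.comp
    { toFun := fun y => ⟨g ⟨y, hYX y.2⟩, ⟨⟨y, hYX y.2⟩, y.2, rfl⟩⟩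
      map_one' := Subtype.ext (map_one g)
      map_mul' := fun a b => Subtype.ext (map_mul g ⟨a, hYX a.2⟩ ⟨b, hYX b.2⟩) }
  obtain ⟨χ, hχ⟩ := h θ₀ ((S.comap g).map X.subtype)
    (by rintro _ ⟨x, -, rfl⟩; exact x.2) (by
      rintro _ ⟨x, hx, rfl⟩ y
      obtain ⟨⟨z, hz, hz'⟩, h3⟩ := hinv (g x) hx ⟨g ⟨y, hYX y.2⟩, ⟨⟨y, hYX y.2⟩, y.2, rfl⟩⟩
      have h4 : z = x * ⟨y, hYX y.2⟩ * x⁻¹ := by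
        apply hg
        rw [hz', map_mul, map_mul, map_inv]
      refine ⟨?_, ?_⟩
      · have := hz
        rw [h4] at this
        exact this
      · rw [← show _ = θ₀ y from h3]
        change θ _ = θ _
        congr 1
        apply Subtype.ext
        change g (x * ⟨y, hYX y.2⟩ * x⁻¹) = g x * g ⟨y, hYX y.2⟩ * (g x)⁻¹
        rw [map_mul, map_mul, map_inv])
  let e := MonoidHom.ofInjective hg
  have he : ∀ s (hs : s ∈ g.range), g (e.symm ⟨s, hs⟩) = s := fun s hs =>
    congrArg Subtype.val (e.apply_symm_apply ⟨s, hs⟩)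
  let f : S →* ((S.comap g).map X.subtype : Subgroup A) :=
    { toFun := fun s => ⟨e.symm ⟨s, hS s.2⟩, ⟨_, by
        change g _ ∈ S
        rw [he]
        exact s.2, rfl⟩⟩
      map_one' := Subtype.ext (by
        change ((e.symm 1 : X) : A) = 1
        rw [map_one]
        rfl)
      map_mul' := fun s t => Subtype.ext (by
        change ((e.symm (⟨s, hS s.2⟩ * ⟨t, hS t.2⟩) : X) : A) = _
        rw [map_mul]
        rfl) }
  refine ⟨χ.comp f, ?_⟩
  rintro ⟨_, ⟨y, hy, rfl⟩⟩ hs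
  have h3 : e.symm ⟨g y, hS hs⟩ = y := hg (he _ _)
  have h4 : f ⟨g y, hs⟩ = ⟨y, ⟨y, hs, rfl⟩⟩ := by
    apply Subtype.ext
    change ((e.symm ⟨g y, hS hs⟩ : X) : A) = y
    rw [h3]
  rw [MonoidHom.comp_apply, h4]
  exact hχ ⟨y, hy⟩ _

theorem inertia_conjFun_iff {Y X : Subgroup A} {θ : A → ℂ} {x : A}
    (hx : x ∈ X) (hn : X ≤ Subgroup.normalizer (Y : Set A)) (a : A) :
    a ∈ inertia Y X (conjFun x θ) ↔ x⁻¹ * a * x ∈ inertia Y X θ := by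
  have key : ∀ a, a ∈ X → (conjFun a (conjFun x θ) = conjFun x θ ↔
      conjFun (x⁻¹ * a * x) θ = θ) := by
    intro a _
    rw [conjFun_mul, conjFun_mul]
    constructor
    · intro h
      rw [h, ← conjFun_mul, inv_mul_cancel, conjFun_one]
    · intro h
      have := congrArg (conjFun x) h
      rwa [← conjFun_mul, mul_inv_cancel, conjFun_one] at this
  constructor
  · rintro ⟨h1, -, h3⟩
    have h4 := X.mul_mem (X.mul_mem (X.inv_mem hx) h1) hx
    exact ⟨h4, hn h4, (key a h1).1 h3⟩
  · rintro ⟨h1, -, h3⟩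
    have h4 : a ∈ X := by
      have := X.mul_mem (X.mul_mem hx h1) (X.inv_mem hx)
      simpa [mul_assoc] using this
    exact ⟨h4, hn h4, (key a h4).2 h3⟩

/-- Under maximal extendibility, extensions chosen for representatives of the `X`-orbits on `Irr(Y)`
define an extension map that is equivariant under every group acting on `X` by inner
automorphisms. -/
theorem MaximalExtendibility.exists_equivariant {Y X : Subgroup A} (h : MaximalExtendibility Y X)
    (B : Subgroup A) (hB : ∀ b ∈ B, ∃ x ∈ X, ∀ y ∈ X, b * y * b⁻¹ = x * y * x⁻¹) :
    ∃ Λ : (A → ℂ) → (A → ℂ), IsExtensionMap Y X Λ ∧ IsEquivariantOn Y B Λ := by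
  obtain ⟨⟨hYX, hn⟩, hext⟩ := h
  choose! Λ₁ hΛ₁ hΛ₁Y using hext
  -- the orbits of `X` on functions, with representatives `rep θ` and `θ = conjFun (t θ) (rep θ)`
  let r : Setoid (A → ℂ) :=
    { r := fun θ θ' => ∃ x ∈ X, conjFun x θ = θ'
      iseqv :=
        { refl := fun θ => ⟨1, X.one_mem, conjFun_one θ⟩
          symm := by
            rintro θ _ ⟨x, hx, rfl⟩
            exact ⟨x⁻¹, X.inv_mem hx, by rw [← conjFun_mul, inv_mul_cancel, conjFun_one]⟩
          trans := by
            rintro θ _ _ ⟨x, hx, rfl⟩ ⟨y, hy, rfl⟩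
            exact ⟨y * x, X.mul_mem hy hx, conjFun_mul _ _ _⟩ } }
  let rep : (A → ℂ) → (A → ℂ) := fun θ => (Quotient.mk r θ).out
  have hrep : ∀ θ, ∃ x ∈ X, conjFun x (rep θ) = θ := fun θ => Quotient.mk_out (s := r) θ
  have hrep' : ∀ x ∈ X, ∀ θ, rep (conjFun x θ) = rep θ := fun x hx θ =>
    congrArg Quotient.out (Quotient.sound (s := r) ⟨x, hx, rfl⟩).symm
  choose t htX ht using hrep
  have hXY : ∀ x ∈ X, ∀ a, a ∈ Y ↔ x⁻¹ * a * x ∈ Y := by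
    intro x hx a
    have := Subgroup.mem_normalizer_iff.1 (hn (X.inv_mem hx)) a
    rwa [inv_inv] at this
  have hrepIrr : ∀ θ ∈ Irr Y, rep θ ∈ Irr Y := by
    intro θ hθ
    have : rep θ = conjFun (t θ)⁻¹ θ := by
      nth_rw 3 [← ht θ]
      rw [← conjFun_mul, inv_mul_cancel, conjFun_one]
    rw [this]
    exact irr_conj_mem (hXY _ (X.inv_mem (htX θ))) hθ
  let Λ : (A → ℂ) → (A → ℂ) := fun θ => conjFun (t θ) (Λ₁ (rep θ))
  -- The value at `θ` does not depend on the element that carries the representative to `θ`.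
  have hΛ : ∀ θ ∈ Irr Y, ∀ x ∈ X, conjFun x (rep θ) = θ → Λ θ = conjFun x (Λ₁ (rep θ)) := by
    intro θ hθ x hx hxθ
    have hmem : x⁻¹ * t θ ∈ inertia Y X (rep θ) := by
      refine ⟨X.mul_mem (X.inv_mem hx) (htX θ), hn (X.mul_mem (X.inv_mem hx) (htX θ)), ?_⟩
      rw [conjFun_mul, ht]
      nth_rw 1 [← hxθ]
      rw [← conjFun_mul, inv_mul_cancel, conjFun_one]
    have := conjFun_eq_self (hΛ₁ _ (hrepIrr θ hθ)) hmem
    rw [← this, ← conjFun_mul, mul_inv_cancel_left]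
  have hΛIrr : ∀ θ ∈ Irr Y, Λ θ ∈ Irr (inertia Y X θ) := by
    intro θ hθ
    refine irr_conj_mem (Z := inertia Y X (rep θ)) (fun a => ?_) (hΛ₁ _ (hrepIrr θ hθ))
    conv_lhs => rw [← ht θ]
    exact inertia_conjFun_iff (htX θ) hn a
  have hsupp : ∀ (χ : A → ℂ) b x, b ∈ B → x ∈ X → (∀ y ∈ X, b * y * b⁻¹ = x * y * x⁻¹) →
      (∀ a, a ∉ X → χ a = 0) → conjFun b χ = conjFun x χ := by
    intro χ b x hb hx hbx hχ
    have hin : ∀ y ∈ X, b⁻¹ * (x * y * x⁻¹) * b = y := by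
      intro y hy
      rw [← hbx y hy]
      group
    funext a
    by_cases ha : a ∈ X
    · have h1 := hin (x⁻¹ * a * x) (X.mul_mem (X.mul_mem (X.inv_mem hx) ha) hx)
      have h2 : x * (x⁻¹ * a * x) * x⁻¹ = a := by group
      rw [h2] at h1
      rw [conjFun, conjFun, h1]
    · rw [conjFun, conjFun, hχ, hχ]
      · intro h
        apply ha
        have := X.mul_mem (X.mul_mem hx h) (X.inv_mem hx)
        simpa [mul_assoc] using this
      · intro h
        apply ha
        have h1 := hbx _ h
        have h2 : b * (b⁻¹ * a * b) * b⁻¹ = a := by group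
        rw [h2] at h1
        rw [h1]
        exact X.mul_mem (X.mul_mem hx h) (X.inv_mem hx)
  refine ⟨Λ, ⟨⟨hYX, hn⟩, fun θ hθ => ⟨hΛIrr θ hθ, fun y hy => ?_⟩⟩, fun b hb θ hθ => ?_⟩
  · have h1 := hΛ₁Y _ (hrepIrr θ hθ) _ ((hXY _ (htX θ) y).1 hy)
    change Λ₁ (rep θ) ((t θ)⁻¹ * y * t θ) = θ y
    rw [h1]
    exact congrFun (ht θ) y
  · obtain ⟨x, hx, hbx⟩ := hB b hb
    rw [hsupp θ b x hb hx hbx fun a ha => hθ.1 a fun h => ha (hYX h),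
      hsupp (Λ θ) b x hb hx hbx fun a ha => (hΛIrr θ hθ).1 a fun h => ha h.1]
    have h1 := hΛ (conjFun x θ) (irr_conj_mem (hXY x hx) hθ) (x * t θ) (X.mul_mem hx (htX θ)) (by
      rw [hrep' x hx, conjFun_mul, ht])
    rw [h1, hrep' x hx, conjFun_mul]

end Extendibility

/-! ### The group `V̂_d` acts on `V_d` by inner automorphisms -/

section BigGroup

variable (K : Type*) [Field K] (l p : ℕ) [ExpChar K p] [PerfectRing K p]

theorem cyclicAction_apply_of_fixed {A : Type*} [Group A] (φ : MulAut A) (n : ℕ)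
    (c : Multiplicative (ZMod n)) (a : fixedPoints (φ ^ n)) (ha : φ a = a) :
    cyclicAction φ n c a = a := by
  obtain ⟨k, hk⟩ := ZMod.intCast_surjective c.toAdd
  have h1 : resFixed φ n a = a := Subtype.ext ha
  have h2 : cyclicAction φ n c = resFixed φ n ^ k := by
    have : c = Multiplicative.ofAdd (k : ZMod n) := by rw [hk]; rfl
    rw [this]
    simp [cyclicAction]
  rw [h2]
  have h3 : ∀ k : ℕ, (resFixed φ n ^ k) a = a := by
    intro k
    induction k with
    | zero => rfl
    | succ k ih => rw [pow_succ, MulAut.mul_apply, h1, ih]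
  obtain ⟨k, rfl | rfl⟩ := k.eq_nat_or_neg
  · rw [zpow_natCast, h3]
  · rw [zpow_neg, zpow_natCast]
    conv_lhs => rw [← h3 k]
    exact MulAut.inv_apply_self _ _ _

/-- `Ê` acts through powers of `F₀`, which fixes the generators `n_α(1)` of `V`. -/
theorem EhatAction_apply_of_mem (m : ℕ) (c : Ehat K l m)
    (a : fixedPoints (F₀ K l p ^ expo K l m)) (ha : (a : Spin K l) ∈ extWeyl K l) :
    EhatAction K l p m c a = a :=
  cyclicAction_apply_of_fixed _ _ _ _ (F₀_fixes_extWeyl K l p ha)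

theorem left_mem_of_mem_mulEhat (m : ℕ) {b : BigGroup K l p m}
    (hb : b ∈ mulEhat K l p m (extWeyl K l)) : (b.left : Spin K l) ∈ extWeyl K l := by
  let W : Subgroup (BigGroup K l p m) :=
    { carrier := {b | (b.left : Spin K l) ∈ extWeyl K l}
      one_mem' := (extWeyl K l).one_mem
      mul_mem' := fun {b c} hb hc => by
        change ((b * c).left : Spin K l) ∈ extWeyl K l
        rw [SemidirectProduct.mul_left, EhatAction_apply_of_mem K l p m _ _ hc]
        exact (extWeyl K l).mul_mem hb hc
      inv_mem' := fun {b} hb => by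
        change ((b⁻¹).left : Spin K l) ∈ extWeyl K l
        have : ((b.left⁻¹ : fixedPoints (F₀ K l p ^ expo K l m)) : Spin K l) ∈ extWeyl K l :=
          (extWeyl K l).inv_mem hb
        rw [SemidirectProduct.inv_left, EhatAction_apply_of_mem K l p m _ _ this]
        exact this }
  have : mulEhat K l p m (extWeyl K l) ≤ W := by
    refine sup_le ?_ ?_
    · rintro _ ⟨x, hx, rfl⟩
      exact hx
    · rintro _ ⟨c, rfl⟩
      exact (extWeyl K l).one_mem
  exact this hb

theorem mem_Vd_iff (m : ℕ) {v x : Spin K l} :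
    x ∈ Vd K l p m v ↔ x ∈ extWeyl K l ∧ v * x = x * v := by
  refine and_congr_right fun hx => ?_
  change twistedF K l p m v x = x ↔ _
  rw [twistedF, MulAut.mul_apply]
  have : (F₀ K l p ^ m) x = x := extWeyl_le_fixedPoints K l p m hx
  rw [this, MulAut.conj_apply, mul_inv_eq_iff_eq_mul]

theorem mem_Hd_iff (m : ℕ) {v x : Spin K l} :
    x ∈ Hd K l p m v ↔ x ∈ toralPart K l ∧ v * x = x * v := by
  refine and_congr_right fun hx => ?_
  have := mem_Vd_iff K l p m (v := v) (x := x)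
  rw [Vd, Subgroup.mem_inf] at this
  have hx' : x ∈ extWeyl K l := hx.2
  simpa [hx'] using this

theorem Hd_le_Vd (m : ℕ) (v : Spin K l) : Hd K l p m v ≤ Vd K l p m v :=
  inf_le_inf_right _ inf_le_right

/-- The embedding of `V_d` into `G^{F₀^{em}} ⋊ Ê`. -/
def embVd (m : ℕ) (v : Spin K l) : Vd K l p m v →* BigGroup K l p m :=
  SemidirectProduct.inl.comp
    (Subgroup.inclusion (inf_le_left.trans (extWeyl_le_fixedPoints K l p (expo K l m))))

theorem emb_Vd (m : ℕ) (v : Spin K l) : emb K l p m (Vd K l p m v) = (embVd K l p m v).range := by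
  ext b
  constructor
  · rintro ⟨x, hx, rfl⟩
    exact ⟨⟨x, hx⟩, rfl⟩
  · rintro ⟨x, rfl⟩
    exact ⟨⟨x, _⟩, x.2, rfl⟩

theorem emb_Hd (m : ℕ) (v : Spin K l) : emb K l p m (Hd K l p m v) =
    ((Hd K l p m v).subgroupOf (Vd K l p m v)).map (embVd K l p m v) := by
  ext b
  constructor
  · rintro ⟨x, hx, rfl⟩
    exact ⟨⟨x, Hd_le_Vd K l p m v hx⟩, hx, rfl⟩
  · rintro ⟨x, hx, rfl⟩
    exact ⟨⟨x, _⟩, hx, rfl⟩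

/-- The elements of `V̂_d` act on `V_d` like elements of `V_d`, as `Ê` centralizes `V`. -/
theorem exists_conj_eq_of_mem_Vhatd (m : ℕ) (v : Spin K l) (hv : v ∈ extWeyl K l)
    (S : Subgroup (Spin K l)) (b : BigGroup K l p m) (hb : b ∈ Vhatd K l p m v hv S) :
    ∃ x ∈ emb K l p m (Vd K l p m v), ∀ y ∈ emb K l p m (Vd K l p m v),
      b * y * b⁻¹ = x * y * x⁻¹ := by
  have hbV := left_mem_of_mem_mulEhat K l p m hb.1
  have hcomm : vFhat K l p m v hv * b = b * vFhat K l p m v hv :=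
    Subgroup.mem_centralizer_iff.1 hb.2.2 _ rfl
  have h1 := congrArg (fun c : BigGroup K l p m => (c.left : Spin K l)) hcomm
  have hpow : ∀ n : ℕ, (SemidirectProduct.inr (Multiplicative.ofAdd 1, 1) ^ n :
      BigGroup K l p m) = SemidirectProduct.inr ((Multiplicative.ofAdd 1, 1) ^ n) := fun n =>
    (map_pow _ _ _).symm
  simp only [vFhat, hpow, SemidirectProduct.mul_left, SemidirectProduct.left_inl,
    SemidirectProduct.left_inr, map_one, mul_one] at h1
  rw [EhatAction_apply_of_mem K l p m _ _ hbV, EhatAction_apply_of_mem K l p m _ _ hv] at h1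
  have hbd : (b.left : Spin K l) ∈ Vd K l p m v := (mem_Vd_iff K l p m).2 ⟨hbV, h1⟩
  refine ⟨SemidirectProduct.inl b.left, ⟨b.left, hbd, rfl⟩, ?_⟩
  rintro _ ⟨y, hy, rfl⟩
  have h2 : b = SemidirectProduct.inl b.left * SemidirectProduct.inr b.right :=
    (SemidirectProduct.inl_left_mul_inr_right b).symm
  have h3 : (SemidirectProduct.inr b.right : BigGroup K l p m) * SemidirectProduct.inl y *
      (SemidirectProduct.inr b.right)⁻¹ = SemidirectProduct.inl y := by
    rw [← map_inv, ← SemidirectProduct.inl_aut, EhatAction_apply_of_mem K l p m _ _ hy.1]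
  conv_lhs => rw [h2]
  rw [mul_inv_rev]
  calc _ = SemidirectProduct.inl b.left * (SemidirectProduct.inr b.right * SemidirectProduct.inl y *
      (SemidirectProduct.inr b.right)⁻¹) * (SemidirectProduct.inl b.left)⁻¹ := by group
    _ = _ := by rw [h3]

theorem isCyclic_E (m : ℕ) : IsCyclic (E K l p m) := by
  rw [E, ← Subgroup.zpowers_eq_closure]
  infer_instance

/-- Both assertions follow once the sign characters of `H_d` extend to their inertia groups. The
group `E` is generated by the Frobenius map alone, so it is never non-cyclic. -/
theorem maximalExtendibility_and_extensionMapCondition (h2 : (2 : K) ≠ 0) (m d : ℕ) (v : Spin K l)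
    (hv : v ∈ extWeyl K l) (hn : NormalIn (Hd K l p m v) (Vd K l p m v))
    (hsq : ∀ y ∈ Hd K l p m v, y * y = 1)
    (hext : SignExtendible K (Hd K l p m v) (Vd K l p m v)) :
    MaximalExtendibility (Hd K l p m v) (Vd K l p m v) ∧
      ExtensionMapCondition K l p m d v hv := by
  refine ⟨hext.maximalExtendibility h2 hn hsq, fun S _ => ?_⟩
  have hinj : Function.Injective (embVd K l p m v) :=
    SemidirectProduct.inl_injective.comp (Subgroup.inclusion_injective _)
  have hext' := hext.map (Hd_le_Vd K l p m v) (embVd K l p m v) hinj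
  rw [← emb_Hd, ← emb_Vd] at hext'
  have hn' : NormalIn (emb K l p m (Hd K l p m v)) (emb K l p m (Vd K l p m v)) := by
    rw [normalIn_iff] at hn ⊢
    refine ⟨?_, ?_⟩
    · rintro _ ⟨x, hx, rfl⟩
      exact ⟨x, hn.1 hx, rfl⟩
    · rintro _ ⟨x, hx, rfl⟩ _ ⟨y, hy, rfl⟩
      refine ⟨x * y * x⁻¹, hn.2 x hx y hy, ?_⟩
      rw [map_mul, map_mul, map_inv]
  have hsq' : ∀ y ∈ emb K l p m (Hd K l p m v), y * y = 1 := by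
    rintro _ ⟨y, hy, rfl⟩
    rw [← map_mul, show y * y = 1 from Subtype.ext (hsq y hy), map_one]
  obtain ⟨Λ, h1, h3⟩ := (hext'.maximalExtendibility h2 hn' hsq').exists_equivariant
    (Vhatd K l p m v hv S) (exists_conj_eq_of_mem_Vhatd K l p m v hv S)
  exact ⟨Λ, h1, h3, fun h => absurd (isCyclic_E K l p m) h⟩

end BigGroup

/-! ### Anticommuting systems and monomial elements -/

/-- Pairwise anticommuting elements `F i` of square `-1` and `G i` of square `1`. -/
structure AntiSystem {R ι : Type*} [Ring R] (F G : ι → R) : Prop where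
  F_sq : ∀ i, F i * F i = -1
  G_sq : ∀ i, G i * G i = 1
  F_F : ∀ i j, i ≠ j → F i * F j = -(F j * F i)
  G_G : ∀ i j, i ≠ j → G i * G j = -(G j * G i)
  F_G : ∀ i j, F i * G j = -(G j * F i)

/-- `x` permutes the elements `F i`, and in the same way the elements `G i`, up to signs. -/
def IsMonomial {R ι : Type*} [Ring R] (F G : ι → R) (x : R) : Prop :=
  ∃ (π : Equiv.Perm ι) (ε δ : ι → ℤˣ), ∀ i,
    x * F i = ε i • (F (π i) * x) ∧ x * G i = δ i • (G (π i) * x)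

section Monomial

variable {R ι : Type*} [Ring R] {F G : ι → R}

theorem IsMonomial.one : IsMonomial F G (1 : R) := ⟨1, 1, 1, fun i => by simp⟩

theorem IsMonomial.mul {x y : R} (hx : IsMonomial F G x) (hy : IsMonomial F G y) :
    IsMonomial F G (x * y) := by
  obtain ⟨π, ε, δ, h⟩ := hx
  obtain ⟨π', ε', δ', h'⟩ := hy
  refine ⟨π * π', fun i => ε' i * ε (π' i), fun i => δ' i * δ (π' i), fun i => ⟨?_, ?_⟩⟩
  · rw [mul_assoc, (h' i).1, mul_smul_comm, ← mul_assoc, (h _).1, smul_mul_assoc, mul_assoc,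
      smul_smul]
    rfl
  · rw [mul_assoc, (h' i).2, mul_smul_comm, ← mul_assoc, (h _).2, smul_mul_assoc, mul_assoc,
      smul_smul]
    rfl

theorem mul_eq_smul_of_inv {x x' a b : R} {ε : ℤˣ} (h1 : x * x' = 1) (h2 : x' * x = 1)
    (h : x * a = ε • (b * x)) : x' * b = ε • (a * x') := by
  have h3 : x' * (x * a) * x' = ε • (x' * (b * x) * x') := by
    rw [h, mul_smul_comm, smul_mul_assoc]
  rw [← mul_assoc, h2, one_mul, ← mul_assoc, mul_assoc (x' * b), h1, mul_one] at h3
  rw [h3, smul_smul, Int.units_mul_self, one_smul]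

theorem IsMonomial.inv {x x' : R} (h1 : x * x' = 1) (h2 : x' * x = 1) (hx : IsMonomial F G x) :
    IsMonomial F G x' := by
  obtain ⟨π, ε, δ, h⟩ := hx
  refine ⟨π⁻¹, fun i => ε (π⁻¹ i), fun i => δ (π⁻¹ i), fun i => ⟨?_, ?_⟩⟩
  · have := (h (π⁻¹ i)).1
    rw [show π (π⁻¹ i) = i from π.apply_symm_apply i] at this
    exact mul_eq_smul_of_inv h1 h2 this
  · have := (h (π⁻¹ i)).2
    rw [show π (π⁻¹ i) = i from π.apply_symm_apply i] at this
    exact mul_eq_smul_of_inv h1 h2 this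

theorem mul_mul_eq_smul {x a b a' b' : R} {ε δ : ℤˣ} (h1 : x * a = ε • (a' * x))
    (h2 : x * b = δ • (b' * x)) : x * (a * b) = (ε * δ) • (a' * b' * x) := by
  rw [← mul_assoc, h1, smul_mul_assoc, mul_assoc, h2, mul_smul_comm, smul_smul, ← mul_assoc]

theorem smul_mul_eq {K : Type*} [Field K] [Algebra K R] {x a b : R} {ε : ℤˣ} (c : K)
    (h : x * a = ε • (b * x)) : (c • x) * a = ε • (b * (c • x)) := by
  rw [smul_mul_assoc, h, mul_smul_comm, smul_comm]

end Monomial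

namespace AntiSystem

variable {R ι : Type*} [Ring R] [DecidableEq ι] {F G : ι → R} (h : AntiSystem F G)

include h

omit [DecidableEq ι] in
theorem G_F (i j : ι) : G i * F j = -(F j * G i) := by rw [h.F_G, neg_neg]

omit [DecidableEq ι] in
theorem F_unit (i : ι) : IsUnit (F i) :=
  ⟨⟨F i, -F i, by rw [mul_neg, h.F_sq, neg_neg], by rw [neg_mul, h.F_sq, neg_neg]⟩, rfl⟩

omit [DecidableEq ι] in
theorem G_unit (i : ι) : IsUnit (G i) := ⟨⟨G i, G i, h.G_sq i, h.G_sq i⟩, rfl⟩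

omit [DecidableEq ι] in
theorem p_sq (i : ι) : F i * G i * (F i * G i) = 1 := by
  rw [mul_assoc, ← mul_assoc (G i), h.G_F, neg_mul, mul_neg, mul_assoc, h.G_sq, mul_one, h.F_sq,
    neg_neg]

theorem p_mul_F (i j : ι) :
    F i * G i * F j = if i = j then -(F j * (F i * G i)) else F j * (F i * G i) := by
  rw [mul_assoc, h.G_F, mul_neg, ← mul_assoc]
  split_ifs with hij
  · rw [hij, mul_assoc]
  · rw [h.F_F i j hij, neg_mul, neg_neg, mul_assoc]

theorem p_mul_G (i j : ι) :
    F i * G i * G j = if i = j then -(G j * (F i * G i)) else G j * (F i * G i) := by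
  split_ifs with hij
  · rw [hij, ← mul_assoc (G j), h.G_F, neg_mul, neg_neg]
  · rw [mul_assoc, h.G_G i j hij, mul_neg, ← mul_assoc, h.F_G, neg_mul, neg_neg, mul_assoc]

omit [DecidableEq ι] in
theorem p_comm (i j : ι) : F i * G i * (F j * G j) = F j * G j * (F i * G i) := by
  classical
  rw [← mul_assoc, h.p_mul_F]
  split_ifs with hij
  · rw [hij, neg_mul, mul_assoc (F j), h.p_mul_G, if_pos rfl, mul_neg, neg_neg, ← mul_assoc]
  · rw [mul_assoc, h.p_mul_G, if_neg hij, ← mul_assoc]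

/-- The rotation `1 - F i F j` exchanges `F i` and `F j` up to signs, and `1 - τ G i G j` exchanges
`G i` and `G j`. -/
theorem isMonomial_rotation {i j : ι} (hij : i ≠ j) (τ : ℤˣ) :
    ∀ k, ((1 - F i * F j) * (1 - τ • (G i * G j))) * F k =
        (if k = i then (-1 : ℤˣ) else 1) •
          (F (Equiv.swap i j k) * ((1 - F i * F j) * (1 - τ • (G i * G j)))) ∧
      ((1 - F i * F j) * (1 - τ • (G i * G j))) * G k =
        (if k = i then τ else if k = j then -τ else 1) •
          (G (Equiv.swap i j k) * ((1 - F i * F j) * (1 - τ • (G i * G j)))) := by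
  have hFG : ∀ k, (1 - τ • (G i * G j)) * F k = F k * (1 - τ • (G i * G j)) := by
    intro k
    rw [sub_mul, mul_sub, one_mul, mul_one, smul_mul_assoc, mul_smul_comm, mul_assoc, h.G_F j k,
      mul_neg, ← mul_assoc, h.G_F i k, neg_mul, neg_neg, mul_assoc]
  have hGF : ∀ k, (1 - F i * F j) * G k = G k * (1 - F i * F j) := by
    intro k
    rw [sub_mul, mul_sub, one_mul, mul_one, mul_assoc, h.F_G j k,
      mul_neg, ← mul_assoc, h.F_G i k, neg_mul, neg_neg, mul_assoc]
  have hFF : ∀ k, (1 - F i * F j) * F k =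
      (if k = i then (-1 : ℤˣ) else 1) • (F (Equiv.swap i j k) * (1 - F i * F j)) := by
    intro k
    by_cases hki : k = i
    · subst hki
      rw [if_pos rfl, Equiv.swap_apply_left, Units.neg_smul, one_smul, sub_mul, mul_sub, mul_assoc,
        ← mul_assoc (F j), h.F_F j k hij.symm, mul_neg, neg_mul, mul_assoc (F k) (F j), h.F_sq,
        ← mul_assoc, h.F_sq]
      noncomm_ring
    · rw [if_neg hki, one_smul]
      by_cases hkj : k = j
      · subst hkj
        rw [Equiv.swap_apply_right, sub_mul, mul_sub, mul_assoc, h.F_sq, ← mul_assoc, h.F_sq]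
        noncomm_ring
      · rw [Equiv.swap_apply_of_ne_of_ne hki hkj, sub_mul, mul_sub, mul_assoc,
          h.F_F j k (Ne.symm hkj), mul_neg, ← mul_assoc, h.F_F i k (Ne.symm hki), neg_mul, neg_neg,
          one_mul, mul_one, mul_assoc]
  have hGG : ∀ k, (1 - τ • (G i * G j)) * G k =
      (if k = i then τ else if k = j then -τ else 1) •
        (G (Equiv.swap i j k) * (1 - τ • (G i * G j))) := by
    intro k
    by_cases hki : k = i
    · subst hki
      rw [if_pos rfl, Equiv.swap_apply_left, sub_mul, mul_sub, smul_mul_assoc, mul_smul_comm,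
        smul_sub, smul_smul, Int.units_mul_self, one_smul, mul_assoc,
        ← mul_assoc (G j), h.G_G j k hij.symm, mul_neg, neg_mul, mul_assoc (G k) (G j), h.G_sq,
        ← mul_assoc, h.G_sq, smul_neg]
      noncomm_ring
    · rw [if_neg hki]
      by_cases hkj : k = j
      · subst hkj
        rw [if_pos rfl, Equiv.swap_apply_right, sub_mul, mul_sub, smul_mul_assoc, mul_smul_comm,
          smul_sub, smul_smul, neg_mul, Int.units_mul_self, mul_assoc, h.G_sq, ← mul_assoc, h.G_sq,
          Units.neg_smul, Units.neg_smul, one_smul]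
        noncomm_ring
      · rw [if_neg hkj, one_smul, Equiv.swap_apply_of_ne_of_ne hki hkj, sub_mul, mul_sub,
          smul_mul_assoc, mul_smul_comm, mul_assoc,
          h.G_G j k (Ne.symm hkj), mul_neg, ← mul_assoc, h.G_G i k (Ne.symm hki), neg_mul, neg_neg,
          one_mul, mul_one, mul_assoc]
  intro k
  constructor
  · rw [mul_assoc, hFG, ← mul_assoc, hFF, smul_mul_assoc, mul_assoc]
  · rw [mul_assoc, hGG, mul_smul_comm, ← mul_assoc, hGF, mul_assoc]

theorem F_mul_F (i k : ι) : F i * F k = (if k = i then (1 : ℤˣ) else -1) • (F k * F i) := by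
  split_ifs with hk
  · rw [hk, one_smul]
  · rw [Units.neg_smul, one_smul, h.F_F i k (Ne.symm hk)]

omit [DecidableEq ι] in
theorem F_mul_G (i k : ι) : F i * G k = (-1 : ℤˣ) • (G k * F i) := by
  rw [Units.neg_smul, one_smul, h.F_G]

variable {K : Type*} [Field K] [Algebra K R]

omit [DecidableEq ι] in
/-- An element of the commutative algebra generated by the `F i * G i` that commutes with all `F i`
is a scalar. -/
theorem exists_algebraMap_of_commute [Finite ι] (h2 : (2 : K) ≠ 0) {y : R}
    (hy : y ∈ Algebra.adjoin K (Set.range fun i => F i * G i)) (hF : ∀ i, F i * y = y * F i) :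
    ∃ k : K, y = algebraMap K R k := by
  classical
  have := Fintype.ofFinite ι
  have key : ∀ S : Finset ι, ∀ y ∈ Algebra.adjoin K ((fun i => F i * G i) '' (S : Set ι)),
      (∀ i, F i * y = y * F i) → ∃ k : K, y = algebraMap K R k := by
    intro S
    induction S using Finset.induction_on with
    | empty =>
      intro y hy _
      rw [Finset.coe_empty, Set.image_empty, Algebra.adjoin_empty, Algebra.mem_bot] at hy
      obtain ⟨k, rfl⟩ := hy
      exact ⟨k, rfl⟩
    | insert i S hi ih =>
      intro y hy hF
      have hp : ∀ a ∈ Algebra.adjoin K ((fun i => F i * G i) '' (S : Set ι)),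
          F i * a = a * F i ∧ F i * G i * a = a * (F i * G i) := by
        intro a ha
        induction ha using Algebra.adjoin_induction with
        | mem a ha =>
          obtain ⟨j, hj, rfl⟩ := ha
          have hji : j ≠ i := by
            rintro rfl
            exact hi hj
          refine ⟨?_, h.p_comm i j⟩
          have := h.p_mul_F j i
          rw [if_neg hji] at this
          exact this.symm
        | algebraMap k => exact ⟨(Algebra.commutes _ _).symm, (Algebra.commutes _ _).symm⟩
        | add a b _ _ iha ihb =>
          exact ⟨by rw [mul_add, add_mul, iha.1, ihb.1], by rw [mul_add, add_mul, iha.2, ihb.2]⟩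
        | mul a b _ _ iha ihb =>
          exact ⟨by rw [← mul_assoc, iha.1, mul_assoc, ihb.1, mul_assoc],
            by rw [← mul_assoc, iha.2, mul_assoc, ihb.2, mul_assoc]⟩
      have hdec : ∃ a ∈ Algebra.adjoin K ((fun i => F i * G i) '' (S : Set ι)),
          ∃ b ∈ Algebra.adjoin K ((fun i => F i * G i) '' (S : Set ι)),
            y = a + F i * G i * b := by
        clear hF
        induction hy using Algebra.adjoin_induction with
        | mem y hy =>
          obtain ⟨j, hj, rfl⟩ := hy
          rw [Finset.coe_insert] at hj
          rcases hj with rfl | hj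
          · exact ⟨0, zero_mem _, 1, one_mem _, by simp⟩
          · exact ⟨_, Algebra.subset_adjoin ⟨j, hj, rfl⟩, 0, zero_mem _, by simp⟩
        | algebraMap k => exact ⟨_, Subalgebra.algebraMap_mem _ k, 0, zero_mem _, by simp⟩
        | add y z _ _ ihy ihz =>
          obtain ⟨a, ha, b, hb, rfl⟩ := ihy
          obtain ⟨a', ha', b', hb', rfl⟩ := ihz
          exact ⟨a + a', add_mem ha ha', b + b', add_mem hb hb', by rw [mul_add]; abel⟩
        | mul y z _ _ ihy ihz =>
          obtain ⟨a, ha, b, hb, rfl⟩ := ihy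
          obtain ⟨a', ha', b', hb', rfl⟩ := ihz
          refine ⟨a * a' + b * b', add_mem (mul_mem ha ha') (mul_mem hb hb'), a * b' + b * a',
            add_mem (mul_mem ha hb') (mul_mem hb ha'), ?_⟩
          have e1 : a * (F i * G i * b') = F i * G i * (a * b') := by
            rw [← mul_assoc, ← (hp a ha).2, mul_assoc]
          have e2 : F i * G i * b * (F i * G i * b') = b * b' := by
            rw [mul_assoc, ← mul_assoc b, ← (hp b hb).2, ← mul_assoc, ← mul_assoc, h.p_sq, one_mul]
          rw [add_mul, mul_add, mul_add, e1, e2, mul_add, mul_assoc (F i * G i) b a']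
          abel
      obtain ⟨a, ha, b, hb, rfl⟩ := hdec
      have h1 := hF i
      have h3 : F i * (F i * G i * b) = -(F i * G i * b * F i) := by
        have := h.p_mul_F i i
        rw [if_pos rfl] at this
        rw [← mul_assoc, ← neg_eq_iff_eq_neg.2 this, neg_mul, mul_assoc _ (F i), (hp b hb).1]
        simp only [mul_assoc]
      rw [mul_add, add_mul, (hp a ha).1, h3, add_right_inj, neg_eq_iff_add_eq_zero] at h1
      have h4 := eq_zero_of_add_self h2 h1
      rw [(h.F_unit i).mul_left_eq_zero] at h4
      rw [h4, add_zero] at hF ⊢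
      exact ih a ha hF
  refine key Finset.univ y ?_ hF
  rwa [Finset.coe_univ, Set.image_univ]

end AntiSystem

/-! ### Root elements in terms of an anticommuting system -/

/-- The isotropic combination `(F i ± G i) / 2`. -/
def ladder (K : Type*) {R ι : Type*} [Field K] [Ring R] [Algebra K R] (F G : ι → R) (i : ι)
    (s : ℤˣ) : R :=
  (2⁻¹ : K) • (F i + s • G i)

section Ladder

variable {K R ι : Type*} [Field K] [Ring R] [Algebra K R] {F G : ι → R}

theorem two_inv_smul_add_self (h2 : (2 : K) ≠ 0) (r : R) : (2⁻¹ : K) • (r + r) = r := by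
  rw [← two_smul K r, smul_smul, inv_mul_cancel₀ h2, one_smul]

theorem ladder_add_ladder_neg (h2 : (2 : K) ≠ 0) (i : ι) (s : ℤˣ) :
    ladder K F G i s + ladder K F G i (-s) = F i := by
  rw [ladder, ladder, ← smul_add, Units.neg_smul]
  rw [show F i + s • G i + (F i + -(s • G i)) = F i + F i by abel, two_inv_smul_add_self h2]

theorem ladder_mem_adjoin (i : ι) (s : ℤˣ) :
    ladder K F G i s ∈ Algebra.adjoin K (Set.range F ∪ Set.range G) := by
  have hF : F i ∈ Algebra.adjoin K (Set.range F ∪ Set.range G) :=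
    Algebra.subset_adjoin (Or.inl ⟨i, rfl⟩)
  have hG : G i ∈ Algebra.adjoin K (Set.range F ∪ Set.range G) :=
    Algebra.subset_adjoin (Or.inr ⟨i, rfl⟩)
  refine Subalgebra.smul_mem _ (add_mem hF ?_) _
  rcases Int.units_eq_one_or s with rfl | rfl
  · rwa [one_smul]
  · rw [Units.neg_smul, one_smul]
    exact neg_mem hG

variable (h : AntiSystem F G)

include h

theorem ladder_sq (i : ι) (s : ℤˣ) : ladder K F G i s * ladder K F G i s = 0 := by
  rw [ladder, smul_mul_smul_comm, add_mul, mul_add, mul_add, h.F_sq, smul_mul_smul_comm, h.G_sq,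
    Int.units_mul_self, one_smul, mul_smul_comm, smul_mul_assoc, h.G_F, smul_neg]
  rw [show ∀ r : R, -1 + r + (-r + 1) = 0 from fun r => by abel, smul_zero]

theorem ladder_mul_ladder_neg (h2 : (2 : K) ≠ 0) (i : ι) (s : ℤˣ) :
    ladder K F G i s * ladder K F G i (-s) = -((2⁻¹ : K) • (1 + s • (F i * G i))) := by
  rw [ladder, ladder, smul_mul_smul_comm, add_mul, mul_add, mul_add, h.F_sq, smul_mul_smul_comm,
    h.G_sq, mul_neg, Int.units_mul_self, Units.neg_smul, Units.neg_smul, one_smul, mul_neg,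
    mul_smul_comm, smul_mul_assoc, h.G_F, smul_neg, ← smul_smul]
  rw [show ∀ r : R, -1 + -r + (-r + -1) = -((1 + r) + (1 + r)) from fun r => by abel, smul_neg,
    two_inv_smul_add_self h2, smul_neg]

theorem ladder_car (h2 : (2 : K) ≠ 0) (i : ι) (s : ℤˣ) :
    ladder K F G i (-s) * ladder K F G i s = -1 - ladder K F G i s * ladder K F G i (-s) := by
  have h1 := ladder_mul_ladder_neg h h2 i s
  have h3 := ladder_mul_ladder_neg h h2 i (-s)
  rw [neg_neg] at h3
  rw [h1, h3, eq_sub_iff_add_eq, ← neg_add, ← smul_add, Units.neg_smul]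
  rw [show 1 + -(s • (F i * G i)) + (1 + s • (F i * G i)) = 1 + 1 by abel,
    two_inv_smul_add_self h2]

theorem ladder_anticomm {i j : ι} (hij : i ≠ j) (s t : ℤˣ) :
    ladder K F G i s * ladder K F G j t = -(ladder K F G j t * ladder K F G i s) := by
  rw [ladder, ladder, smul_mul_smul_comm, smul_mul_smul_comm, add_mul, mul_add, mul_add, add_mul,
    mul_add, mul_add, ← smul_neg, h.F_F i j hij, smul_mul_smul_comm, h.G_G i j hij,
    smul_mul_smul_comm, mul_smul_comm, smul_mul_assoc, smul_mul_assoc, mul_smul_comm, h.F_G i j,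
    h.G_F i j, smul_neg, smul_neg, smul_neg, mul_comm t s]
  congr 1
  abel

theorem ladder_mul_self_mem (h2 : (2 : K) ≠ 0) (i : ι) (s : ℤˣ) :
    ladder K F G i s * ladder K F G i (-s) ∈
      Algebra.adjoin K (Set.range fun i => F i * G i) := by
  have hp : F i * G i ∈ Algebra.adjoin K (Set.range fun i => F i * G i) :=
    Algebra.subset_adjoin ⟨i, rfl⟩
  rw [ladder_mul_ladder_neg h h2]
  refine neg_mem (Subalgebra.smul_mem _ (add_mem (one_mem _) ?_) _)
  rcases Int.units_eq_one_or s with rfl | rfl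
  · rwa [one_smul]
  · rw [Units.neg_smul, one_smul]
    exact neg_mem hp

end Ladder

/-- The products `X` and `Y` of two basis vectors that span the root subgroups for a root and its
negative: multiples of an isotropic combination for a short root, and products of two of them for a
long root. -/
inductive IsRootPair (K : Type*) {R ι : Type*} [Field K] [Ring R] [Algebra K R] (F G : ι → R) :
    R → R → Prop
  | short (i : ι) (τ s : ℤˣ) :
      IsRootPair K F G (τ • ladder K F G i s) (-(τ • ladder K F G i (-s)))
  | long (i j : ι) (hij : i ≠ j) (s t : ℤˣ) :
      IsRootPair K F G (-(ladder K F G i s * ladder K F G j t))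
        (-(ladder K F G j (-t) * ladder K F G i (-s)))

namespace IsRootPair

variable {K R ι : Type*} [Field K] [Ring R] [Algebra K R] {F G : ι → R} {X Y : R}

theorem fst_sq (h : AntiSystem F G) (hXY : IsRootPair K F G X Y) : X * X = 0 := by
  cases hXY with
  | short i τ s => rw [smul_mul_smul_comm, ladder_sq h, smul_zero]
  | long i j hij s t =>
    rw [neg_mul_neg, mul_assoc, ← mul_assoc (ladder K F G j t), ladder_anticomm h hij.symm,
      neg_mul, mul_assoc, ladder_sq h, mul_zero, neg_zero, mul_zero]

theorem swap (hXY : IsRootPair K F G X Y) : IsRootPair K F G Y X := by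
  cases hXY with
  | short i τ s =>
    have := IsRootPair.short (K := K) (F := F) (G := G) i (-τ) (-s)
    rwa [Units.neg_smul, Units.neg_smul, neg_neg, neg_neg] at this
  | long i j hij s t =>
    have := IsRootPair.long (K := K) (F := F) (G := G) j i hij.symm (-t) (-s)
    rwa [neg_neg, neg_neg] at this

theorem mul_eq (h : AntiSystem F G) {i j : ι} (hij : i ≠ j) (s t : ℤˣ) :
    -(ladder K F G i s * ladder K F G j t) * -(ladder K F G j (-t) * ladder K F G i (-s)) =
      ladder K F G i s * ladder K F G i (-s) * (ladder K F G j t * ladder K F G j (-t)) := by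
  rw [neg_mul_neg, mul_assoc, mul_assoc (ladder K F G i s) (ladder K F G i (-s)),
    ← mul_assoc (ladder K F G j t), ← mul_assoc (ladder K F G i (-s)),
    ladder_anticomm h hij (-s) t, neg_mul, mul_assoc, mul_assoc, ladder_anticomm h hij (-s) (-t),
    mul_neg, mul_neg, mul_neg, neg_neg]

theorem fst_mul_snd_mem (h : AntiSystem F G) (h2 : (2 : K) ≠ 0) (hXY : IsRootPair K F G X Y) :
    X * Y ∈ Algebra.adjoin K (Set.range fun i => F i * G i) := by
  cases hXY with
  | short i τ s =>
    rw [mul_neg, smul_mul_smul_comm, Int.units_mul_self, one_smul]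
    exact neg_mem (ladder_mul_self_mem h h2 i s)
  | long i j hij s t =>
    rw [mul_eq h hij]
    exact mul_mem (ladder_mul_self_mem h h2 i s) (ladder_mul_self_mem h h2 j t)

theorem mul_mul_fst (h : AntiSystem F G) (h2 : (2 : K) ≠ 0) (hXY : IsRootPair K F G X Y) :
    X * Y * X = X := by
  have key : ∀ i s, ladder K F G i s * ladder K F G i (-s) * ladder K F G i s =
      -ladder K F G i s := by
    intro i s
    rw [mul_assoc, ladder_car h h2, mul_sub, mul_neg, mul_one, ← mul_assoc, ladder_sq h, zero_mul,
      sub_zero]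
  cases hXY with
  | short i τ s =>
    rw [mul_neg, smul_mul_smul_comm, Int.units_mul_self, one_smul, neg_mul, mul_smul_comm, key,
      smul_neg, neg_neg]
  | long i j hij s t =>
    have hc : ladder K F G j t * ladder K F G j (-t) * ladder K F G i s =
        ladder K F G i s * (ladder K F G j t * ladder K F G j (-t)) := by
      rw [mul_assoc, ladder_anticomm h hij.symm, mul_neg, ← mul_assoc,
        ladder_anticomm h hij.symm, neg_mul, neg_neg, mul_assoc]
    rw [mul_eq h hij, mul_neg, ← mul_assoc _ (ladder K F G i s),
      mul_assoc (ladder K F G i s * _) _ (ladder K F G i s), hc, ← mul_assoc _ (ladder K F G i s),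
      key, mul_assoc, key, neg_mul_neg]

theorem snd_sq (h : AntiSystem F G) (hXY : IsRootPair K F G X Y) : Y * Y = 0 :=
  fst_sq h (hXY.swap)

theorem snd_mul_fst_mem (h : AntiSystem F G) (h2 : (2 : K) ≠ 0) (hXY : IsRootPair K F G X Y) :
    Y * X ∈ Algebra.adjoin K (Set.range fun i => F i * G i) :=
  (hXY.swap).fst_mul_snd_mem h h2

theorem mul_mul_snd (h : AntiSystem F G) (h2 : (2 : K) ≠ 0) (hXY : IsRootPair K F G X Y) :
    Y * X * Y = Y :=
  (hXY.swap).mul_mul_fst h h2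

/-- The element `n_α(t)` for a root pair. -/
theorem weyl_eq (h : AntiSystem F G) (h2 : (2 : K) ≠ 0) (hXY : IsRootPair K F G X Y) (t : Kˣ) :
    (1 + (t : K) • X) * (1 + (-(t⁻¹ : Kˣ) : K) • Y) * (1 + (t : K) • X) =
      1 - X * Y - Y * X + (t : K) • X - ((t⁻¹ : Kˣ) : K) • Y := by
  have e1 := hXY.fst_sq h
  have e2 := hXY.mul_mul_fst h h2
  have hsc : (t : K) * -((t⁻¹ : Kˣ) : K) = -1 := by rw [mul_neg, Units.mul_inv]
  have e3 : (1 + (t : K) • X) * (1 + (-(t⁻¹ : Kˣ) : K) • Y) =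
      1 + (t : K) • X - ((t⁻¹ : Kˣ) : K) • Y - X * Y := by
    rw [add_mul, one_mul, mul_add, mul_one, smul_mul_smul_comm, hsc]
    simp only [neg_smul, one_smul]
    abel
  have e4 : ((t⁻¹ : Kˣ) : K) * (t : K) = 1 := Units.inv_mul t
  rw [e3, mul_add, mul_one, sub_mul, sub_mul, add_mul, one_mul, smul_mul_smul_comm, e1, smul_zero,
    mul_smul_comm (t : K) (X * Y), e2, smul_mul_smul_comm, e4, one_smul]
  abel

theorem weyl_mul_weyl (h : AntiSystem F G) (h2 : (2 : K) ≠ 0) (hXY : IsRootPair K F G X Y)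
    (t r : Kˣ) :
    (1 - X * Y - Y * X + (t : K) • X - ((t⁻¹ : Kˣ) : K) • Y) *
      (1 - X * Y - Y * X + (r : K) • X - ((r⁻¹ : Kˣ) : K) • Y) =
      1 - X * Y - Y * X - ((t * r⁻¹ : Kˣ) : K) • (X * Y) - ((t⁻¹ * r : Kˣ) : K) • (Y * X) := by
  have e1 := hXY.fst_sq h
  have e2 := hXY.mul_mul_fst h h2
  have e3 := hXY.snd_sq h
  have e4 := hXY.mul_mul_snd h h2
  have zX : (1 - X * Y - Y * X) * X = 0 := by
    rw [sub_mul, sub_mul, one_mul, e2, mul_assoc, e1, mul_zero, sub_zero, sub_self]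
  have zY : (1 - X * Y - Y * X) * Y = 0 := by
    rw [sub_mul, sub_mul, one_mul, e4, mul_assoc, e3, mul_zero, sub_zero, sub_self]
  have Xz : X * (1 - X * Y - Y * X) = 0 := by
    rw [mul_sub, mul_sub, mul_one, ← mul_assoc, e1, zero_mul, ← mul_assoc, e2, sub_zero, sub_self]
  have Yz : Y * (1 - X * Y - Y * X) = 0 := by
    rw [mul_sub, mul_sub, mul_one, ← mul_assoc, e4, ← mul_assoc, e3, zero_mul, sub_self, sub_zero]
  have zz : (1 - X * Y - Y * X) * (1 - X * Y - Y * X) = 1 - X * Y - Y * X := by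
    conv_lhs => rw [mul_sub, mul_sub, mul_one, ← mul_assoc, zX, ← mul_assoc, zY, zero_mul, zero_mul,
      sub_zero, sub_zero]
  have e5 : ∀ z : R, z * z = z → z * X = 0 → z * Y = 0 → X * z = 0 → Y * z = 0 →
      (z + (t : K) • X - ((t⁻¹ : Kˣ) : K) • Y) * (z + (r : K) • X - ((r⁻¹ : Kˣ) : K) • Y) =
      z - ((t * r⁻¹ : Kˣ) : K) • (X * Y) - ((t⁻¹ * r : Kˣ) : K) • (Y * X) := by
    intro z h1 h2 h3 h4 h5
    simp only [add_mul, sub_mul, mul_add, mul_sub, smul_mul_assoc, mul_smul_comm, h1, h2, h3, h4,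
      h5, e1, e3, smul_zero, Units.val_mul, zero_add, add_zero, sub_zero, zero_sub,
      smul_neg, smul_smul]
    rw [mul_comm ((t⁻¹ : Kˣ) : K) (r : K), mul_comm ((r⁻¹ : Kˣ) : K) (t : K)]
    abel
  exact e5 _ zz zX zY Xz Yz

/-- The element `n_α(1)` of a short root. -/
theorem weyl_one_short (h : AntiSystem F G) (h2 : (2 : K) ≠ 0) (i : ι) (τ s : ℤˣ)
    (hX : X = τ • ladder K F G i s) (hY : Y = -(τ • ladder K F G i (-s))) :
    1 - X * Y - Y * X + X - Y = τ • F i := by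
  rw [hX, hY, mul_neg, neg_mul, smul_mul_smul_comm, smul_mul_smul_comm, Int.units_mul_self,
    one_smul, one_smul, ladder_car h h2, ← ladder_add_ladder_neg (F := F) (G := G) h2 i s, smul_add]
  abel

/-- The element `n_α(1)` of a long root. -/
theorem weyl_one_long (h : AntiSystem F G) (h2 : (2 : K) ≠ 0) {i j : ι} (hij : i ≠ j) (s t : ℤˣ)
    (hX : X = -(ladder K F G i s * ladder K F G j t))
    (hY : Y = -(ladder K F G j (-t) * ladder K F G i (-s))) :
    1 - X * Y - Y * X + X - Y =
      (2⁻¹ : K) • ((1 - F i * F j) * (1 - (s * t) • (G i * G j))) := by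
  have e := mul_eq (K := K) h hij.symm (-t) (-s)
  rw [neg_neg, neg_neg] at e
  rw [hX, hY, mul_eq h hij, e, ladder_anticomm h hij.symm (-t) (-s)]
  have l1 := ladder_mul_ladder_neg h h2 i s
  have l2 := ladder_mul_ladder_neg h h2 i (-s)
  have l3 := ladder_mul_ladder_neg h h2 j t
  have l4 := ladder_mul_ladder_neg h h2 j (-t)
  rw [neg_neg] at l2 l4
  have e1 : ladder K F G i s * ladder K F G j t + ladder K F G i (-s) * ladder K F G j (-t) =
      (2⁻¹ : K) • (F i * F j + (s * t) • (G i * G j)) := by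
    simp only [ladder, smul_mul_smul_comm]
    rw [← smul_add, ← smul_smul]
    congr 1
    rw [← two_inv_smul_add_self h2 (F i * F j + (s * t) • (G i * G j))]
    congr 1
    simp only [add_mul, mul_add, Units.neg_smul, mul_neg, neg_mul, smul_mul_assoc, mul_smul_comm,
      smul_smul, mul_comm t s, smul_add, neg_add, smul_neg, neg_neg]
    abel
  have e2 : F i * F j * (G i * G j) = -(F i * G i * (F j * G j)) := by
    simp only [mul_assoc]
    rw [← mul_assoc (F j) (G i), h.F_G, neg_mul, mul_neg, mul_assoc]
  have e3 : (2⁻¹ : K) • (1 + (1 : R)) = 1 := two_inv_smul_add_self h2 1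
  have e4 : 1 - ladder K F G i s * ladder K F G i (-s) *
        (ladder K F G j t * ladder K F G j (-t)) -
      ladder K F G j (-t) * ladder K F G j t * (ladder K F G i (-s) * ladder K F G i s) =
      (2⁻¹ : K) • (1 - (s * t) • (F i * G i * (F j * G j))) := by
    rw [l1, l2, l3, l4, neg_mul_neg, neg_mul_neg, smul_mul_smul_comm, smul_mul_smul_comm,
      sub_sub, ← smul_add, ← smul_smul]
    rw [show (1 + s • (F i * G i)) * (1 + t • (F j * G j)) +
      (1 + -t • (F j * G j)) * (1 + -s • (F i * G i)) =
      (1 + (s * t) • (F i * G i * (F j * G j))) + (1 + (s * t) • (F i * G i * (F j * G j))) by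
        simp only [add_mul, mul_add, one_mul, mul_one, Units.neg_smul, neg_mul_neg,
          smul_mul_smul_comm, h.p_comm j i, mul_comm t s]
        abel]
    rw [two_inv_smul_add_self h2]
    nth_rewrite 1 [← e3]
    rw [← smul_sub]
    congr 1
    abel
  rw [e4]
  rw [show ∀ a b c : R, a + -b - - -c = a - (b + c) from fun a b c => by abel, e1, ← smul_sub]
  congr 1
  rw [sub_mul, one_mul, mul_sub, mul_one, mul_smul_comm, e2, smul_neg]
  abel

/-- The elements `n_α(1)` are signed `F i` for short roots, and rotations for long roots. -/
theorem weyl_one_eq (h : AntiSystem F G) (h2 : (2 : K) ≠ 0) (hXY : IsRootPair K F G X Y) :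
    (∃ i, ∃ τ : ℤˣ, 1 - X * Y - Y * X + X - Y = τ • F i) ∨
    ∃ i j, i ≠ j ∧ ∃ τ : ℤˣ, 1 - X * Y - Y * X + X - Y =
      (2⁻¹ : K) • ((1 - F i * F j) * (1 - τ • (G i * G j))) := by
  cases hXY with
  | short i τ s => exact Or.inl ⟨i, τ, weyl_one_short h h2 i τ s rfl rfl⟩
  | long i j hij s t => exact Or.inr ⟨i, j, hij, s * t, weyl_one_long h h2 hij s t rfl rfl⟩

end IsRootPair

/-! ### The Clifford algebra of type `B_l` -/

section Clifford

variable {K : Type*} [Field K] {l : ℕ}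

/-- The position of the weight `s e_i`. -/
def wpos (i : Fin l) (s : ℤˣ) : Fin (2 * l + 1) := if s = 1 then pos i else neg i

theorem rev_mid : (mid l).rev = mid l := by
  simp only [mid, Fin.ext_iff, Fin.val_rev]
  omega

theorem rev_wpos (i : Fin l) (s : ℤˣ) : (wpos i s).rev = wpos i (-s) := by
  rcases Int.units_eq_one_or s with rfl | rfl
  · rw [wpos, wpos, if_pos rfl, if_neg (by decide)]
    rfl
  · rw [wpos, wpos, if_neg (by decide), if_pos (by decide)]
    exact Fin.rev_rev _

theorem val_wpos (i : Fin l) (s : ℤˣ) :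
    (wpos i s : ℕ) = i ∧ s = 1 ∨ (wpos i s : ℕ) = 2 * l - i ∧ s = -1 := by
  rcases Int.units_eq_one_or s with rfl | rfl
  · exact Or.inl ⟨by rw [wpos, if_pos rfl]; rfl, rfl⟩
  · refine Or.inr ⟨?_, rfl⟩
    rw [wpos, if_neg (by decide)]
    simp only [neg, pos, Fin.val_rev]
    omega

theorem wpos_ne_mid (i : Fin l) (s : ℤˣ) : wpos i s ≠ mid l := by
  have := i.2
  rw [ne_eq, Fin.ext_iff]
  simp only [mid]
  rcases val_wpos i s with h | h <;> omega

theorem wpos_ne_wpos {i j : Fin l} (hij : i ≠ j) (s t : ℤˣ) : wpos i s ≠ wpos j t := by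
  have := i.2
  have := j.2
  rw [ne_eq, Fin.ext_iff] at hij ⊢
  rcases val_wpos i s with h | h <;> rcases val_wpos j t with h' | h' <;> omega

theorem exists_eq_wpos {a : Fin (2 * l + 1)} (ha : a ≠ mid l) : ∃ i s, a = wpos (l := l) i s := by
  have h2 := a.2
  rw [ne_eq, Fin.ext_iff] at ha
  simp only [mid] at ha
  rcases Nat.lt_or_ge a l with h | h
  · refine ⟨⟨a, h⟩, 1, ?_⟩
    rw [wpos, if_pos rfl]
    rfl
  · refine ⟨⟨2 * l - a, by omega⟩, -1, ?_⟩
    rw [wpos, if_neg (by decide), Fin.ext_iff]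
    simp only [neg, pos, Fin.val_rev]
    omega

theorem u_mul_mid {a : Fin (2 * l + 1)} (ha : a ≠ mid l) :
    (u (mid l) * u a : Cl K l) = -(u a * u (mid l)) :=
  u_anticomm (by rwa [rev_mid])

theorem u_mid_mul_u_mid {a b : Fin (2 * l + 1)} (hb : b ≠ mid l) :
    (u a * u (mid l) * (u b * u (mid l)) : Cl K l) = -(u a * u b) := by
  rw [mul_assoc, ← mul_assoc (u (mid l)), u_mul_mid hb, neg_mul, mul_assoc, u_mid_mul_self, mul_one,
    mul_neg]

theorem u_pos_mul_u_neg (i : Fin l) :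
    (u (pos i) * u (neg i) + u (neg i) * u (pos i) : Cl K l) = 1 := by
  have hne : ∀ k j : Fin l, (pos k : Fin (2 * l + 1)) ≠ neg j := by
    intro k j
    have := k.2
    have := j.2
    simp only [pos, neg, ne_eq, Fin.ext_iff, Fin.val_rev]
    omega
  have hpp : ∀ k j : Fin l, (pos k : Fin (2 * l + 1)) = pos j ↔ k = j := by
    intro k j
    simp only [pos, Fin.ext_iff]
  have hnn : ∀ k j : Fin l, (neg k : Fin (2 * l + 1)) = neg j ↔ k = j := by
    intro k j
    simp only [neg, Fin.rev_inj, hpp]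
  have hm : ∀ j : Fin l, mid l ≠ pos j ∧ mid l ≠ neg j := by
    intro j
    have := j.2
    simp only [pos, neg, mid, ne_eq, Fin.ext_iff, Fin.val_rev]
    omega
  rw [u, u, CliffordAlgebra.ι_mul_ι_add_swap, QuadraticMap.polar]
  simp only [quadForm_apply, Pi.add_apply, Pi.single_apply, hne, (hne _ _).symm, hpp, hnn,
    hm]
  simp

/-- The element `F_i = (u_{e_i} + u_{-e_i}) u_0` of the even Clifford algebra, of square `-1`. -/
def clF (K : Type*) [Field K] (l : ℕ) (i : Fin l) : Cl K l := (u (pos i) + u (neg i)) * u (mid l)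

/-- The element `G_i = (u_{e_i} - u_{-e_i}) u_0` of the even Clifford algebra, of square `1`. -/
def clG (K : Type*) [Field K] (l : ℕ) (i : Fin l) : Cl K l := (u (pos i) - u (neg i)) * u (mid l)

theorem antiSystem_clF_clG : AntiSystem (clF K l) (clG K l) := by
  have hp : ∀ i : Fin l, pos i ≠ mid l := fun i => by
    have := wpos_ne_mid i 1
    rwa [wpos, if_pos rfl] at this
  have hn : ∀ i : Fin l, neg i ≠ mid l := fun i => by
    have := wpos_ne_mid i (-1)
    rwa [wpos, if_neg (by decide)] at this
  have sq : ∀ i : Fin l, (u (pos i) * u (pos i) : Cl K l) = 0 ∧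
      (u (neg i) * u (neg i) : Cl K l) = 0 :=
    fun i => ⟨u_mul_self_of_ne (hp i), u_mul_self_of_ne (hn i)⟩
  have car : ∀ i : Fin l, (u (neg i) * u (pos i) : Cl K l) = 1 - u (pos i) * u (neg i) :=
    fun i => by rw [← u_pos_mul_u_neg i]; abel
  have anti : ∀ i j : Fin l, i ≠ j → (u (pos i) * u (pos j) : Cl K l) = -(u (pos j) * u (pos i)) ∧
      (u (pos i) * u (neg j) : Cl K l) = -(u (neg j) * u (pos i)) ∧
      (u (neg i) * u (pos j) : Cl K l) = -(u (pos j) * u (neg i)) ∧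
      (u (neg i) * u (neg j) : Cl K l) = -(u (neg j) * u (neg i)) := by
    intro i j hij
    have key : ∀ s t : ℤˣ,
        (u (wpos i s) * u (wpos j t) : Cl K l) = -(u (wpos j t) * u (wpos i s)) := fun s t =>
      u_anticomm (by rw [rev_wpos]; exact wpos_ne_wpos (Ne.symm hij) _ _)
    have e1 : ∀ i : Fin l, wpos i 1 = pos i := fun i => if_pos rfl
    have e2 : ∀ i : Fin l, wpos i (-1) = neg i := fun i => if_neg (by decide)
    refine ⟨?_, ?_, ?_, ?_⟩
    · simpa only [e1, e2] using key 1 1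
    · simpa only [e1, e2] using key 1 (-1)
    · simpa only [e1, e2] using key (-1) 1
    · simpa only [e1, e2] using key (-1) (-1)
  constructor
  · intro i
    simp only [clF, add_mul, mul_add, u_mid_mul_u_mid (hp _), u_mid_mul_u_mid (hn _), (sq i).1,
      (sq i).2, car]
    abel
  · intro i
    simp only [clG, sub_mul, mul_sub, u_mid_mul_u_mid (hp _), u_mid_mul_u_mid (hn _), (sq i).1,
      (sq i).2, car]
    abel
  · intro i j hij
    obtain ⟨h1, h2, h3, h4⟩ := anti i j hij
    simp only [clF, add_mul, mul_add, u_mid_mul_u_mid (hp _), u_mid_mul_u_mid (hn _), h1, h2, h3,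
      h4]
    abel
  · intro i j hij
    obtain ⟨h1, h2, h3, h4⟩ := anti i j hij
    simp only [clG, sub_mul, mul_sub, u_mid_mul_u_mid (hp _), u_mid_mul_u_mid (hn _), h1, h2, h3,
      h4]
    abel
  · intro i j
    by_cases hij : i = j
    · subst hij
      simp only [clF, clG, sub_mul, mul_sub, add_mul, mul_add, u_mid_mul_u_mid (hp _),
        u_mid_mul_u_mid (hn _), (sq i).1, (sq i).2]
      abel
    · obtain ⟨h1, h2, h3, h4⟩ := anti i j hij
      simp only [clF, clG, sub_mul, mul_sub, add_mul, mul_add, u_mid_mul_u_mid (hp _),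
        u_mid_mul_u_mid (hn _), h1, h2, h3, h4]
      abel

theorem u_wpos_mul_mid (h2 : (2 : K) ≠ 0) (i : Fin l) (s : ℤˣ) :
    (u (wpos i s) * u (mid l) : Cl K l) = ladder K (clF K l) (clG K l) i s := by
  rcases Int.units_eq_one_or s with rfl | rfl
  · rw [ladder, wpos, if_pos rfl, one_smul, clF, clG, ← add_mul]
    rw [show ∀ a b : Cl K l, a + b + (a - b) = a + a from fun a b => by abel, ← smul_mul_assoc,
      two_inv_smul_add_self h2]
  · rw [ladder, wpos, if_neg (by decide), Units.neg_smul, one_smul, clF, clG, ← sub_eq_add_neg,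
      ← sub_mul]
    rw [show ∀ a b : Cl K l, a + b - (a - b) = b + b from fun a b => by abel, ← smul_mul_assoc,
      two_inv_smul_add_self h2]

theorem u_wpos_mul_u_wpos (h2 : (2 : K) ≠ 0) (i j : Fin l) (s t : ℤˣ) :
    (u (wpos i s) * u (wpos j t) : Cl K l) =
      -(ladder K (clF K l) (clG K l) i s * ladder K (clF K l) (clG K l) j t) := by
  rw [← u_wpos_mul_mid h2, ← u_wpos_mul_mid h2, u_mid_mul_u_mid (wpos_ne_mid _ _), neg_neg]

theorem isRootPair (h2 : (2 : K) ≠ 0) (α : Root l) :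
    IsRootPair K (clF K l) (clG K l) (u α.fst * u α.snd) (u α.opp.fst * u α.opp.snd) := by
  obtain ⟨a, b, hlt, hne⟩ := α
  simp only [Root.opp]
  by_cases ha : a = mid l
  · subst ha
    obtain ⟨i, s, rfl⟩ := exists_eq_wpos (l := l) hlt.ne'
    have := IsRootPair.short (K := K) (F := clF K l) (G := clG K l) i (-1) s
    rw [u_mul_mid (wpos_ne_mid _ _), rev_mid, rev_wpos, u_wpos_mul_mid h2, u_wpos_mul_mid h2]
    rwa [Units.neg_smul, one_smul, Units.neg_smul, one_smul, neg_neg] at this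
  obtain ⟨i, s, rfl⟩ := exists_eq_wpos (l := l) ha
  by_cases hb : b = mid l
  · subst hb
    have := IsRootPair.short (K := K) (F := clF K l) (G := clG K l) i 1 s
    rw [rev_mid, rev_wpos, u_mul_mid (wpos_ne_mid _ _), u_wpos_mul_mid h2, u_wpos_mul_mid h2]
    rwa [one_smul, one_smul] at this
  obtain ⟨j, t, rfl⟩ := exists_eq_wpos (l := l) hb
  have hij : i ≠ j := by
    rintro rfl
    rw [rev_wpos] at hne
    rcases Int.units_eq_one_or s with rfl | rfl <;> rcases Int.units_eq_one_or t with rfl | rfl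
    · exact hlt.ne rfl
    · exact hne rfl
    · exact hne (by rw [neg_neg])
    · exact hlt.ne rfl
  rw [rev_wpos, rev_wpos, u_wpos_mul_u_wpos h2, u_wpos_mul_u_wpos h2]
  exact IsRootPair.long i j hij s t

theorem coe_nElt (h2 : (2 : K) ≠ 0) (α : Root l) (t : Kˣ) :
    (nElt α t : Cl K l) = 1 - u α.fst * u α.snd * (u α.opp.fst * u α.opp.snd) -
      u α.opp.fst * u α.opp.snd * (u α.fst * u α.snd) + (t : K) • (u α.fst * u α.snd) -
      ((t⁻¹ : Kˣ) : K) • (u α.opp.fst * u α.opp.snd) :=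
  (isRootPair h2 α).weyl_eq antiSystem_clF_clG h2 t

theorem coe_nElt_mul_nElt (h2 : (2 : K) ≠ 0) (α : Root l) (t r : Kˣ) :
    (nElt α t * nElt α r : Cl K l) = 1 - u α.fst * u α.snd * (u α.opp.fst * u α.opp.snd) -
      u α.opp.fst * u α.opp.snd * (u α.fst * u α.snd) -
      ((t * r⁻¹ : Kˣ) : K) • (u α.fst * u α.snd * (u α.opp.fst * u α.opp.snd)) -
      ((t⁻¹ * r : Kˣ) : K) • (u α.opp.fst * u α.opp.snd * (u α.fst * u α.snd)) := by
  rw [coe_nElt h2, coe_nElt h2, (isRootPair h2 α).weyl_mul_weyl antiSystem_clF_clG h2]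

theorem nElt_inv (h2 : (2 : K) ≠ 0) (α : Root l) (t : Kˣ) : (nElt α t)⁻¹ = nElt α (-t) := by
  apply inv_eq_of_mul_eq_one_right
  apply Subtype.ext
  refine (coe_nElt_mul_nElt h2 α t (-t)).trans ?_
  rw [inv_neg, mul_neg, mul_neg, mul_inv_cancel, inv_mul_cancel]
  simp only [Units.val_neg, Units.val_one, neg_smul, one_smul]
  change _ = (1 : Cl K l)
  abel

theorem coe_nElt_mul_nElt_mem (h2 : (2 : K) ≠ 0) (α : Root l) (t r : Kˣ) :
    (nElt α t * nElt α r : Cl K l) ∈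
      Algebra.adjoin K (Set.range fun i => clF K l i * clG K l i) := by
  have h1 := (isRootPair h2 α).fst_mul_snd_mem antiSystem_clF_clG h2
  have h3 := (isRootPair h2 α).snd_mul_fst_mem antiSystem_clF_clG h2
  rw [coe_nElt_mul_nElt h2]
  exact sub_mem (sub_mem (sub_mem (sub_mem (one_mem _) h1) h3) (Subalgebra.smul_mem _ h1 _))
    (Subalgebra.smul_mem _ h3 _)

/-- The torus lies in the commutative algebra generated by the involutions `F i * G i`. -/
theorem coe_mem_of_mem_torus (h2 : (2 : K) ≠ 0) {x : Spin K l} (hx : x ∈ torus K l) :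
    (x : Cl K l) ∈ Algebra.adjoin K (Set.range fun i => clF K l i * clG K l i) := by
  induction hx using Subgroup.closure_induction'' with
  | mem x hx =>
    obtain ⟨α, t, rfl⟩ := hx
    rw [hElt, nElt_inv h2]
    exact coe_nElt_mul_nElt_mem h2 α t (-1)
  | inv_mem x hx =>
    obtain ⟨α, t, rfl⟩ := hx
    rw [hElt, mul_inv_rev, inv_inv, nElt_inv h2]
    exact coe_nElt_mul_nElt_mem h2 α 1 (-t)
  | one => exact one_mem _
  | mul x y _ _ hx hy => exact mul_mem hx hy

theorem coe_nElt_mem (h2 : (2 : K) ≠ 0) (α : Root l) (t : Kˣ) :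
    (nElt α t : Cl K l) ∈ Algebra.adjoin K (Set.range (clF K l) ∪ Set.range (clG K l)) := by
  have key : ∀ {X Y : Cl K l}, IsRootPair K (clF K l) (clG K l) X Y →
      X ∈ Algebra.adjoin K (Set.range (clF K l) ∪ Set.range (clG K l)) := by
    intro X Y h
    cases h with
    | short i τ s =>
      rcases Int.units_eq_one_or τ with rfl | rfl
      · rw [one_smul]
        exact ladder_mem_adjoin i s
      · rw [Units.neg_smul, one_smul]
        exact neg_mem (ladder_mem_adjoin i s)
    | long i j hij s t => exact neg_mem (mul_mem (ladder_mem_adjoin i s) (ladder_mem_adjoin j t))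
  have h1 := key (isRootPair h2 α)
  have h3 := key (isRootPair h2 α).swap
  rw [coe_nElt h2]
  exact sub_mem (add_mem (sub_mem (sub_mem (one_mem _) (mul_mem h1 h3)) (mul_mem h3 h1))
    (Subalgebra.smul_mem _ h1 _)) (Subalgebra.smul_mem _ h3 _)

theorem coe_mem_of_mem_extWeyl (h2 : (2 : K) ≠ 0) {x : Spin K l} (hx : x ∈ extWeyl K l) :
    (x : Cl K l) ∈ Algebra.adjoin K (Set.range (clF K l) ∪ Set.range (clG K l)) := by
  induction hx using Subgroup.closure_induction'' with
  | mem x hx =>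
    obtain ⟨α, rfl⟩ := hx
    exact coe_nElt_mem h2 α 1
  | inv_mem x hx =>
    obtain ⟨α, rfl⟩ := hx
    rw [nElt_inv h2]
    exact coe_nElt_mem h2 α (-1)
  | one => exact one_mem _
  | mul x y _ _ hx hy => exact mul_mem hx hy

theorem coe_nElt_one (h2 : (2 : K) ≠ 0) (α : Root l) :
    (nElt α (1 : Kˣ) : Cl K l) = 1 - u α.fst * u α.snd * (u α.opp.fst * u α.opp.snd) -
      u α.opp.fst * u α.opp.snd * (u α.fst * u α.snd) + u α.fst * u α.snd -
      u α.opp.fst * u α.opp.snd := by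
  rw [coe_nElt h2, inv_one, Units.val_one, one_smul, one_smul]

theorem coe_nElt_one_cases (h2 : (2 : K) ≠ 0) (α : Root l) :
    (∃ i, ∃ τ : ℤˣ, (nElt α (1 : Kˣ) : Cl K l) = τ • clF K l i) ∨
    ∃ i j, i ≠ j ∧ ∃ τ : ℤˣ, (nElt α (1 : Kˣ) : Cl K l) =
      (2⁻¹ : K) • ((1 - clF K l i * clF K l j) * (1 - τ • (clG K l i * clG K l j))) := by
  rw [coe_nElt_one h2]
  exact (isRootPair h2 α).weyl_one_eq antiSystem_clF_clG h2

theorem coe_mul_inv (x : Spin K l) : (x : Cl K l) * (x⁻¹ : Spin K l) = 1 :=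
  congrArg Subtype.val (mul_inv_cancel x)

theorem coe_inv_mul (x : Spin K l) : ((x⁻¹ : Spin K l) : Cl K l) * x = 1 :=
  congrArg Subtype.val (inv_mul_cancel x)

/-- The elements of `V` permute the `F i` and the `G i` up to signs, as the generators do. -/
theorem isMonomial_of_mem_extWeyl (h2 : (2 : K) ≠ 0) {x : Spin K l} (hx : x ∈ extWeyl K l) :
    IsMonomial (clF K l) (clG K l) (x : Cl K l) := by
  have h := antiSystem_clF_clG (K := K) (l := l)
  induction hx using Subgroup.closure_induction with
  | mem x hx =>
    obtain ⟨α, rfl⟩ := hx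
    rcases coe_nElt_one_cases h2 α with ⟨i, τ, e⟩ | ⟨i, j, hij, τ, e⟩
    · rw [e]
      refine ⟨1, fun k => if k = i then 1 else -1, fun k => -1, fun k => ?_⟩
      rw [smul_mul_assoc, smul_mul_assoc, mul_smul_comm, mul_smul_comm, h.F_mul_F, h.F_mul_G]
      exact ⟨smul_comm _ _ _, smul_comm _ _ _⟩
    · rw [e]
      exact ⟨_, _, _, fun k => ⟨smul_mul_eq _ (h.isMonomial_rotation hij τ k).1,
        smul_mul_eq _ (h.isMonomial_rotation hij τ k).2⟩⟩
  | one => exact IsMonomial.one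
  | mul x y _ _ hx hy => exact hx.mul hy
  | inv x _ hx => exact hx.inv (coe_mul_inv x) (coe_inv_mul x)

/-- The elements of `V` are polynomials in the `F i` and the products `G i * G j`. -/
theorem commute_of_mem_extWeyl (h2 : (2 : K) ≠ 0) {z : Cl K l}
    (hF : ∀ i, z * clF K l i = clF K l i * z)
    (hG : ∀ i j, z * (clG K l i * clG K l j) = clG K l i * clG K l j * z)
    {x : Spin K l} (hx : x ∈ extWeyl K l) : z * x = x * z := by
  induction hx using Subgroup.closure_induction with
  | mem x hx =>
    obtain ⟨α, rfl⟩ := hx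
    rcases coe_nElt_one_cases h2 α with ⟨i, τ, e⟩ | ⟨i, j, hij, τ, e⟩
    · rw [e, mul_smul_comm, hF, smul_mul_assoc]
    · rw [e, mul_smul_comm, smul_mul_assoc]
      congr 1
      have e1 : z * (1 - clF K l i * clF K l j) = (1 - clF K l i * clF K l j) * z := by
        rw [mul_sub, sub_mul, ← mul_assoc, hF, mul_assoc, hF, mul_one, one_mul, mul_assoc]
      have e3 : z * (1 - τ • (clG K l i * clG K l j)) = (1 - τ • (clG K l i * clG K l j)) * z := by
        rw [mul_sub, sub_mul, mul_one, one_mul, mul_smul_comm, hG, smul_mul_assoc]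
      rw [← mul_assoc, e1, mul_assoc, e3, mul_assoc]
  | one => exact (mul_one z).trans (one_mul z).symm
  | mul x y _ _ hx hy =>
    change z * ((x : Cl K l) * y) = x * y * z
    rw [← mul_assoc, hx, mul_assoc, hy, mul_assoc]
  | inv x _ hx =>
    have := mul_eq_smul_of_inv (a := z) (b := z) (ε := 1) (coe_mul_inv x) (coe_inv_mul x)
      (by rw [one_smul]; exact hx.symm)
    rw [one_smul] at this
    exact this.symm

end Clifford

/-! ### Generators of the toral part -/

section Abstract

/-- The elements of `H` act by signs on the blocks of the elements `f n`. If `H` contains `-1` and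
the products `P j * P k`, each `P i` negates exactly the block `i`, and no element of `H` acts like
a single `P i₀`, then these elements generate `H`. -/
theorem eq_closure_of_blocks {A R ι N : Type*} [Group A] [Ring R] [Fintype ι] [DecidableEq ι]
    (ρ : A →* R) (H : Subgroup A) (i₀ : ι) (P : ι → R) (neg : A) (pair : ι → ι → A)
    (hneg : neg ∈ H) (hpair : ∀ j k, pair j k ∈ H) (hcoe : ∀ j k, ρ (pair j k) = P j * P k)
    (f : N → R) (blk : N → ι)
    (hPf : ∀ i n, P i * f n = if blk n = i then -(f n * P i) else f n * P i)
    (hH : ∀ x ∈ H, ∃ ε : ι → ℤˣ, ∀ n, ρ x * f n = ε (blk n) • (f n * ρ x))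
    (hscal : ∀ x ∈ H, (∀ n, ρ x * f n = f n * ρ x) → x = 1 ∨ x = neg)
    (hP₀ : ∀ x ∈ H, ¬ ∀ n, P i₀ * ρ x * f n = f n * (P i₀ * ρ x)) :
    H = Subgroup.closure (insert neg {g | ∃ j k, g = pair j k}) := by
  have hPf' : ∀ i n, P i * f n = (if blk n = i then (-1 : ℤˣ) else 1) • (f n * P i) := by
    intro i n
    rw [hPf]
    split_ifs
    · rw [Units.neg_smul, one_smul]
    · rw [one_smul]
  have key : ∀ S : Finset ι, ∀ x ∈ H, ∀ ε : ι → ℤˣ, (∀ n, ρ x * f n = ε (blk n) • (f n * ρ x)) →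
      (∀ i, i ≠ i₀ → i ∉ S → ε i = 1) →
      x ∈ Subgroup.closure (insert neg {g | ∃ j k, g = pair j k}) := by
    intro S
    induction S using Finset.induction_on with
    | empty =>
      intro x hx ε hε h1
      by_cases h0 : ε i₀ = 1
      · have : ∀ i, ε i = 1 := fun i => by
          by_cases hi : i = i₀
          · rw [hi, h0]
          · exact h1 i hi (Finset.notMem_empty _)
        rcases hscal x hx (fun n => by rw [hε, this, one_smul]) with rfl | rfl
        · exact one_mem _
        · exact Subgroup.subset_closure (Set.mem_insert _ _)
      · refine absurd (fun n => ?_) (hP₀ x hx)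
        rw [mul_assoc, hε, mul_smul_comm, ← mul_assoc, hPf', smul_mul_assoc, smul_smul, mul_assoc]
        have h0' := (Int.units_eq_one_or (ε i₀)).resolve_left h0
        by_cases hn : blk n = i₀
        · rw [if_pos hn, hn, h0', neg_one_mul, neg_neg, one_smul]
        · rw [if_neg hn, h1 _ hn (Finset.notMem_empty _), one_mul, one_smul]
    | insert i S hi ih =>
      intro x hx ε hε h1
      by_cases hii : i = i₀ ∨ ε i = 1
      · refine ih x hx ε hε fun j hj hjS => ?_
        by_cases hji : j = i
        · rcases hii with hii | hii
          · exact absurd (hji.trans hii) hj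
          · rw [hji, hii]
        · exact h1 j hj (by rw [Finset.mem_insert]; tauto)
      · obtain ⟨hi0, he⟩ := not_or.1 hii
        have he' := (Int.units_eq_one_or (ε i)).resolve_left he
        have hc : pair i₀ i ∈ Subgroup.closure (insert neg {g | ∃ j k, g = pair j k}) :=
          Subgroup.subset_closure (Set.mem_insert_of_mem _ ⟨_, _, rfl⟩)
        rw [← Subgroup.mul_mem_cancel_left _ hc]
        refine ih _ (mul_mem (hpair _ _) hx)
          (fun j => ε j * ((if j = i then (-1 : ℤˣ) else 1) * if j = i₀ then (-1 : ℤˣ) else 1))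
          (fun n => ?_) fun j hj hjS => ?_
        · rw [map_mul, hcoe, mul_assoc, hε, mul_smul_comm, mul_assoc (P i₀), ← mul_assoc (P i),
            hPf', smul_mul_assoc, mul_smul_comm, smul_smul, mul_assoc (f n), ← mul_assoc (P i₀),
            hPf', smul_mul_assoc, smul_smul, mul_assoc (f n), mul_assoc (P i₀), mul_assoc (ε _)]
        · rw [if_neg hj, mul_one]
          by_cases hji : j = i
          · rw [hji, he', if_pos rfl, neg_one_mul, neg_neg]
          · rw [if_neg hji, mul_one, h1 j hj (by rw [Finset.mem_insert]; tauto)]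
  apply le_antisymm
  · intro x hx
    obtain ⟨ε, hε⟩ := hH x hx
    exact key Finset.univ x hx ε hε fun i _ h => absurd (Finset.mem_univ i) h
  · refine (Subgroup.closure_le _).2 ?_
    rintro _ (rfl | ⟨j, k, rfl⟩)
    exacts [hneg, hpair j k]

theorem mul_prod_of_smul {R ι : Type*} [Ring R] {x : R} {Q Q' : ι → R} {ε : ι → ℤˣ}
    (h : ∀ k, x * Q k = ε k • (Q' k * x)) (L : List ι) :
    x * (L.map Q).prod = (L.map ε).prod • ((L.map Q').prod * x) := by
  induction L with
  | nil => simp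
  | cons a L ih =>
    simp only [List.map_cons, List.prod_cons]
    rw [← mul_assoc, h, smul_mul_assoc, mul_assoc, ih, mul_smul_comm, smul_smul, mul_assoc]

variable {R ι : Type*} [Ring R] [Fintype ι]

theorem mul_prod_univ_of_anticomm {x : R} {Q : ι → R} (h : ∀ k, x * Q k = -(Q k * x)) :
    x * (Finset.univ.toList.map Q).prod =
      ((-1) ^ Fintype.card ι : ℤˣ) • ((Finset.univ.toList.map Q).prod * x) := by
  rw [mul_prod_of_smul (ε := fun _ => -1) (fun k => by rw [h, Units.neg_smul, one_smul]),
    Finset.prod_map_toList, Finset.prod_const, Finset.card_univ]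

theorem mul_prod_univ_self [DecidableEq ι] {Q : ι → R}
    (h : ∀ j k, j ≠ k → Q j * Q k = -(Q k * Q j)) (i : ι) :
    Q i * (Finset.univ.toList.map Q).prod =
      ((-1) ^ Fintype.card ι * -1 : ℤˣ) • ((Finset.univ.toList.map Q).prod * Q i) := by
  rw [mul_prod_of_smul (ε := fun k => -1 * if k = i then -1 else 1) (fun k => ?_),
    Finset.prod_map_toList, Finset.prod_mul_distrib, Finset.prod_const, Finset.card_univ,
    Finset.prod_ite_eq' Finset.univ i, if_pos (Finset.mem_univ i)]
  by_cases hk : k = i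
  · rw [hk, if_pos rfl, neg_one_mul, neg_neg, one_smul]
  · rw [if_neg hk, mul_one, h i k (Ne.symm hk), Units.neg_smul, one_smul]

/-- A product of the `G i` or of the `F i`, of even or odd length respectively, that commutes with
all `F i` and anticommutes with all `G i`. -/
def flipElt (F G : ι → R) : R :=
  if Even (Fintype.card ι) then (Finset.univ.toList.map G).prod else (Finset.univ.toList.map F).prod

namespace AntiSystem

variable {F G : ι → R} (h : AntiSystem F G)

include h

theorem flipElt_F (i : ι) : flipElt F G * F i = F i * flipElt F G := by
  classical
  unfold flipElt
  split_ifs with he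
  · rw [mul_prod_univ_of_anticomm (h.F_G i), he.neg_one_pow, one_smul]
  · rw [mul_prod_univ_self h.F_F i, (Nat.not_even_iff_odd.1 he).neg_one_pow, neg_one_mul, neg_neg,
      one_smul]

theorem flipElt_G (i : ι) : flipElt F G * G i = -(G i * flipElt F G) := by
  classical
  unfold flipElt
  split_ifs with he
  · rw [mul_prod_univ_self h.G_G i, he.neg_one_pow, one_mul, Units.neg_smul, one_smul, neg_neg]
  · rw [mul_prod_univ_of_anticomm (h.G_F i), (Nat.not_even_iff_odd.1 he).neg_one_pow,
      Units.neg_smul, one_smul, neg_neg]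

theorem flipElt_p (i : ι) : flipElt F G * (F i * G i) = -(F i * G i * flipElt F G) := by
  rw [← mul_assoc, h.flipElt_F, mul_assoc, h.flipElt_G, mul_neg, mul_assoc]

theorem isUnit_flipElt : IsUnit (flipElt F G) := by
  unfold flipElt
  split_ifs
  exacts [isUnit_list_prod_map h.G_unit _, isUnit_list_prod_map h.F_unit _]

end AntiSystem

end Abstract

section Toral

variable {K : Type*} [Field K] {l : ℕ}

/-- The inclusion of the spin group into the Clifford algebra. -/
def coeHom (K : Type*) [Field K] (l : ℕ) : Spin K l →* Cl K l := (spinGroup (quadForm K l)).subtype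

theorem coeHom_apply (x : Spin K l) : coeHom K l x = (x : Cl K l) := rfl

theorem coeHom_injective : Function.Injective (coeHom K l) := Subtype.val_injective

theorem nElt_sq_mem (h2 : (2 : K) ≠ 0) (α : Root l) :
    nElt α (1 : Kˣ) * nElt α 1 ∈ toralPart K l := by
  have hV : nElt α (1 : Kˣ) ∈ extWeyl K l := Subgroup.subset_closure ⟨α, rfl⟩
  refine ⟨?_, mul_mem hV hV⟩
  have h1 : hElt α (-1 : Kˣ) ∈ torus K l := Subgroup.subset_closure ⟨α, _, rfl⟩
  rw [hElt, ← nElt_inv h2, ← mul_inv_rev] at h1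
  exact (Subgroup.inv_mem_iff _).1 h1

theorem clF_sq (i : Fin l) : clF K l i * clF K l i = -1 := antiSystem_clF_clG.F_sq i

/-- The element `n_α(1)` for the simple root `α = e_1`. -/
theorem coe_nElt_short (h2 : (2 : K) ≠ 0) (hl : 0 < l) :
    coeHom K l (nElt (simpleRoot ⟨0, hl⟩) 1) = clF K l ⟨0, hl⟩ := by
  rw [coeHom_apply, coe_nElt_one h2]
  have := u_wpos_mul_mid (K := K) h2 ⟨0, hl⟩ 1
  have h3 := u_wpos_mul_mid (K := K) h2 ⟨0, hl⟩ (-1)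
  rw [IsRootPair.weyl_one_short antiSystem_clF_clG h2 ⟨0, hl⟩ 1 1 (X := u _ * u _), one_smul]
  · rw [one_smul, ← this]
    rfl
  · rw [one_smul, ← h3, ← u_mul_mid (wpos_ne_mid _ _)]
    simp only [simpleRoot, dite_true, Root.opp, rev_mid]
    rfl

/-- The element `-1` is the square of `n_α(1)` for a short root `α`. -/
theorem exists_neg (h2 : (2 : K) ≠ 0) (hl : 0 < l) :
    ∃ g ∈ toralPart K l, coeHom K l g = -1 := by
  refine ⟨_, nElt_sq_mem h2 (simpleRoot ⟨0, hl⟩), ?_⟩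
  rw [map_mul, coe_nElt_short h2 hl, clF_sq]

/-- The element `n_α(1)` for a long root `α = s e_i + t e_j`. -/
theorem coe_nElt_long (h2 : (2 : K) ≠ 0) {i j : Fin l} (hij : i ≠ j) (s t : ℤˣ) (α : Root l)
    (h1 : α.fst = wpos i s) (h3 : α.snd = wpos j t) :
    coeHom K l (nElt α 1) =
      (2⁻¹ : K) • ((1 - clF K l i * clF K l j) * (1 - (s * t) • (clG K l i * clG K l j))) := by
  rw [coeHom_apply, coe_nElt_one h2]
  refine IsRootPair.weyl_one_long antiSystem_clF_clG h2 hij s t ?_ ?_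
  · rw [h1, h3, u_wpos_mul_u_wpos h2]
  · simp only [Root.opp]
    rw [h1, h3, rev_wpos, rev_wpos, u_wpos_mul_u_wpos h2]

/-- The product of two of the involutions `F i * G i` is, up to sign, the square of `n_α(1)` for a
long root `α`. -/
theorem exists_pair (h2 : (2 : K) ≠ 0) (j k : Fin l) :
    ∃ g ∈ toralPart K l, coeHom K l g = clF K l j * clG K l j * (clF K l k * clG K l k) := by
  have h := antiSystem_clF_clG (K := K) (l := l)
  have key : ∀ j k : Fin l, j < k →
      ∃ g ∈ toralPart K l, coeHom K l g = clF K l j * clG K l j * (clF K l k * clG K l k) := by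
    intro j k hjk
    obtain ⟨m, hm, hm'⟩ := exists_neg (K := K) h2 (lt_of_le_of_lt (Nat.zero_le _) k.2)
    have hjk' : (j : ℕ) < k := hjk
    let α : Root l := ⟨pos j, pos k, hjk, by
      have := j.2
      have := k.2
      simp only [pos, ne_eq, Fin.ext_iff, Fin.val_rev]
      omega⟩
    refine ⟨_, mul_mem hm (nElt_sq_mem h2 α), ?_⟩
    rw [map_mul, map_mul, hm', coe_nElt_long h2 hjk.ne 1 1 α rfl rfl, one_mul, one_smul,
      smul_mul_smul_comm]
    have e1 : (1 - clG K l j * clG K l k) * (1 - clF K l j * clF K l k) =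
        (1 - clF K l j * clF K l k) * (1 - clG K l j * clG K l k) := by
      have : clG K l j * clG K l k * (clF K l j * clF K l k) =
          clF K l j * clF K l k * (clG K l j * clG K l k) := by
        have hc : ∀ i, clG K l j * clG K l k * clF K l i = clF K l i * (clG K l j * clG K l k) := by
          intro i
          rw [mul_assoc, h.G_F, mul_neg, ← mul_assoc, h.G_F, neg_mul, neg_neg, mul_assoc]
        rw [← mul_assoc, hc, mul_assoc, hc, ← mul_assoc]
      rw [mul_sub, sub_mul, sub_mul, this]
      noncomm_ring
    have e2 : (1 - clF K l j * clF K l k) * (1 - clF K l j * clF K l k) =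
        -(clF K l j * clF K l k + clF K l j * clF K l k) := by
      have : clF K l j * clF K l k * (clF K l j * clF K l k) = -1 := by
        rw [mul_assoc, ← mul_assoc (clF K l k), h.F_F k j hjk.ne', neg_mul, mul_assoc, h.F_sq,
          mul_neg, mul_neg, mul_one, mul_neg, neg_neg, h.F_sq]
      rw [mul_sub, mul_one, sub_mul, one_mul, this]
      abel
    have e3 : (1 - clG K l j * clG K l k) * (1 - clG K l j * clG K l k) =
        -(clG K l j * clG K l k + clG K l j * clG K l k) := by
      have : clG K l j * clG K l k * (clG K l j * clG K l k) = -1 := by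
        rw [mul_assoc, ← mul_assoc (clG K l k), h.G_G k j hjk.ne', neg_mul, mul_assoc, h.G_sq,
          mul_neg, mul_one, h.G_sq]
      rw [mul_sub, mul_one, sub_mul, one_mul, this]
      abel
    rw [mul_assoc (1 - _), ← mul_assoc (1 - clG K l j * _), e1, mul_assoc (1 - clF K l j * _), e3,
      ← mul_assoc, e2, ← smul_mul_smul_comm, smul_neg, smul_neg, two_inv_smul_add_self h2,
      two_inv_smul_add_self h2, neg_mul_neg, neg_mul, one_mul, mul_assoc, ← mul_assoc (clF K l k),
      h.F_G k j]
    noncomm_ring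
  rcases lt_trichotomy j k with hjk | hjk | hjk
  · exact key j k hjk
  · exact ⟨1, one_mem _, by rw [hjk, h.p_sq, map_one]⟩
  · rw [h.p_comm]
    exact key k j hjk

/-- The flip of the Clifford algebra commutes with the extended Weyl group. -/
theorem flipElt_comm (h2 : (2 : K) ≠ 0) {x : Spin K l} (hx : x ∈ extWeyl K l) :
    flipElt (clF K l) (clG K l) * coeHom K l x = coeHom K l x * flipElt (clF K l) (clG K l) := by
  have h := antiSystem_clF_clG (K := K) (l := l)
  refine commute_of_mem_extWeyl h2 h.flipElt_F (fun i j => ?_) hx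
  rw [← mul_assoc, h.flipElt_G, neg_mul, mul_assoc, h.flipElt_G, mul_neg, neg_neg, mul_assoc]

theorem nontrivial_cl (h2 : (2 : K) ≠ 0) : Nontrivial (Cl K l) := by
  have : Invertible (2 : K) := invertibleOfNonzero h2
  infer_instance

theorem eq_one_or_of_coe_eq_algebraMap (h2 : (2 : K) ≠ 0) {x m : Spin K l}
    (hm : coeHom K l m = -1) {k : K} (hk : coeHom K l x = algebraMap K (Cl K l) k) :
    x = 1 ∨ x = m := by
  have := nontrivial_cl (l := l) h2
  have h1 : star (x : Cl K l) * x = 1 := spinGroup.coe_star_mul_self x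
  rw [coeHom_apply] at hk
  rw [hk, CliffordAlgebra.star_algebraMap, ← map_mul,
    map_eq_one_iff _ (algebraMap K (Cl K l)).injective, mul_self_eq_one_iff] at h1
  rcases h1 with rfl | rfl
  · exact Or.inl (coeHom_injective (by rw [coeHom_apply, hk, map_one, map_one]))
  · exact Or.inr (coeHom_injective (by rw [coeHom_apply, hk, hm, map_neg, map_one]))

/-- An element of the toral part that commutes with all `F i` is `1` or `-1`. -/
theorem eq_one_or_of_commute (h2 : (2 : K) ≠ 0) {x m : Spin K l} (hm : coeHom K l m = -1)
    (hx : x ∈ toralPart K l) (hF : ∀ i, coeHom K l x * clF K l i = clF K l i * coeHom K l x) :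
    x = 1 ∨ x = m := by
  obtain ⟨k, hk⟩ := antiSystem_clF_clG.exists_algebraMap_of_commute h2
    (coe_mem_of_mem_torus h2 hx.1) fun i => (hF i).symm
  exact eq_one_or_of_coe_eq_algebraMap h2 hm hk

/-- No element of the toral part centralized by `z` differs by a scalar from an involution that `z`
negates. -/
theorem not_commute_of_anticomm (h2 : (2 : K) ≠ 0) {x : Spin K l} (hx : x ∈ toralPart K l)
    {y z : Cl K l} (hy : y ∈ Algebra.adjoin K (Set.range fun i => clF K l i * clG K l i))
    (hyy : y * y = 1) (hz : IsUnit z) (hzy : z * y = -(y * z))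
    (hzx : z * coeHom K l x = coeHom K l x * z) :
    ¬ ∀ i, y * coeHom K l x * clF K l i = clF K l i * (y * coeHom K l x) := by
  intro hF
  have := nontrivial_cl (l := l) h2
  obtain ⟨k, hk⟩ := antiSystem_clF_clG.exists_algebraMap_of_commute h2
    (mul_mem hy (coe_mem_of_mem_torus h2 hx.1)) fun i => (hF i).symm
  have h1 : coeHom K l x = k • y := by
    rw [← one_mul (coeHom K l x), ← hyy, mul_assoc, ← coeHom_apply] at *
    rw [show y * coeHom K l x = algebraMap K _ k from hk, ← Algebra.commutes, Algebra.smul_def]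
  have h3 : z * coeHom K l x = -(coeHom K l x * z) := by
    rw [h1, mul_smul_comm, hzy, smul_neg, smul_mul_assoc]
  rw [hzx, eq_neg_iff_add_eq_zero] at h3
  have h4 := eq_zero_of_add_self h2 h3
  have hu : IsUnit (coeHom K l x * z) := ((Group.isUnit x).map (coeHom K l)).mul hz
  rw [h4] at hu
  exact not_isUnit_zero hu

/-- The elements of the toral part act diagonally on the `F i`. -/
theorem exists_sign_of_mem_toralPart (h2 : (2 : K) ≠ 0) {x : Spin K l} (hx : x ∈ toralPart K l) :
    ∃ ε : Fin l → ℤˣ, ∀ i, coeHom K l x * clF K l i = ε i • (clF K l i * coeHom K l x) := by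
  have h := antiSystem_clF_clG (K := K) (l := l)
  have := nontrivial_cl (l := l) h2
  obtain ⟨π, ε, δ, hm⟩ := isMonomial_of_mem_extWeyl h2 hx.2
  refine ⟨ε, fun i => ?_⟩
  suffices hπ : π i = i by
    have := (hm i).1
    rwa [hπ] at this
  by_contra hne
  have hxp : ∀ y ∈ Algebra.adjoin K (Set.range fun i => clF K l i * clG K l i),
      y * (clF K l i * clG K l i) = clF K l i * clG K l i * y := by
    intro y hy
    induction hy using Algebra.adjoin_induction with
    | mem a ha =>
      obtain ⟨j, rfl⟩ := ha
      exact h.p_comm j i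
    | algebraMap k => exact Algebra.commutes _ _
    | add a b _ _ iha ihb => rw [add_mul, mul_add, iha, ihb]
    | mul a b _ _ iha ihb => rw [mul_assoc, ihb, ← mul_assoc, iha, mul_assoc]
  have e1 := hxp _ (coe_mem_of_mem_torus h2 hx.1)
  rw [mul_mul_eq_smul (hm i).1 (hm i).2, ← smul_mul_assoc] at e1
  have e2 := ((Group.isUnit x).map (coeHom K l)).mul_right_cancel e1
  have e3 := h.p_mul_F (π i) i
  rw [if_neg hne] at e3
  have e4 : clF K l i * clG K l i * clF K l i = clF K l i * (clF K l i * clG K l i) := by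
    rw [← e2, smul_mul_assoc, e3, mul_smul_comm]
  have e5 := h.p_mul_F i i
  rw [if_pos rfl, e4, eq_neg_iff_add_eq_zero] at e5
  have e6 := eq_zero_of_add_self h2 e5
  have hu : IsUnit (clF K l i * (clF K l i * clG K l i)) :=
    (h.F_unit i).mul ((h.F_unit i).mul (h.G_unit i))
  rw [e6] at hu
  exact not_isUnit_zero hu

end Toral

/-! ### The block system of the extended Weyl group -/

section Inst

variable {K : Type*} [Field K] {l : ℕ}

theorem clp_mem_adjoin (i : Fin l) : clF K l i * clG K l i ∈
    Algebra.adjoin K (Set.range fun i => clF K l i * clG K l i) :=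
  Algebra.subset_adjoin ⟨i, rfl⟩

/-- The toral part of the extended Weyl group is generated by `-1` and the products of two of the
involutions `F i * G i`. -/
theorem toralPart_eq_closure (h2 : (2 : K) ≠ 0) (hl : 0 < l) {m : Spin K l}
    (hm : m ∈ toralPart K l) (hm' : coeHom K l m = -1) {pair : Fin l → Fin l → Spin K l}
    (hpair : ∀ j k, pair j k ∈ toralPart K l)
    (hpair' : ∀ j k, coeHom K l (pair j k) =
      clF K l j * clG K l j * (clF K l k * clG K l k)) :
    toralPart K l = Subgroup.closure (insert m {g | ∃ j k, g = pair j k}) := by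
  have h := antiSystem_clF_clG (K := K) (l := l)
  refine eq_closure_of_blocks (coeHom K l) (toralPart K l) ⟨0, hl⟩
    (fun i => clF K l i * clG K l i) m pair hm hpair hpair' (clF K l) id
    (fun i n => ?_) (fun x hx => exists_sign_of_mem_toralPart h2 hx)
    (fun x hx hF => eq_one_or_of_commute h2 hm' hx hF) fun x hx =>
      not_commute_of_anticomm h2 hx (clp_mem_adjoin _) (h.p_sq _) h.isUnit_flipElt (h.flipElt_p _)
        (flipElt_comm h2 hx.2)
  simp only [h.p_mul_F, id, eq_comm]

/-- If `y` is a unit that maps each member of a finite family to a member, under conjugation, then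
each member arises in this way. -/
theorem exists_preimage_of_conj {R ι : Type*} [Ring R] [Finite ι] {e : ι → R}
    (he : Function.Injective e) {y : R} (hy : IsUnit y) (h : ∀ j, ∃ k, y * e j = e k * y) (i : ι) :
    ∃ j, y * e j = e i * y := by
  choose f hf using h
  have hinj : Function.Injective f := by
    intro j k hjk
    have h1 := hf j
    rw [hjk, ← hf k] at h1
    exact he (hy.mul_left_cancel h1)
  obtain ⟨j, rfl⟩ := Finite.surjective_of_injective hinj i
  exact ⟨j, hf j⟩

theorem isUnit_of_mem_closure {A R : Type*} [Group A] [Ring R] {ρ : A →* R} {V : Subgroup A} {z : R}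
    (hz : IsUnit z) {y : R} (hy : y ∈ Submonoid.closure (insert z (ρ '' V))) : IsUnit y := by
  have : Submonoid.closure (insert z (ρ '' V)) ≤ IsUnit.submonoid R := by
    refine Submonoid.closure_le.2 ?_
    rintro _ (rfl | ⟨x, _, rfl⟩)
    exacts [hz, (Group.isUnit x).map ρ]
  exact this hy

variable {R ι : Type*} [Ring R] [Algebra K R] {F G : ι → R}

theorem adjoin_le_adjoin_ladder (h2 : (2 : K) ≠ 0) (s : ι → ℤˣ) :
    Algebra.adjoin K (Set.range F ∪ Set.range G) ≤
      Algebra.adjoin K ((Set.range fun i => ladder K F G i (s i)) ∪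
        Set.range fun i => ladder K F G i (-s i)) := by
  have hb : ∀ i, ladder K F G i (s i) ∈ Algebra.adjoin K
      ((Set.range fun i => ladder K F G i (s i)) ∪ Set.range fun i => ladder K F G i (-s i)) :=
    fun i => Algebra.subset_adjoin (Or.inl ⟨i, rfl⟩)
  have hc : ∀ i, ladder K F G i (-s i) ∈ Algebra.adjoin K
      ((Set.range fun i => ladder K F G i (s i)) ∪ Set.range fun i => ladder K F G i (-s i)) :=
    fun i => Algebra.subset_adjoin (Or.inr ⟨i, rfl⟩)
  refine Algebra.adjoin_le ?_
  rintro _ (⟨i, rfl⟩ | ⟨i, rfl⟩)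
  · rw [← ladder_add_ladder_neg (F := F) (G := G) h2 i (s i)]
    exact add_mem (hb i) (hc i)
  · have e : s i • G i = ladder K F G i (s i) - ladder K F G i (-s i) := by
      rw [ladder, ladder, ← smul_sub, Units.neg_smul]
      rw [show F i + s i • G i - (F i + -(s i • G i)) = s i • G i + s i • G i by abel,
        two_inv_smul_add_self h2]
    have e1 := sub_mem (hb i) (hc i)
    rw [← e] at e1
    rcases Int.units_eq_one_or (s i) with hs | hs
    · rwa [hs, one_smul] at e1
    · rw [hs, Units.neg_smul, one_smul] at e1
      exact neg_mem_iff.1 e1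

/-- The eigenvectors of `F i * G i` are the vectors killed by an isotropic combination. -/
theorem ladder_mul_eq_zero_iff (h : AntiSystem F G) (h2 : (2 : K) ≠ 0) (i : ι) (s : ℤˣ) (ω : R) :
    ladder K F G i s * ω = 0 ↔ F i * G i * ω = s • ω := by
  have e : F i * (F i + s • G i) = -1 + s • (F i * G i) := by
    rw [mul_add, h.F_sq, mul_smul_comm]
  rw [ladder, smul_mul_assoc, smul_eq_zero_iff_right (inv_ne_zero h2),
    ← (h.F_unit i).mul_right_eq_zero, ← mul_assoc, e, add_mul, neg_one_mul, neg_add_eq_zero,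
    smul_mul_assoc]
  constructor
  · intro h1
    nth_rewrite 2 [h1]
    rw [smul_smul, Int.units_mul_self, one_smul]
  · intro h1
    rw [h1, smul_smul, Int.units_mul_self, one_smul]

theorem flipElt_mem_adjoin [Fintype ι] :
    flipElt F G ∈ Algebra.adjoin K (Set.range F ∪ Set.range G) := by
  unfold flipElt
  split_ifs
  · refine Subalgebra.list_prod_mem _ fun x hx => ?_
    obtain ⟨i, _, rfl⟩ := List.mem_map.1 hx
    exact Algebra.subset_adjoin (Or.inr ⟨i, rfl⟩)
  · refine Subalgebra.list_prod_mem _ fun x hx => ?_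
    obtain ⟨i, _, rfl⟩ := List.mem_map.1 hx
    exact Algebra.subset_adjoin (Or.inl ⟨i, rfl⟩)

theorem mem_of_mem_closure {A : Type*} [Group A] {ρ : A →* R} {V : Subgroup A} {z : R}
    {W : Subalgebra K R} (hz : z ∈ W) (hV : ∀ x ∈ V, ρ x ∈ W) {y : R}
    (hy : y ∈ Submonoid.closure (insert z (ρ '' V))) : y ∈ W := by
  have : Submonoid.closure (insert z (ρ '' V)) ≤ W.toSubmonoid := by
    refine Submonoid.closure_le.2 ?_
    rintro _ (rfl | ⟨x, hx, rfl⟩)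
    exacts [hz, hV x hx]
  exact this hy

/-- A common eigenvector of the involutions `F i * G i`, for any choice of eigenvalues. It is a vacuum
vector, and hence determined up to a scalar by the eigenvalues. -/
theorem exists_eigenvector [Nontrivial R] [Fintype ι] [DecidableEq ι] (h : AntiSystem F G)
    (h2 : (2 : K) ≠ 0) (s : ι → ℤˣ) :
    ∃ ω : R, ω ≠ 0 ∧ (∀ i, F i * G i * ω = s i • ω) ∧
      ∀ y ∈ Algebra.adjoin K (Set.range F ∪ Set.range G),
        (∀ i, F i * G i * (y * ω) = s i • (y * ω)) → ∃ k : K, y * ω = k • ω := by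
  obtain ⟨ω, hω0, hω⟩ := exists_vacuum (fun i => ladder K F G i (s i))
    (fun i => ladder_sq h i _) (fun i j hij => ladder_anticomm h hij _ _) Finset.univ
  refine ⟨ω, hω0, fun i => (ladder_mul_eq_zero_iff h h2 i (s i) ω).1 (hω i (Finset.mem_univ i)),
    fun y hy hyω => ?_⟩
  refine exists_smul_of_vacuum (κ := fun _ => (-1 : K)) (c := fun i => ladder K F G i (-s i))
    (fun _ => neg_ne_zero.2 one_ne_zero) (fun i => ladder_sq h i _)
    (fun i j hij => ladder_anticomm h hij _ _) (fun i j hij => ladder_anticomm h hij _ _)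
    (fun i => ?_) (fun i => hω i (Finset.mem_univ i)) (adjoin_le_adjoin_ladder h2 s hy)
    fun i => (ladder_mul_eq_zero_iff h h2 i (s i) _).2 (hyω i)
  have := ladder_car h h2 i (-s i)
  rw [neg_neg] at this
  rw [this, map_neg, map_one]

end Inst

section BlockV

variable (K : Type*) [Field K] (l : ℕ)

/-- The block system of the extended Weyl group: the blocks are the pairs `{e_i, -e_i}` of
weights. -/
def blockSystemExtWeyl (h2 : (2 : K) ≠ 0) (hl : 0 < l) :
    BlockSystem K (Fin l) (coeHom K l) (extWeyl K l) (toralPart K l) where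
  P i := clF K l i * clG K l i
  Q := clG K l
  neg := (exists_neg h2 hl).choose
  pair j k := (exists_pair h2 j k).choose
  flip := flipElt (clF K l) (clG K l)
  P_sq := antiSystem_clF_clG.p_sq
  P_comm := antiSystem_clF_clG.p_comm
  P_Q := antiSystem_clF_clG.p_mul_G
  Q_anti := antiSystem_clF_clG.G_G
  Q_unit := antiSystem_clF_clG.G_unit
  coe_neg := (exists_neg h2 hl).choose_spec.2
  coe_pair j k := (exists_pair h2 j k).choose_spec.2
  H_eq := toralPart_eq_closure h2 hl (exists_neg h2 hl).choose_spec.1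
    (exists_neg h2 hl).choose_spec.2 (fun j k => (exists_pair h2 j k).choose_spec.1)
    fun j k => (exists_pair h2 j k).choose_spec.2
  H_le := inf_le_right
  monomial x hx := by
    obtain ⟨π, ε, δ, h⟩ := isMonomial_of_mem_extWeyl h2 hx
    exact ⟨π, _, δ, fun j => ⟨mul_mul_eq_smul (h j).1 (h j).2, (h j).2⟩⟩
  prod_comm he x hx := by
    have := flipElt_comm h2 hx
    rw [flipElt, if_pos he] at this
    exact this.symm
  flip_unit := antiSystem_clF_clG.isUnit_flipElt
  flip_P := antiSystem_clF_clG.flipElt_p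
  flip_comm x hx := flipElt_comm h2 hx
  vacuum s := by
    have h := antiSystem_clF_clG (K := K) (l := l)
    have := nontrivial_cl (l := l) h2
    obtain ⟨ω, hω0, hω, hy⟩ := exists_eigenvector h h2 s
    refine ⟨ω, hω0, ⟨1, fun j => by rw [hω, one_mul]⟩, fun y hyV hyP => hy y
      (mem_of_mem_closure flipElt_mem_adjoin (fun x hx => coe_mem_of_mem_extWeyl h2 hx) hyV)
      fun i => ?_⟩
    have hinj : Function.Injective fun j => s j • (clF K l j * clG K l j) := fun j k hjk =>
      eq_of_smul_eq_smul h2 h.p_sq h.p_mul_G h.G_unit hjk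
    obtain ⟨j, hj⟩ := exists_preimage_of_conj hinj
      (isUnit_of_mem_closure h.isUnit_flipElt hyV) hyP i
    have e : ∀ j, (s j • (clF K l j * clG K l j)) * ω = ω := fun j => by
      rw [smul_mul_assoc, hω, smul_smul, Int.units_mul_self, one_smul]
    have e1 : (s i • (clF K l i * clG K l i)) * (y * ω) = y * ω := by
      rw [← mul_assoc, ← hj, mul_assoc, e]
    nth_rewrite 2 [← e1]
    rw [smul_mul_assoc, smul_smul, Int.units_mul_self, one_smul]

theorem signExtendible_extWeyl [IsAlgClosed K] (h2 : (2 : K) ≠ 0) (hl : 0 < l) :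
    SignExtendible K (toralPart K l) (extWeyl K l) := by
  have := nontrivial_cl (l := l) h2
  have : Nonempty (Fin l) := ⟨⟨0, hl⟩⟩
  intro θ S hS h
  exact (blockSystemExtWeyl K l h2 hl).exists_extension coeHom_injective h2 hS θ h

variable {K l}

theorem sq_of_mem_toralPart (h2 : (2 : K) ≠ 0) (hl : 0 < l) {x y : Spin K l}
    (hx : x ∈ toralPart K l) (hy : y ∈ toralPart K l) : x * x = 1 ∧ x * y = y * x := by
  have h := antiSystem_clF_clG (K := K) (l := l)
  have hcomm : ∀ {x y : Spin K l}, x ∈ toralPart K l → y ∈ toralPart K l → x * y = y * x := by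
    intro x y hx hy
    apply coeHom_injective
    rw [map_mul, map_mul]
    refine Algebra.commute_of_mem_adjoin_of_forall_mem_commute (coe_mem_of_mem_torus h2 hy.1) ?_
    rintro _ ⟨j, rfl⟩
    refine (Algebra.commute_of_mem_adjoin_of_forall_mem_commute
      (coe_mem_of_mem_torus h2 hx.1) ?_).symm
    rintro _ ⟨k, rfl⟩
    exact h.p_comm j k
  refine ⟨?_, hcomm hx hy⟩
  have B := blockSystemExtWeyl K l h2 hl
  rw [B.H_eq] at hx
  induction hx using Subgroup.closure_induction with
  | mem x hx =>
    apply coeHom_injective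
    rcases hx with rfl | ⟨j, k, rfl⟩
    · rw [map_mul, B.coe_neg, neg_mul_neg, one_mul, map_one]
    · rw [map_mul, B.coe_pair, map_one, mul_assoc, ← mul_assoc (B.P k), ← B.P_comm j k,
        mul_assoc (B.P j) (B.P k), B.P_sq, mul_one, B.P_sq]
  | one => rw [one_mul]
  | mul x z hx hz ihx ihz =>
    rw [← B.H_eq] at hx hz
    rw [mul_assoc, ← mul_assoc z, hcomm hz hx, mul_assoc, ihz, mul_one, ihx]
  | inv x _ ihx => rw [← mul_inv_rev, ihx, inv_one]

end BlockV

/-! ### The action of `v₀` -/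

section Shift

variable {K : Type*} [Field K] {l : ℕ}

theorem coe_nElt_simpleRoot (h2 : (2 : K) ≠ 0) {i j : Fin l} (hij : (i : ℕ) = j + 1) :
    coeHom K l (nElt (simpleRoot i) 1) =
      (2⁻¹ : K) • ((1 - clF K l i * clF K l j) * (1 - (-1 : ℤˣ) • (clG K l i * clG K l j))) := by
  have hne : i ≠ j := by
    rintro rfl
    omega
  have h0 : (i : ℕ) ≠ 0 := by omega
  have := coe_nElt_long h2 hne 1 (-1) (simpleRoot i) (by rw [simpleRoot, dif_neg h0]; rfl) (by
    have hj : (⟨i - 1, by omega⟩ : Fin l) = j := Fin.ext (by simp only; omega)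
    rw [simpleRoot, dif_neg h0, wpos, if_neg (by decide), ← hj])
  rwa [one_mul] at this

/-- The action of the product of the first `k` simple reflections. -/
theorem prod_take_action (h2 : (2 : K) ≠ 0) (k : ℕ) (hk : k < l) :
    ∀ W, W = coeHom K l
      ((List.ofFn fun i : Fin l => nElt (simpleRoot i) (1 : Kˣ)).take (k + 1)).prod →
    (∀ s t : Fin l, (t : ℕ) = s + 1 → (t : ℕ) ≤ k →
      W * clF K l s = (-1 : ℤˣ) • (clF K l t * W) ∧ W * clG K l s = (-1 : ℤˣ) • (clG K l t * W)) ∧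
    (∀ s z : Fin l, (s : ℕ) = k → (z : ℕ) = 0 →
      W * clF K l s = ((-1) ^ k : ℤˣ) • (clF K l z * W) ∧
      W * clG K l s = ((-1) ^ (k + 1) : ℤˣ) • (clG K l z * W)) ∧
    ∀ s : Fin l, k < s → W * clF K l s = (-1 : ℤˣ) • (clF K l s * W) ∧
      W * clG K l s = (-1 : ℤˣ) • (clG K l s * W) := by
  have h := antiSystem_clF_clG (K := K) (l := l)
  induction k with
  | zero =>
    intro W hW
    have e : W = clF K l ⟨0, hk⟩ := by
      rw [hW, List.prod_take_succ _ _ (by simpa using hk), List.take_zero, List.prod_nil, one_mul,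
        List.getElem_ofFn, coe_nElt_short h2]
    rw [e]
    refine ⟨fun s t ht h0 => by omega, fun s z hs hz => ?_, fun s hs => ?_⟩
    · obtain rfl : s = ⟨0, hk⟩ := Fin.ext hs
      obtain rfl : z = ⟨0, hk⟩ := Fin.ext hz
      rw [pow_zero, one_smul, zero_add, pow_one]
      exact ⟨rfl, h.F_mul_G _ _⟩
    · have hne : s ≠ ⟨0, hk⟩ := by
        rintro rfl
        exact lt_irrefl _ hs
      exact ⟨by rw [h.F_mul_F, if_neg hne], h.F_mul_G _ _⟩
  | succ k ih =>
    intro W hW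
    obtain ⟨i1, i2, i3⟩ := ih (by omega) _ rfl
    rw [List.prod_take_succ _ _ (by simpa using hk), List.getElem_ofFn, map_mul] at hW
    set W' := coeHom K l ((List.ofFn fun i : Fin l =>
      nElt (simpleRoot i) (1 : Kˣ)).take (k + 1)).prod
    let i : Fin l := ⟨k + 1, hk⟩
    let j : Fin l := ⟨k, by omega⟩
    have hij : i ≠ j := by simp [i, j]
    have e : coeHom K l (nElt (simpleRoot i) 1) = _ := coe_nElt_simpleRoot (j := j) h2 rfl
    have hF := fun s => smul_mul_eq (2⁻¹ : K) (h.isMonomial_rotation hij (-1) s).1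
    have hG := fun s => smul_mul_eq (2⁻¹ : K) (h.isMonomial_rotation hij (-1) s).2
    rw [← e] at hF hG
    have comp : ∀ {a b c : Cl K l} {ε δ : ℤˣ},
        coeHom K l (nElt (simpleRoot i) 1) * a = ε • (b * coeHom K l (nElt (simpleRoot i) 1)) →
        W' * b = δ • (c * W') → W * a = (ε * δ) • (c * W) := by
      intro a b c ε δ ha hb
      rw [hW, mul_assoc, ha, mul_smul_comm, ← mul_assoc, hb, smul_mul_assoc, smul_smul, mul_assoc]
    refine ⟨fun s t ht htk => ?_, fun s z hs hz => ?_, fun s hs => ?_⟩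
    · by_cases hsj : s = j
      · have hti : t = i := by
          rw [hsj] at ht
          exact Fin.ext ht
        have hF' := hF s
        have hG' := hG s
        rw [if_neg (hsj.trans_ne hij.symm), hsj, Equiv.swap_apply_right] at hF' hG'
        rw [if_pos rfl, neg_neg] at hG'
        obtain ⟨c1, c2⟩ := i3 i (by simp [i])
        have d1 := comp hF' c1
        have d2 := comp hG' c2
        rw [one_mul] at d1 d2
        rw [hsj, hti]
        exact ⟨d1, d2⟩
      · have hsi : s ≠ i := by
          rintro rfl
          simp only [i] at ht htk
          omega
        have hsk : (t : ℕ) ≤ k := by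
          have : (s : ℕ) ≠ k := fun h0 => hsj (Fin.ext h0)
          omega
        have hF' := hF s
        have hG' := hG s
        rw [if_neg hsi, Equiv.swap_apply_of_ne_of_ne hsi hsj] at hF' hG'
        rw [if_neg hsj] at hG'
        obtain ⟨c1, c2⟩ := i1 s t ht hsk
        have d1 := comp hF' c1
        have d2 := comp hG' c2
        rw [one_mul] at d1 d2
        exact ⟨d1, d2⟩
    · have hsi : s = i := Fin.ext hs
      have hF' := hF s
      have hG' := hG s
      rw [if_pos hsi, hsi, Equiv.swap_apply_left] at hF' hG'
      obtain ⟨c1, c2⟩ := i2 j z rfl hz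
      have d1 := comp hF' c1
      have d2 := comp hG' c2
      rw [hsi, pow_succ' _ (k + 1), pow_succ' _ k]
      rw [pow_succ' _ k] at d2
      exact ⟨d1, d2⟩
    · have hsi : s ≠ i := by
        rintro rfl
        simp only [i] at hs
        omega
      have hsj : s ≠ j := by
        rintro rfl
        simp only [j] at hs
        omega
      have hF' := hF s
      have hG' := hG s
      rw [if_neg hsi, Equiv.swap_apply_of_ne_of_ne hsi hsj] at hF' hG'
      rw [if_neg hsj] at hG'
      obtain ⟨c1, c2⟩ := i3 s (by omega)
      have d1 := comp hF' c1
      have d2 := comp hG' c2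
      rw [one_mul] at d1 d2
      exact ⟨d1, d2⟩

/-- The residue of `n`, as an index. -/
def idx (hl : 0 < l) (n : ℕ) : Fin l := ⟨n % l, Nat.mod_lt _ hl⟩

/-- The `F i` with signs and indices in `ℕ`, such that `v₀` acts as the shift by one. -/
def shiftF (K : Type*) [Field K] (hl : 0 < l) (n : ℕ) : Cl K l :=
  ((-1) ^ (n % l) : ℤˣ) • clF K l (idx hl n)

/-- The `G i` with signs and indices in `ℕ`, such that `v₀` acts as the shift by one. -/
def shiftG (K : Type*) [Field K] (hl : 0 < l) (n : ℕ) : Cl K l :=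
  ((-1) ^ (n % l + n / l) : ℤˣ) • clG K l (idx hl n)

theorem v₀_mul_shift (h2 : (2 : K) ≠ 0) (hl : 0 < l) (n : ℕ) :
    coeHom K l (v₀ K l) * shiftF K hl n = shiftF K hl (n + 1) * coeHom K l (v₀ K l) ∧
    coeHom K l (v₀ K l) * shiftG K hl n = shiftG K hl (n + 1) * coeHom K l (v₀ K l) := by
  obtain ⟨h1, h3, -⟩ := prod_take_action (K := K) (l := l) h2 (l - 1) (by omega) _ rfl
  have e : ((List.ofFn fun i : Fin l => nElt (simpleRoot i) (1 : Kˣ)).take (l - 1 + 1)).prod =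
      v₀ K l := by
    rw [List.take_of_length_le (by rw [List.length_ofFn]; omega)]
    rfl
  rw [e] at h1 h3
  have hn := Nat.mod_lt n hl
  have hdiv := Nat.div_add_mod n l
  rw [shiftF, shiftF, shiftG, shiftG, mul_smul_comm, mul_smul_comm, smul_mul_assoc, smul_mul_assoc]
  by_cases hc : n % l = l - 1
  · obtain ⟨e1, e2⟩ : (n + 1) / l = n / l + 1 ∧ (n + 1) % l = 0 :=
      (Nat.div_mod_unique hl).2 ⟨by rw [mul_add]; omega, hl⟩
    obtain ⟨c1, c2⟩ := h3 (idx hl n) (idx hl (n + 1)) hc e2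
    rw [c1, c2, smul_smul, smul_smul, e1, e2, hc, pow_zero, one_smul, Int.units_mul_self, one_smul,
      zero_add]
    refine ⟨rfl, ?_⟩
    congr 1
    rw [pow_add, mul_right_comm, ← pow_add, show l - 1 + (l - 1 + 1) = 2 * (l - 1) + 1 by omega,
      pow_succ, pow_mul, neg_one_sq, one_pow, one_mul, pow_succ, mul_comm]
  · obtain ⟨e1, e2⟩ : (n + 1) / l = n / l ∧ (n + 1) % l = n % l + 1 :=
      (Nat.div_mod_unique hl).2 ⟨by omega, by omega⟩
    obtain ⟨c1, c2⟩ := h1 (idx hl n) (idx hl (n + 1)) e2 (by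
      change (n + 1) % l ≤ l - 1
      omega)
    rw [c1, c2, smul_smul, smul_smul, e1, e2, pow_succ, add_right_comm, pow_succ]
    exact ⟨rfl, rfl⟩

end Shift

/-! ### Twisted fixed points of odd type -/

section Norm

variable {A : Type*} [Group A]

/-- The norm `h · vhv⁻¹ ⋯ vⁿ⁻¹hv¹⁻ⁿ`, a product of `n` factors. -/
def twistNorm (v h : A) : ℕ → A
  | 0 => 1
  | n + 1 => twistNorm v h n * (v ^ n * h * (v ^ n)⁻¹)

variable {v : A} {H : Subgroup A}

theorem pow_conj_mem (hv : ∀ h ∈ H, v * h * v⁻¹ ∈ H) (n : ℕ) {h : A} (hh : h ∈ H) :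
    v ^ n * h * (v ^ n)⁻¹ ∈ H := by
  induction n with
  | zero => simpa using hh
  | succ n ih =>
    have := hv _ ih
    rw [pow_succ', mul_inv_rev]
    simpa only [mul_assoc] using this

theorem twistNorm_mem (hv : ∀ h ∈ H, v * h * v⁻¹ ∈ H) (n : ℕ) {h : A} (hh : h ∈ H) :
    twistNorm v h n ∈ H := by
  induction n with
  | zero => exact one_mem _
  | succ n ih => exact mul_mem ih (pow_conj_mem hv n hh)

theorem twistNorm_mul (hv : ∀ h ∈ H, v * h * v⁻¹ ∈ H) (hH : ∀ x ∈ H, ∀ y ∈ H, x * y = y * x)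
    (n : ℕ) {h h' : A} (hh : h ∈ H) (hh' : h' ∈ H) :
    twistNorm v (h * h') n = twistNorm v h n * twistNorm v h' n := by
  induction n with
  | zero => exact (one_mul 1).symm
  | succ n ih =>
    have e : v ^ n * (h * h') * (v ^ n)⁻¹ = v ^ n * h * (v ^ n)⁻¹ * (v ^ n * h' * (v ^ n)⁻¹) := by
      group
    rw [twistNorm, twistNorm, twistNorm, ih, e, mul_assoc, ← mul_assoc (twistNorm v h' n),
      hH _ (twistNorm_mem hv n hh') _ (pow_conj_mem hv n hh)]
    simp only [mul_assoc]

theorem twistNorm_conj {x : A} (hx : v * x = x * v) (n : ℕ) (h : A) :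
    twistNorm v (x * h * x⁻¹) n = x * twistNorm v h n * x⁻¹ := by
  induction n with
  | zero => simp [twistNorm]
  | succ n ih =>
    have e : v ^ n * x = x * v ^ n := (Commute.pow_left hx n).eq
    have e' : x⁻¹ * (v ^ n)⁻¹ = (v ^ n)⁻¹ * x⁻¹ := by rw [← mul_inv_rev, e, mul_inv_rev]
    rw [twistNorm, twistNorm, ih]
    rw [show v ^ n * (x * h * x⁻¹) * (v ^ n)⁻¹ = v ^ n * x * h * (x⁻¹ * (v ^ n)⁻¹) by
      simp only [mul_assoc], e, e']
    group

theorem twistNorm_of_commute {h : A} (hh : v * h = h * v) (n : ℕ) : twistNorm v h n = h ^ n := by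
  induction n with
  | zero => rw [twistNorm, pow_zero]
  | succ n ih =>
    have e : v ^ n * h = h * v ^ n := (Commute.pow_left hh n).eq
    rw [twistNorm, ih, e, mul_inv_cancel_right, pow_succ]

theorem mul_conj_twistNorm (v h : A) (n : ℕ) :
    h * (v * twistNorm v h n * v⁻¹) = twistNorm v h (n + 1) := by
  induction n with
  | zero => simp [twistNorm]
  | succ n ih =>
    calc h * (v * twistNorm v h (n + 1) * v⁻¹) =
        h * (v * twistNorm v h n * v⁻¹) * (v ^ (n + 1) * h * (v ^ (n + 1))⁻¹) := by
          rw [twistNorm, pow_succ']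
          group
      _ = _ := by rw [ih]; rfl

/-- If an odd power of `v` centralizes `H`, then the sign characters of the centralizer of `v` in
`H` extend to `H` along the norm map, which is the identity on this centralizer. -/
theorem SignExtendible.of_odd {K : Type*} [Field K] {V Y X : Subgroup A}
    (hVH : ∀ x ∈ V, ∀ h ∈ H, x * h * x⁻¹ ∈ H) (hvV : v ∈ V)
    (hH : ∀ x ∈ H, ∀ y ∈ H, x * y = y * x) (hsq : ∀ x ∈ H, x * x = 1) {n : ℕ} (hn : Odd n)
    (hvn : ∀ h ∈ H, v ^ n * h = h * v ^ n) (hY : ∀ x, x ∈ Y ↔ x ∈ H ∧ v * x = x * v)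
    (hX : ∀ x ∈ X, x ∈ V ∧ v * x = x * v) (hext : SignExtendible K H V) :
    SignExtendible K Y X := by
  intro θ S hS hθ
  have hv : ∀ h ∈ H, v * h * v⁻¹ ∈ H := hVH v hvV
  have hN : ∀ h ∈ H, twistNorm v h n ∈ Y := by
    intro h hh
    refine (hY _).2 ⟨twistNorm_mem hv n hh, ?_⟩
    have h1 := mul_conj_twistNorm v h n
    rw [twistNorm, hvn h hh, mul_inv_cancel_right, hH _ (twistNorm_mem hv n hh) h hh] at h1
    have h3 := mul_left_cancel h1
    rwa [mul_inv_eq_iff_eq_mul] at h3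
  let θ' : H →* ℤˣ :=
    { toFun := fun h => θ ⟨_, hN h h.2⟩
      map_one' := by
        rw [← map_one θ]
        congr 1
        apply Subtype.ext
        change twistNorm v 1 n = 1
        rw [twistNorm_of_commute (by simp), one_pow]
      map_mul' := fun a b => by
        rw [← map_mul]
        congr 1
        exact Subtype.ext (twistNorm_mul hv hH n a.2 b.2) }
  obtain ⟨χ, hχ⟩ := hext θ' S (fun x hx => (hX x (hS hx)).1) fun x hx h => by
    obtain ⟨h1, h3⟩ := hX x (hS hx)
    refine ⟨hVH x h1 h h.2, ?_⟩
    obtain ⟨h4, h5⟩ := hθ x hx ⟨_, hN h h.2⟩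
    refine Eq.trans ?_ h5
    change θ _ = θ _
    congr 1
    exact Subtype.ext (twistNorm_conj h3 n h)
  refine ⟨χ, fun y hs => ?_⟩
  obtain ⟨hyH, hyv⟩ := (hY y).1 y.2
  have e : twistNorm v (y : A) n = y := by
    obtain ⟨k, rfl⟩ := hn
    rw [twistNorm_of_commute hyv, pow_add, pow_mul, pow_two, hsq _ hyH, one_pow, one_mul, pow_one]
  rw [hχ ⟨y, hyH⟩ hs]
  change ((θ ⟨_, _⟩ : ℤ) : K) = _
  congr 3
  exact Subtype.ext e

end Norm

section Odd

variable {K : Type*} [Field K] {l : ℕ}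

/-- The toral part is normal in the extended Weyl group, which permutes its generators. -/
theorem conj_mem_toralPart (h2 : (2 : K) ≠ 0) (hl : 0 < l) {x h : Spin K l} (hx : x ∈ extWeyl K l)
    (hh : h ∈ toralPart K l) : x * h * x⁻¹ ∈ toralPart K l := by
  have B := blockSystemExtWeyl K l h2 hl
  obtain ⟨π, μ, ν, hm⟩ := B.monomial x hx
  have hsub : toralPart K l ≤ (toralPart K l).comap (MulAut.conj x).toMonoidHom := by
    conv_lhs => rw [B.H_eq]
    refine (Subgroup.closure_le _).2 ?_
    rintro _ (rfl | ⟨j, k, rfl⟩)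
    · have : x * B.neg * x⁻¹ = B.neg := by
        apply coeHom_injective
        rw [map_mul, map_mul, B.coe_neg, mul_neg, mul_one, neg_mul, ← map_mul, mul_inv_cancel,
          map_one]
      change x * B.neg * x⁻¹ ∈ toralPart K l
      rw [this]
      exact B.neg_mem
    · have : x * B.pair j k * x⁻¹ = B.signElt (μ j * μ k) * B.pair (π j) (π k) := by
        apply coeHom_injective
        rw [map_mul, map_mul, B.coe_pair, mul_mul_eq_smul (hm j).1 (hm k).1, smul_mul_assoc,
          mul_assoc, ← map_mul, mul_inv_cancel, map_one, mul_one, map_mul, B.coe_signElt,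
          B.coe_pair, smul_mul_assoc, one_mul]
      change x * B.pair j k * x⁻¹ ∈ toralPart K l
      rw [this]
      exact mul_mem (B.signElt_mem _) (B.pair_mem _ _)
  exact hsub hh

theorem pow_mul_shift (h2 : (2 : K) ≠ 0) (hl : 0 < l) (k n : ℕ) :
    coeHom K l (v₀ K l ^ k) * shiftF K hl n = shiftF K hl (n + k) * coeHom K l (v₀ K l ^ k) ∧
    coeHom K l (v₀ K l ^ k) * shiftG K hl n = shiftG K hl (n + k) * coeHom K l (v₀ K l ^ k) := by
  induction k with
  | zero => simp
  | succ k ih =>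
    obtain ⟨h1, h3⟩ := v₀_mul_shift (K := K) h2 hl (n + k)
    rw [pow_succ', map_mul]
    constructor
    · rw [mul_assoc, ih.1, ← mul_assoc, h1, mul_assoc, add_assoc]
    · rw [mul_assoc, ih.2, ← mul_assoc, h3, mul_assoc, add_assoc]

theorem shiftF_add (hl : 0 < l) (n : ℕ) : shiftF K hl (n + l) = shiftF K hl n := by
  unfold shiftF idx
  simp only [Nat.add_mod_right]

theorem shiftG_add (hl : 0 < l) (n : ℕ) : shiftG K hl (n + l) = -shiftG K hl n := by
  unfold shiftG idx
  simp only [Nat.add_mod_right, Nat.add_div_right n hl]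
  rw [← add_assoc, pow_succ, mul_neg_one, Units.neg_smul]

theorem shift_of_lt (hl : 0 < l) (i : Fin l) :
    shiftF K hl i * shiftG K hl i = clF K l i * clG K l i := by
  have : idx hl (i : ℕ) = i := Fin.ext (Nat.mod_eq_of_lt i.2)
  rw [shiftF, shiftG, this, Nat.div_eq_of_lt i.2, add_zero, smul_mul_smul_comm, Int.units_mul_self,
    one_smul]

/-- The power `v₀ ^ l` negates all `F i * G i`, and hence centralizes the toral part. -/
theorem v₀_pow_comm (h2 : (2 : K) ≠ 0) (hl : 0 < l) {h : Spin K l} (hh : h ∈ toralPart K l) :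
    v₀ K l ^ l * h = h * v₀ K l ^ l := by
  have B := blockSystemExtWeyl K l h2 hl
  have hP : ∀ i : Fin l, coeHom K l (v₀ K l ^ l) * (clF K l i * clG K l i) =
      (-1 : ℤˣ) • (clF K l i * clG K l i * coeHom K l (v₀ K l ^ l)) := by
    intro i
    obtain ⟨h1, h3⟩ := pow_mul_shift (K := K) h2 hl l i
    rw [← shift_of_lt hl, ← mul_assoc, h1, mul_assoc, h3, shiftF_add, shiftG_add, Units.neg_smul,
      one_smul, neg_mul, mul_neg, mul_assoc]
  have hle : toralPart K l ≤ Subgroup.centralizer {v₀ K l ^ l} := by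
    conv_lhs => rw [toralPart_eq_closure h2 hl (exists_neg h2 hl).choose_spec.1
      (exists_neg h2 hl).choose_spec.2 (fun j k => (exists_pair h2 j k).choose_spec.1)
      fun j k => (exists_pair h2 j k).choose_spec.2]
    refine (Subgroup.closure_le _).2 ?_
    rintro _ (rfl | ⟨j, k, rfl⟩)
    · refine Subgroup.mem_centralizer_singleton_iff.2 (coeHom_injective ?_)
      rw [map_mul, map_mul, (exists_neg h2 hl).choose_spec.2, mul_neg, neg_mul, mul_one, one_mul]
    · refine Subgroup.mem_centralizer_singleton_iff.2 (coeHom_injective ?_)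
      rw [map_mul, map_mul, (exists_pair h2 j k).choose_spec.2, mul_mul_eq_smul (hP j) (hP k),
        Int.units_mul_self, one_smul]
  exact (Subgroup.mem_centralizer_singleton_iff.1 (hle hh)).symm

end Odd

/-! ### Products along arithmetic progressions -/

section Blk

variable {R : Type*} [Ring R]

/-- The ordered product `e n * e (n + a) * ⋯` of `k` factors. -/
def blk (a k : ℕ) (e : ℕ → R) (n : ℕ) : R := ((List.range k).map fun t => e (n + t * a)).prod

theorem blk_zero (a : ℕ) (e : ℕ → R) (n : ℕ) : blk a 0 e n = 1 := rfl

theorem blk_succ (a k : ℕ) (e : ℕ → R) (n : ℕ) :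
    blk a (k + 1) e n = blk a k e n * e (n + k * a) := by
  rw [blk, List.range_succ, List.map_append, List.prod_append, List.map_singleton,
    List.prod_singleton]
  rfl

theorem blk_succ' (a k : ℕ) (e : ℕ → R) (n : ℕ) :
    blk a (k + 1) e n = e n * blk a k e (n + a) := by
  rw [blk, List.range_succ_eq_map, List.map_cons, List.prod_cons, List.map_map, zero_mul, add_zero,
    blk]
  congr 3
  funext t
  simp only [Function.comp, Nat.succ_eq_add_one]
  congr 1
  ring

theorem mul_blk {a k : ℕ} {e : ℕ → R} {x : R} {n m : ℕ} {ε : ℤˣ}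
    (h : ∀ t, t < k → x * e (n + t * a) = ε • (e (m + t * a) * x)) :
    x * blk a k e n = ε ^ k • (blk a k e m * x) := by
  induction k with
  | zero => simp [blk_zero]
  | succ k ih =>
    rw [blk_succ, blk_succ, ← mul_assoc, ih fun t ht => h t (by omega), smul_mul_assoc, mul_assoc,
      h k (by omega), mul_smul_comm, smul_smul, mul_assoc, pow_succ]

theorem blk_mul {a k : ℕ} {e : ℕ → R} {x : R} {n : ℕ} {ε : ℤˣ}
    (h : ∀ t, t < k → e (n + t * a) * x = ε • (x * e (n + t * a))) :
    blk a k e n * x = ε ^ k • (x * blk a k e n) := by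
  rw [mul_blk (ε := ε) (m := n) fun t ht => by
    rw [h t ht, smul_smul, Int.units_mul_self, one_smul], smul_smul, ← mul_pow, Int.units_mul_self,
    one_pow, one_smul]

/-- If `x` anticommutes with exactly one of the factors `e (n + t * a)`, `t = t₀`, and commutes with
the others, then it anticommutes with the product if and only if the factor occurs. -/
theorem mul_blk_of_one {a k : ℕ} {e : ℕ → R} {x : R} {n t₀ : ℕ}
    (h : ∀ t, t < k → x * e (n + t * a) =
      if t = t₀ then -(e (n + t * a) * x) else e (n + t * a) * x) :
    x * blk a k e n = if t₀ < k then -(blk a k e n * x) else blk a k e n * x := by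
  induction k with
  | zero => simp [blk_zero]
  | succ k ih =>
    rw [blk_succ, ← mul_assoc, ih fun t ht => h t (by omega)]
    have hk := h k (by omega)
    by_cases h1 : k = t₀
    · rw [if_pos h1] at hk
      rw [if_neg (by omega), if_pos (by omega), mul_assoc, hk, mul_neg, mul_assoc]
    · rw [if_neg h1] at hk
      by_cases h3 : t₀ < k
      · rw [if_pos h3, if_pos (by omega), neg_mul, mul_assoc, hk, mul_assoc]
      · rw [if_neg h3, if_neg (by omega), mul_assoc, hk, mul_assoc]

theorem isUnit_blk {a k : ℕ} {e : ℕ → R} {n : ℕ} (h : ∀ t, t < k → IsUnit (e (n + t * a))) :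
    IsUnit (blk a k e n) := by
  induction k with
  | zero => exact isUnit_one
  | succ k ih =>
    rw [blk_succ]
    exact (ih fun t ht => h t (by omega)).mul (h k (by omega))

/-- For anticommuting elements of equal squares, the product of the reflections in the differences
of neighbours permutes the elements cyclically, up to a sign. -/
theorem blk_sub_mul {a k : ℕ} {e : ℕ → R} {n : ℕ}
    (hanti : ∀ i j, i ≤ k → j ≤ k → i ≠ j →
      e (n + i * a) * e (n + j * a) = -(e (n + j * a) * e (n + i * a)))
    (hsq : ∀ i j, i ≤ k → j ≤ k → e (n + i * a) * e (n + i * a) = e (n + j * a) * e (n + j * a)) :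
    (∀ s, s < k → blk a k (fun i => e i - e (i + a)) n * e (n + s * a) =
      ((-1) ^ k : ℤˣ) • (e (n + (s + 1) * a) * blk a k (fun i => e i - e (i + a)) n)) ∧
    blk a k (fun i => e i - e (i + a)) n * e (n + k * a) =
      ((-1) ^ k : ℤˣ) • (e n * blk a k (fun i => e i - e (i + a)) n) := by
  induction k with
  | zero => simp [blk_zero]
  | succ k ih =>
    obtain ⟨ih1, ih2⟩ := ih (fun i j hi hj => hanti i j (by omega) (by omega))
      fun i j hi hj => hsq i j (by omega) (by omega)
    have hr : n + k * a + a = n + (k + 1) * a := by ring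
    have a1 := hanti k (k + 1) (by omega) (by omega) (by omega)
    have a2 := hsq k (k + 1) (by omega) (by omega)
    have step : ∀ {x y z : R} {ε : ℤˣ},
        (e (n + k * a) - e (n + (k + 1) * a)) * x = -(y * (e (n + k * a) - e (n + (k + 1) * a))) →
        blk a k (fun i => e i - e (i + a)) n * y =
          ε • (z * blk a k (fun i => e i - e (i + a)) n) →
        blk a (k + 1) (fun i => e i - e (i + a)) n * x =
          (ε * -1) • (z * blk a (k + 1) (fun i => e i - e (i + a)) n) := by
      intro x y z ε h1 h3
      rw [blk_succ, hr, mul_assoc, h1, mul_neg, ← mul_assoc, h3, mul_neg_one, Units.neg_smul,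
        smul_mul_assoc, mul_assoc]
    rw [pow_succ]
    refine ⟨fun s hs => ?_, ?_⟩
    · rcases Nat.lt_succ_iff_lt_or_eq.1 hs with hs | rfl
      · refine step ?_ (ih1 s hs)
        rw [sub_mul, mul_sub, hanti k s (by omega) (by omega) (by omega),
          hanti (k + 1) s (by omega) (by omega) (by omega)]
        abel
      · refine step (y := e (n + (s + 1) * a)) ?_ ?_
        · rw [sub_mul, mul_sub, a2]
          abel
        · refine blk_mul fun t ht => ?_
          rw [sub_mul, mul_sub, Units.neg_smul, one_smul,
            show n + t * a + a = n + (t + 1) * a by ring,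
            hanti t (s + 1) (by omega) (by omega) (by omega),
            hanti (t + 1) (s + 1) (by omega) (by omega) (by omega)]
          abel
    · refine step (y := e (n + k * a)) ?_ ih2
      rw [sub_mul, mul_sub, a1, ← a2]
      abel

end Blk

/-! ### Anticommuting systems with a shift -/

/-- Anticommuting sequences `f` and `g`, which are periodic and antiperiodic, respectively, with
period `l`, and whose members of different residues are different members of an anticommuting
system. -/
structure ShiftSystem {R : Type*} [Ring R] (l : ℕ) (f g : ℕ → R) : Prop where
  f_sq : ∀ n, f n * f n = -1
  g_sq : ∀ n, g n * g n = 1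
  f_f : ∀ n m, n % l ≠ m % l → f n * f m = -(f m * f n)
  g_g : ∀ n m, n % l ≠ m % l → g n * g m = -(g m * g n)
  f_g : ∀ n m, f n * g m = -(g m * f n)
  f_add : ∀ n, f (n + l) = f n
  g_add : ∀ n, g (n + l) = -g n

namespace ShiftSystem

variable {R : Type*} [Ring R] {l : ℕ} {f g : ℕ → R} (S : ShiftSystem l f g)

include S

theorem g_f (n m : ℕ) : g n * f m = -(f m * g n) := by rw [S.f_g, neg_neg]

theorem f_mod (n : ℕ) : f (n % l) = f n := by
  have key : ∀ k r, f (r + l * k) = f r := by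
    intro k
    induction k with
    | zero => simp
    | succ k ih =>
      intro r
      rw [mul_add, mul_one, ← add_assoc, S.f_add, ih]
  rw [← key (n / l) (n % l), Nat.mod_add_div]

theorem g_mod (n : ℕ) : ∃ ε : ℤˣ, g n = ε • g (n % l) := by
  have key : ∀ k r, g (r + l * k) = ((-1) ^ k : ℤˣ) • g r := by
    intro k
    induction k with
    | zero => simp
    | succ k ih =>
      intro r
      rw [mul_add, mul_one, ← add_assoc, S.g_add, ih, pow_succ, mul_neg_one, Units.neg_smul]
  refine ⟨(-1) ^ (n / l), ?_⟩
  rw [← key, Nat.mod_add_div]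

theorem g_of_mod_eq {n m : ℕ} (h : n % l = m % l) : ∃ ε : ℤˣ, g n = ε • g m := by
  obtain ⟨ε, h1⟩ := S.g_mod n
  obtain ⟨δ, h3⟩ := S.g_mod m
  exact ⟨ε * δ, by rw [h1, h, h3, smul_smul, mul_assoc, Int.units_mul_self, mul_one]⟩

theorem p_mul_f (i n : ℕ) :
    f i * g i * f n = if i % l = n % l then -(f n * (f i * g i)) else f n * (f i * g i) := by
  rw [mul_assoc, S.g_f, mul_neg, ← mul_assoc]
  split_ifs with h
  · rw [← S.f_mod i, h, S.f_mod n, mul_assoc]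
  · rw [S.f_f i n h, neg_mul, neg_neg, mul_assoc]

theorem p_mul_g (i n : ℕ) :
    f i * g i * g n = if i % l = n % l then -(g n * (f i * g i)) else g n * (f i * g i) := by
  split_ifs with h
  · obtain ⟨ε, h1⟩ := S.g_of_mod_eq h
    rw [h1, mul_smul_comm, smul_mul_assoc, mul_smul_comm, ← mul_assoc (g n), S.g_f, neg_mul,
      smul_neg, neg_neg]
  · rw [mul_assoc, S.g_g i n h, mul_neg, ← mul_assoc, S.f_g, neg_mul, neg_neg, mul_assoc]

theorem p_comm (i j : ℕ) : f i * g i * (f j * g j) = f j * g j * (f i * g i) := by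
  rw [← mul_assoc, S.p_mul_f]
  split_ifs with hij
  · rw [neg_mul, mul_assoc (f j), S.p_mul_g, if_pos hij, mul_neg, neg_neg, ← mul_assoc]
  · rw [mul_assoc, S.p_mul_g, if_neg hij, ← mul_assoc]

theorem p_sq (i : ℕ) : f i * g i * (f i * g i) = 1 := by
  rw [mul_assoc, ← mul_assoc (g i), S.g_f, neg_mul, mul_neg, mul_assoc, S.g_sq, mul_one, S.f_sq,
    neg_neg]

variable {a d : ℕ}

theorem blk_p_comm (k k' n m : ℕ) :
    blk a k (fun i => f i * g i) n * blk a k' (fun i => f i * g i) m =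
      blk a k' (fun i => f i * g i) m * blk a k (fun i => f i * g i) n := by
  have := blk_mul (a := a) (k := k) (e := fun i => f i * g i) (n := n) (ε := 1)
    (x := blk a k' (fun i => f i * g i) m) fun t _ => by
      have := mul_blk (a := a) (k := k') (e := fun i => f i * g i) (n := m) (m := m) (ε := 1)
        (x := f (n + t * a) * g (n + t * a)) fun t' _ => by rw [one_smul, S.p_comm]
      rwa [one_pow] at this
  rwa [one_pow, one_smul] at this

theorem p_mul_blk (k n i : ℕ) : f i * g i * blk a k (fun i => f i * g i) n =
    blk a k (fun i => f i * g i) n * (f i * g i) := by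
  have := S.blk_p_comm (a := a) 1 k i n
  rwa [blk_succ, blk_zero, one_mul, zero_mul, add_zero] at this

/-- The involution of a block. -/
theorem blk_p_sq (k n : ℕ) :
    blk a k (fun i => f i * g i) n * blk a k (fun i => f i * g i) n = 1 := by
  induction k with
  | zero => exact one_mul 1
  | succ k ih =>
    rw [blk_succ, mul_assoc, ← mul_assoc (f _ * g _), S.p_mul_blk, mul_assoc, S.p_sq, mul_one, ih]

theorem blk_p_add (hl : l = a * d) (hd : 0 < d) (n : ℕ) :
    blk a d (fun i => f i * g i) (n + a) = -blk a d (fun i => f i * g i) n := by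
  obtain ⟨k, rfl⟩ : ∃ k, d = k + 1 := ⟨d - 1, by omega⟩
  rw [blk_succ, blk_succ', show n + a + k * a = n + l by rw [hl]; ring, S.f_add, S.g_add, mul_neg,
    mul_neg, S.p_mul_blk]

omit S in
theorem add_mul_mod_inj (hl : l = a * d) (ha : 0 < a) {j s t : ℕ} (hs : s < d) (ht : t < d)
    (h : (j + s * a) % l = (j + t * a) % l) : s = t := by
  have h1 : s * a ≡ t * a [MOD d * a] := by
    rw [mul_comm d, ← hl]
    exact Nat.ModEq.add_left_cancel' j h
  exact Nat.ModEq.eq_of_lt_of_lt (Nat.ModEq.mul_right_cancel' ha.ne' h1) hs ht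

omit S in
theorem exists_add_eq (hl : l = a * d) (ha : 0 < a) (hd : 0 < d) {i j : ℕ} (h : j % a = i % a) :
    ∃ q < d, ∃ c c', i + l * c = j + q * a + l * c' := by
  have hl0 : 0 < l := by rw [hl]; exact Nat.mul_pos ha hd
  have hle : j ≤ i + l * j := le_add_left (Nat.le_mul_of_pos_left j hl0)
  have hmod : j ≡ i + l * j [MOD a] := by
    rw [hl, mul_assoc]
    exact h.trans (Nat.add_mul_mod_self_left _ _ _).symm
  obtain ⟨M, hM⟩ := (Nat.modEq_iff_dvd' hle).1 hmod
  refine ⟨M % d, Nat.mod_lt _ hd, j, M / d, ?_⟩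
  have hMd := Nat.mod_add_div M d
  calc i + l * j = j + a * M := by omega
    _ = j + a * (M % d + d * (M / d)) := by rw [hMd]
    _ = j + M % d * a + l * (M / d) := by rw [hl]; ring

omit S in
theorem ne_of_block_ne (hl : l = a * d) {i j t : ℕ} (h : j % a ≠ i % a) :
    (j + t * a) % l ≠ i % l := by
  intro h1
  apply h
  have h3 : (j + t * a) % l % a = i % l % a := by rw [h1]
  rwa [hl, Nat.mod_mul_right_mod, Nat.mod_mul_right_mod, Nat.add_mul_mod_self_right] at h3

theorem f_mul_blk_p (hl : l = a * d) (ha : 0 < a) (hd : 0 < d) (j i : ℕ) :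
    f i * blk a d (fun i => f i * g i) j =
      if j % a = i % a then -(blk a d (fun i => f i * g i) j * f i)
      else blk a d (fun i => f i * g i) j * f i := by
  have hp : ∀ n, f i * (f n * g n) =
      if n % l = i % l then -(f n * g n * f i) else f n * g n * f i := by
    intro n
    rw [S.p_mul_f]
    split_ifs
    · rw [neg_neg]
    · rfl
  split_ifs with h
  · obtain ⟨q, hq, c, c', hi⟩ := exists_add_eq hl ha hd h
    have hi' : i % l = (j + q * a) % l := by
      rw [← Nat.add_mul_mod_self_left i l c, hi, Nat.add_mul_mod_self_left]
    rw [mul_blk_of_one (t₀ := q) fun t ht => ?_, if_pos hq]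
    rw [hp]
    congr 1
    rw [hi', eq_iff_iff]
    exact ⟨add_mul_mod_inj hl ha ht hq, fun h1 => by rw [h1]⟩
  · have := mul_blk (x := f i) (e := fun i => f i * g i) (a := a) (k := d) (n := j) (m := j)
      (ε := 1)
      fun t ht => by rw [hp, if_neg (ne_of_block_ne hl h), one_smul]
    rwa [one_pow, one_smul] at this

theorem blk_p_mul_f (hl : l = a * d) (ha : 0 < a) (hd : 0 < d) (j i : ℕ) :
    blk a d (fun i => f i * g i) j * f i =
      if j % a = i % a then -(f i * blk a d (fun i => f i * g i) j)
      else f i * blk a d (fun i => f i * g i) j := by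
  rw [S.f_mul_blk_p hl ha hd]
  split_ifs
  · rw [neg_neg]
  · rfl

/-- The product of the reflections in the differences of neighbours in a block of the `f n`. -/
theorem blk_f_mul_f (hl : l = a * d) (ha : 0 < a) (hd : Even d) (hd0 : 0 < d) (j i : ℕ) :
    blk a (d - 1) (fun i => f i - f (i + a)) j * f i =
      -((if j % a = i % a then f (i + a) else f i) *
        blk a (d - 1) (fun i => f i - f (i + a)) j) := by
  have hodd : Odd (d - 1) := Nat.Even.sub_odd hd0 hd odd_one
  by_cases h : j % a = i % a
  · rw [if_pos h]
    have hc := blk_sub_mul (a := a) (k := d - 1) (e := f) (n := j)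
      (fun s t hs ht hst => S.f_f _ _ (by
        exact fun h1 => hst (add_mul_mod_inj hl ha (by omega) (by omega) h1)))
      fun s t _ _ => by rw [S.f_sq, S.f_sq]
    rw [hodd.neg_one_pow] at hc
    obtain ⟨q, hlt, c, c', hi⟩ := exists_add_eq hl ha hd0 h
    have hf : ∀ n m, f (n + l * m) = f n := fun n m => by
      rw [← S.f_mod, Nat.add_mul_mod_self_left, S.f_mod]
    have e1 : f i = f (j + q * a) := by rw [← hf i c, hi, hf]
    have e2 : f (i + a) = f (j + (q + 1) * a) := by
      rw [← hf (i + a) c, add_right_comm, hi, add_right_comm, hf]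
      ring_nf
    rw [e1, e2]
    by_cases hlast : q = d - 1
    · rw [hlast, hc.2, Units.neg_smul, one_smul, Nat.sub_add_cancel hd0,
        show j + d * a = j + l by rw [hl, mul_comm], S.f_add]
    · rw [hc.1 _ (by omega), Units.neg_smul, one_smul]
  · rw [if_neg h, blk_mul (ε := -1) fun t _ => ?_, hodd.neg_one_pow, Units.neg_smul, one_smul]
    rw [sub_mul, mul_sub, S.f_f _ _ (ne_of_block_ne hl h),
      show j + t * a + a = j + (t + 1) * a by ring, S.f_f _ _ (ne_of_block_ne hl h),
      Units.neg_smul, one_smul]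
    abel

theorem blk_f_mul_g (hd : Even d) (hd0 : 0 < d) (j i : ℕ) :
    blk a (d - 1) (fun i => f i - f (i + a)) j * g i =
      -(g i * blk a (d - 1) (fun i => f i - f (i + a)) j) := by
  have hodd : Odd (d - 1) := Nat.Even.sub_odd hd0 hd odd_one
  rw [blk_mul (ε := -1) fun t _ => ?_, hodd.neg_one_pow, Units.neg_smul, one_smul]
  rw [sub_mul, mul_sub, S.f_g, S.f_g, Units.neg_smul, one_smul]
  abel

/-- A rotation of a block of the `g n`. -/
theorem blk_g_mul_g (hl : l = a * d) (ha : 0 < a) (hd : Even d) (hd0 : 0 < d) (j i : ℕ) :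
    g j * blk a (d - 1) (fun i => g i - g (i + a)) j * g i =
      (if j % a = i % a then g (i + a) else g i) *
        (g j * blk a (d - 1) (fun i => g i - g (i + a)) j) := by
  have hodd : Odd (d - 1) := Nat.Even.sub_odd hd0 hd odd_one
  by_cases h : j % a = i % a
  · rw [if_pos h]
    have hc := blk_sub_mul (a := a) (k := d - 1) (e := g) (n := j)
      (fun s t hs ht hst => S.g_g _ _ (by
        exact fun h1 => hst (add_mul_mod_inj hl ha (by omega) (by omega) h1)))
      fun s t _ _ => by rw [S.g_sq, S.g_sq]
    rw [hodd.neg_one_pow] at hc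
    obtain ⟨q, hlt, c, c', hi⟩ := exists_add_eq hl ha hd0 h
    have key : g j * blk a (d - 1) (fun i => g i - g (i + a)) j * g (j + q * a) =
        g (j + (q + 1) * a) * (g j * blk a (d - 1) (fun i => g i - g (i + a)) j) := by
      by_cases hlast : q = d - 1
      · rw [hlast, mul_assoc, hc.2, Units.neg_smul, one_smul, Nat.sub_add_cancel hd0,
          show j + d * a = j + l by rw [hl, mul_comm], S.g_add, mul_neg, neg_mul]
      · rw [mul_assoc, hc.1 _ (by omega), Units.neg_smul, one_smul, mul_neg, ← mul_assoc,
          S.g_g j (j + (q + 1) * a), neg_mul, neg_neg, mul_assoc]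
        intro h1
        have := add_mul_mod_inj (s := 0) hl ha hd0 (show q + 1 < d by omega)
          (by rwa [zero_mul, add_zero])
        omega
    have hg : ∀ r k, g (r + l * k) = ((-1) ^ k : ℤˣ) • g r := by
      intro r k
      induction k with
      | zero => simp
      | succ k ih =>
        rw [mul_add, mul_one, ← add_assoc, S.g_add, ih, pow_succ, mul_neg_one, Units.neg_smul]
    have hgu : ∀ r k, g r = ((-1) ^ k : ℤˣ) • g (r + l * k) := fun r k => by
      rw [hg, smul_smul, Int.units_mul_self, one_smul]
    rw [hgu i c, hgu (i + a) c, add_right_comm i, hi, add_right_comm _ _ a, hg, hg,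
      show j + q * a + a = j + (q + 1) * a by ring, mul_smul_comm, mul_smul_comm, key,
      smul_mul_assoc, smul_mul_assoc]
  · rw [if_neg h, mul_assoc, blk_mul (ε := -1) fun t _ => ?_, hodd.neg_one_pow, Units.neg_smul,
      one_smul, mul_neg, ← mul_assoc, S.g_g j i, neg_mul, neg_neg, mul_assoc]
    · have := ne_of_block_ne (t := 0) hl h
      rwa [zero_mul, add_zero] at this
    · rw [sub_mul, mul_sub, S.g_g _ _ (ne_of_block_ne hl h),
        show j + t * a + a = j + (t + 1) * a by ring, S.g_g _ _ (ne_of_block_ne hl h),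
        Units.neg_smul, one_smul]
      abel

theorem blk_g_mul_f (hd : Even d) (hd0 : 0 < d) (j i : ℕ) :
    g j * blk a (d - 1) (fun i => g i - g (i + a)) j * f i =
      f i * (g j * blk a (d - 1) (fun i => g i - g (i + a)) j) := by
  have hodd : Odd (d - 1) := Nat.Even.sub_odd hd0 hd odd_one
  rw [mul_assoc, blk_mul (ε := -1) fun t _ => ?_, hodd.neg_one_pow, Units.neg_smul, one_smul,
    mul_neg, ← mul_assoc, S.g_f, neg_mul, neg_neg, mul_assoc]
  rw [sub_mul, mul_sub, S.g_f, S.g_f, Units.neg_smul, one_smul]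
  abel

theorem isUnit_blk_f {K : Type*} [Field K] [Algebra K R] (h2 : (2 : K) ≠ 0) (hl : l = a * d)
    (ha : 0 < a) (j : ℕ) : IsUnit (blk a (d - 1) (fun i => f i - f (i + a)) j) := by
  refine isUnit_blk fun t ht => ?_
  have e : (f (j + t * a) - f (j + t * a + a)) * (f (j + t * a) - f (j + t * a + a)) =
      -(1 + 1) := by
    rw [sub_mul, mul_sub, mul_sub, S.f_sq, S.f_sq, S.f_f (j + t * a) (j + t * a + a)]
    · abel
    · intro h1
      rw [show j + t * a + a = j + (t + 1) * a by ring] at h1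
      have := add_mul_mod_inj hl ha (by omega) (by omega) h1
      omega
  have e2 := two_inv_smul_add_self h2 (1 : R)
  refine ⟨⟨f (j + t * a) - f (j + t * a + a), -((2⁻¹ : K) • (f (j + t * a) - f (j + t * a + a))),
    ?_, ?_⟩, rfl⟩
  · rw [mul_neg, mul_smul_comm, e, smul_neg, neg_neg, e2]
  · rw [neg_mul, smul_mul_assoc, e, smul_neg, neg_neg, e2]

theorem isUnit_blk_g {K : Type*} [Field K] [Algebra K R] (h2 : (2 : K) ≠ 0) (hl : l = a * d)
    (ha : 0 < a) (j : ℕ) : IsUnit (g j * blk a (d - 1) (fun i => g i - g (i + a)) j) := by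
  refine IsUnit.mul ⟨⟨g j, g j, S.g_sq j, S.g_sq j⟩, rfl⟩ (isUnit_blk fun t ht => ?_)
  have e : (g (j + t * a) - g (j + t * a + a)) * (g (j + t * a) - g (j + t * a + a)) = 1 + 1 := by
    rw [sub_mul, mul_sub, mul_sub, S.g_sq, S.g_sq, S.g_g (j + t * a) (j + t * a + a)]
    · abel
    · intro h1
      rw [show j + t * a + a = j + (t + 1) * a by ring] at h1
      have := add_mul_mod_inj hl ha (by omega) (by omega) h1
      omega
  have e2 := two_inv_smul_add_self h2 (1 : R)
  refine ⟨⟨g (j + t * a) - g (j + t * a + a), (2⁻¹ : K) • (g (j + t * a) - g (j + t * a + a)),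
    ?_, ?_⟩, rfl⟩
  · rw [mul_smul_comm, e, e2]
  · rw [smul_mul_assoc, e, e2]

theorem blk_f_add {K : Type*} [Field K] [Algebra K R] (h2 : (2 : K) ≠ 0) (hl : l = a * d)
    (ha : 0 < a) (hd : Even d) (hd0 : 0 < d) (j : ℕ) :
    blk a (d - 1) (fun i => f i - f (i + a)) (j + a) =
      -blk a (d - 1) (fun i => f i - f (i + a)) j := by
  have hodd : Odd (d - 1) := Nat.Even.sub_odd hd0 hd odd_one
  have h1 : ∀ t, blk a (d - 1) (fun i => f i - f (i + a)) j * f (j + t * a) =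
      -(f (j + t * a + a) * blk a (d - 1) (fun i => f i - f (i + a)) j) := fun t => by
    rw [S.blk_f_mul_f hl ha hd hd0, if_pos (by rw [Nat.add_mul_mod_self_right])]
  have h3 := mul_blk (a := a) (k := d - 1) (e := fun i => f i - f (i + a)) (n := j) (m := j + a)
    (ε := -1) (x := blk a (d - 1) (fun i => f i - f (i + a)) j) fun t _ => by
      have h4 := h1 (t + 1)
      rw [show j + (t + 1) * a = j + t * a + a by ring] at h4
      rw [mul_sub, h1, h4, show j + a + t * a = j + t * a + a by ring, sub_mul, Units.neg_smul,
        one_smul]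
      abel
  rw [hodd.neg_one_pow, ← smul_mul_assoc, Units.neg_smul, one_smul] at h3
  rw [(S.isUnit_blk_f h2 hl ha j).mul_right_cancel h3, neg_neg]

theorem blk_g_add {K : Type*} [Field K] [Algebra K R] (h2 : (2 : K) ≠ 0) (hl : l = a * d)
    (ha : 0 < a) (hd : Even d) (hd0 : 0 < d) (j : ℕ) :
    g (j + a) * blk a (d - 1) (fun i => g i - g (i + a)) (j + a) =
      g j * blk a (d - 1) (fun i => g i - g (i + a)) j := by
  have h1 : ∀ t, g j * blk a (d - 1) (fun i => g i - g (i + a)) j * g (j + t * a) =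
      g (j + t * a + a) * (g j * blk a (d - 1) (fun i => g i - g (i + a)) j) := fun t => by
    rw [S.blk_g_mul_g hl ha hd hd0, if_pos (by rw [Nat.add_mul_mod_self_right])]
  have h3 := mul_blk (a := a) (k := d - 1) (e := fun i => g i - g (i + a)) (n := j) (m := j + a)
    (ε := 1) (x := g j * blk a (d - 1) (fun i => g i - g (i + a)) j) fun t _ => by
      have h4 := h1 (t + 1)
      rw [show j + (t + 1) * a = j + t * a + a by ring] at h4
      rw [mul_sub, h1, h4, show j + a + t * a = j + t * a + a by ring, sub_mul, one_smul]
  rw [one_pow, one_smul] at h3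
  have h5 := h1 0
  rw [zero_mul, add_zero] at h5
  refine (S.isUnit_blk_g h2 hl ha j).mul_right_cancel ?_
  conv_rhs => rw [← mul_assoc, h5, mul_assoc, h3]
  rw [mul_assoc]

end ShiftSystem

/-! ### Elements that commute with a shift -/

section Perm

variable {R : Type*} [Ring R]

theorem eq_smul_mod {a : ℕ} {e : ℕ → R} (h : ∀ n, e (n + a) = -e n) (n : ℕ) :
    e n = ((-1) ^ (n / a) : ℤˣ) • e (n % a) := by
  have key : ∀ k r, e (r + a * k) = ((-1) ^ k : ℤˣ) • e r := by
    intro k r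
    induction k with
    | zero => simp
    | succ k ih =>
      rw [mul_add, mul_one, ← add_assoc, h, ih, pow_succ, mul_neg_one, Units.neg_smul]
  rw [← key, Nat.mod_add_div]

/-- `x` permutes the residues modulo `l`, compatibly with the translation by `a`, such that it acts
on the `f n` and the `g n` by this permutation up to signs that are constant on blocks. -/
def IsShiftMonomial (l a : ℕ) (f g : ℕ → R) (x : R) : Prop :=
  ∃ (π : ℕ → ℕ) (ε δ : ℕ → ℤˣ), (∀ i, i < l → ∃ n, π n = i) ∧ ∀ n t,
    x * f (n + t * a) = ε n • (f (π n + t * a) * x) ∧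
    x * g (n + t * a) = δ n • (g (π n + t * a) * x)

/-- The product of a family of elements that `x` permutes up to signs is mapped to itself or its
negative. -/
theorem exists_sign_mul_prod_of_perm {ι : Type*} [Fintype ι] {x : R} {Q : ι → R}
    (hQ : ∀ j k, j ≠ k → Q j * Q k = -(Q k * Q j)) {π : ι → ι} (hπ : Function.Bijective π)
    {ν : ι → ℤˣ} (h : ∀ j, x * Q j = ν j • (Q (π j) * x)) :
    ∃ α : ℤˣ, x * (Finset.univ.toList.map Q).prod = α • ((Finset.univ.toList.map Q).prod * x) := by
  obtain ⟨α, hα⟩ := exists_sign_mul_prod (Q' := Q ∘ π) h Finset.univ.toList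
  have hp : (Finset.univ.toList.map π).Perm Finset.univ.toList := by
    refine (List.perm_ext_iff_of_nodup ((Finset.nodup_toList _).map hπ.1)
      (Finset.nodup_toList _)).2 fun j => ?_
    simp only [List.mem_map, Finset.mem_toList, Finset.mem_univ, true_and, iff_true]
    exact hπ.2 j
  obtain ⟨β, hβ⟩ := exists_sign_of_perm hQ hp
  refine ⟨α * β, ?_⟩
  rw [hα, ← List.map_map, hβ, smul_mul_assoc, smul_smul]

theorem mul_prod_of_perm {ι : Type*} [Fintype ι] {x : R} {Q : ι → R}
    (hQ : ∀ j k, Q j * Q k = Q k * Q j) {π : ι → ι} (hπ : Function.Bijective π)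
    (h : ∀ j, x * Q j = Q (π j) * x) :
    x * (Finset.univ.toList.map Q).prod = (Finset.univ.toList.map Q).prod * x := by
  have h1 := mul_prod_of_smul (Q' := Q ∘ π) (ε := 1)
    (fun j => by rw [h, Pi.one_apply, one_smul]; rfl) Finset.univ.toList
  have hp : (Finset.univ.toList.map π).Perm Finset.univ.toList := by
    refine (List.perm_ext_iff_of_nodup ((Finset.nodup_toList _).map hπ.1)
      (Finset.nodup_toList _)).2 fun j => ?_
    simp only [List.mem_map, Finset.mem_toList, Finset.mem_univ, true_and, iff_true]
    exact hπ.2 j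
  have hc : ((Finset.univ.toList.map π).map Q).prod = (Finset.univ.toList.map Q).prod :=
    (hp.map Q).prod_eq' (List.pairwise_of_forall_mem_list (by
      intro r hr r' hr'
      obtain ⟨j, -, rfl⟩ := List.mem_map.1 hr
      obtain ⟨k, -, rfl⟩ := List.mem_map.1 hr'
      exact hQ j k))
  have h3 : (Finset.univ.toList.map (1 : ι → ℤˣ)).prod = 1 := by
    rw [Finset.prod_map_toList]
    exact Finset.prod_eq_one fun _ _ => rfl
  rw [h1, h3, one_smul, ← List.map_map, hc]

/-- If one factor of a product takes `y` to `y'`, and the others commute or anticommute with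
both, then the product takes `y` to `y'`, up to a sign. -/
theorem prod_mul_of_one {ι : Type*} [DecidableEq ι] {Q : ι → R} {y y' : R} {τ : ℤˣ} {j : ι}
    (h : ∀ k, Q k * y = τ • ((if k = j then y' else y) * Q k))
    (h' : ∀ k, k ≠ j → Q k * y' = τ • (y' * Q k)) {L : List ι} (hL : L.Nodup) :
    (L.map Q).prod * y = τ ^ L.length • ((if j ∈ L then y' else y) * (L.map Q).prod) := by
  induction L with
  | nil => simp
  | cons k L ih =>
    obtain ⟨hk, hL⟩ := List.nodup_cons.1 hL
    rw [List.map_cons, List.prod_cons, mul_assoc, ih hL, mul_smul_comm, ← mul_assoc,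
      List.length_cons, pow_succ, mul_smul]
    congr 1
    by_cases hkj : k = j
    · rw [← hkj, if_neg hk, if_pos List.mem_cons_self, h, if_pos hkj, smul_mul_assoc, mul_assoc]
    · by_cases hj : j ∈ L
      · rw [if_pos hj, if_pos (List.mem_cons_of_mem _ hj), h' k hkj, smul_mul_assoc, mul_assoc]
      · rw [if_neg hj, h, if_neg hkj, if_neg, smul_mul_assoc, mul_assoc]
        rw [List.mem_cons]
        exact not_or.2 ⟨Ne.symm hkj, hj⟩

end Perm

namespace ShiftSystem

variable {R : Type*} [Ring R] {l : ℕ} {f g : ℕ → R} (S : ShiftSystem l f g) {a d : ℕ}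

theorem mul_blk_p {π : ℕ → ℕ} {ε δ : ℕ → ℤˣ} {x : R} (hd : Even d)
    (h : ∀ n t, x * f (n + t * a) = ε n • (f (π n + t * a) * x) ∧
      x * g (n + t * a) = δ n • (g (π n + t * a) * x)) (n : ℕ) :
    x * blk a d (fun i => f i * g i) n = blk a d (fun i => f i * g i) (π n) * x := by
  rw [mul_blk (a := a) (k := d) (e := fun i => f i * g i) (x := x) (n := n) (m := π n)
    (ε := ε n * δ n) fun t _ => mul_mul_eq_smul (h n t).1 (h n t).2]
  obtain ⟨k, rfl⟩ := hd
  rw [← two_mul, pow_mul, sq, Int.units_mul_self, one_pow, one_smul]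

theorem mul_blk_sub {π : ℕ → ℕ} {ε : ℕ → ℤˣ} {x : R} (hd : Even d) (hd0 : 0 < d)
    (h : ∀ n t, x * f (n + t * a) = ε n • (f (π n + t * a) * x)) (n : ℕ) :
    x * blk a (d - 1) (fun i => f i - f (i + a)) n =
      ε n • (blk a (d - 1) (fun i => f i - f (i + a)) (π n) * x) := by
  rw [mul_blk (m := π n) (ε := ε n) fun t _ => ?_]
  · obtain ⟨k, hk⟩ := hd
    rw [show d - 1 = 2 * (k - 1) + 1 by omega, pow_succ, pow_mul, sq, Int.units_mul_self, one_pow,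
      one_mul]
  · have h1 := h n (t + 1)
    rw [show n + (t + 1) * a = n + t * a + a by ring,
      show π n + (t + 1) * a = π n + t * a + a by ring] at h1
    rw [mul_sub, h, h1, sub_mul, smul_sub]

include S

variable {K : Type*} [Field K] [Algebra K R]

theorem blk_f_anti (hl : l = a * d) (hd : Even d) (hd0 : 0 < d) {j k : ℕ} (hjk : j % a ≠ k % a) :
    blk a (d - 1) (fun i => f i - f (i + a)) j * blk a (d - 1) (fun i => f i - f (i + a)) k =
      -(blk a (d - 1) (fun i => f i - f (i + a)) k *
        blk a (d - 1) (fun i => f i - f (i + a)) j) := by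
  have hodd : Odd (d - 1) := Nat.Even.sub_odd hd0 hd odd_one
  have h1 : ∀ n, k % a = n % a → blk a (d - 1) (fun i => f i - f (i + a)) j * f n =
      (-1 : ℤˣ) • (f n * blk a (d - 1) (fun i => f i - f (i + a)) j) := fun n hn => by
    rw [blk_mul (ε := -1) fun t _ => ?_, hodd.neg_one_pow]
    have hjn : j % a ≠ n % a := hn ▸ hjk
    rw [sub_mul, mul_sub, S.f_f _ _ (ne_of_block_ne hl hjn),
      show j + t * a + a = j + (t + 1) * a by ring, S.f_f _ _ (ne_of_block_ne hl hjn),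
      Units.neg_smul, one_smul]
    abel
  rw [mul_blk (m := k) (ε := -1) fun t _ => ?_, hodd.neg_one_pow, Units.neg_smul, one_smul]
  rw [mul_sub, sub_mul, h1 _ (by rw [Nat.add_mul_mod_self_right]),
    h1 _ (by rw [Nat.add_mod_right, Nat.add_mul_mod_self_right]), smul_sub]

theorem blk_g_comm (hl : l = a * d) (ha : 0 < a) (hd : Even d) (hd0 : 0 < d) {j k : ℕ}
    (hjk : j % a ≠ k % a) :
    g j * blk a (d - 1) (fun i => g i - g (i + a)) j *
        (g k * blk a (d - 1) (fun i => g i - g (i + a)) k) =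
      g k * blk a (d - 1) (fun i => g i - g (i + a)) k *
        (g j * blk a (d - 1) (fun i => g i - g (i + a)) j) := by
  have h1 : ∀ n, k % a = n % a → g j * blk a (d - 1) (fun i => g i - g (i + a)) j * g n =
      g n * (g j * blk a (d - 1) (fun i => g i - g (i + a)) j) := fun n hn => by
    rw [S.blk_g_mul_g hl ha hd hd0, if_neg (hn ▸ hjk)]
  have h3 := mul_blk (x := g j * blk a (d - 1) (fun i => g i - g (i + a)) j) (a := a) (k := d - 1)
    (e := fun i => g i - g (i + a)) (n := k) (m := k) (ε := 1) fun t _ => by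
      rw [mul_sub, sub_mul, h1 _ (by rw [Nat.add_mul_mod_self_right]),
        h1 _ (by rw [Nat.add_mod_right, Nat.add_mul_mod_self_right]), one_smul]
  rw [one_pow, one_smul] at h3
  rw [← mul_assoc, h1 k rfl, mul_assoc, h3, mul_assoc]

theorem blk_p_mul_blk_f (hl : l = a * d) (ha : 0 < a) (hd : Even d) (hd0 : 0 < d) (j k : ℕ) :
    blk a d (fun i => f i * g i) j * blk a (d - 1) (fun i => f i - f (i + a)) k =
      if j % a = k % a then
        -(blk a (d - 1) (fun i => f i - f (i + a)) k * blk a d (fun i => f i * g i) j)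
      else blk a (d - 1) (fun i => f i - f (i + a)) k * blk a d (fun i => f i * g i) j := by
  have hodd : Odd (d - 1) := Nat.Even.sub_odd hd0 hd odd_one
  have h1 : ∀ n, n % a = k % a → blk a d (fun i => f i * g i) j * f n =
      (if j % a = k % a then (-1 : ℤˣ) else 1) • (f n * blk a d (fun i => f i * g i) j) :=
    fun n hn => by
      rw [S.blk_p_mul_f hl ha hd0, hn]
      split_ifs
      · rw [Units.neg_smul, one_smul]
      · rw [one_smul]
  rw [mul_blk (m := k) (ε := if j % a = k % a then (-1 : ℤˣ) else 1) fun t _ => ?_]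
  · split_ifs
    · rw [hodd.neg_one_pow, Units.neg_smul, one_smul]
    · rw [one_pow, one_smul]
  · rw [mul_sub, sub_mul, h1 _ (by rw [Nat.add_mul_mod_self_right]),
      h1 _ (by rw [Nat.add_mod_right, Nat.add_mul_mod_self_right]), smul_sub]

theorem blk_p_injective [Nontrivial R] (h2 : (2 : K) ≠ 0) (hl : l = a * d) (ha : 0 < a)
    (hd : Even d) (hd0 : 0 < d) {j k : Fin a} {u u' : ℤˣ}
    (h : u • blk a d (fun i => f i * g i) (j : ℕ) = u' • blk a d (fun i => f i * g i) (k : ℕ)) :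
    j = k := by
  refine eq_of_smul_eq_smul (K := K) (P := fun j : Fin a => blk a d (fun i => f i * g i) (j : ℕ))
    (Q := fun j : Fin a => blk a (d - 1) (fun i => f i - f (i + a)) (j : ℕ)) h2
    (fun j => S.blk_p_sq _ _) (fun j k => ?_) (fun j => S.isUnit_blk_f h2 hl ha _) h
  have := S.blk_p_mul_blk_f hl ha hd hd0 j k
  simp only [Nat.mod_eq_of_lt (Fin.is_lt _), ← Fin.ext_iff] at this
  exact this

/-- The action of a shift monomial element on the blocks. -/
theorem exists_block_perm [Nontrivial R] (h2 : (2 : K) ≠ 0) (hl : l = a * d) (ha : 0 < a)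
    (hd : Even d) (hd0 : 0 < d) {x : R} (hxu : IsUnit x) (hx : IsShiftMonomial l a f g x) :
    ∃ (π : Fin a → Fin a) (μ ν : Fin a → ℤˣ), Function.Bijective π ∧ ∀ j : Fin a,
      x * blk a d (fun i => f i * g i) j =
        μ j • (blk a d (fun i => f i * g i) (π j : ℕ) * x) ∧
      x * blk a (d - 1) (fun i => f i - f (i + a)) j =
        ν j • (blk a (d - 1) (fun i => f i - f (i + a)) (π j : ℕ) * x) ∧
      x * (g j * blk a (d - 1) (fun i => g i - g (i + a)) j) =
        g (π j : ℕ) * blk a (d - 1) (fun i => g i - g (i + a)) (π j : ℕ) * x := by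
  obtain ⟨π, ε, δ, -, h⟩ := hx
  have key : ∀ j : Fin a,
      x * blk a d (fun i => f i * g i) j =
        ((-1) ^ (π j / a) : ℤˣ) • (blk a d (fun i => f i * g i) (π j % a) * x) := fun j => by
    rw [mul_blk_p hd h, eq_smul_mod (S.blk_p_add hl hd0) (π j), smul_mul_assoc]
  refine ⟨fun j => ⟨π j % a, Nat.mod_lt _ ha⟩, _, fun j => ε j * (-1) ^ (π j / a), ?_,
    fun j => ⟨key j, ?_, ?_⟩⟩
  · refine Finite.injective_iff_bijective.1 fun j k hjk => ?_
    have hjk' : π j % a = π k % a := congrArg Fin.val hjk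
    have e1 := key j
    have e2 := key k
    rw [hjk'] at e1
    refine S.blk_p_injective (u := (-1) ^ (π j / a)) (u' := (-1) ^ (π k / a)) h2 hl ha hd hd0
      (hxu.mul_left_cancel ?_)
    rw [mul_smul_comm, e1, mul_smul_comm, e2, smul_smul, smul_smul, Int.units_mul_self,
      Int.units_mul_self]
  · rw [mul_blk_sub hd hd0 fun n t => (h n t).1,
      eq_smul_mod (S.blk_f_add h2 hl ha hd hd0) (π j), smul_mul_assoc, smul_smul]
  · have hR : ∀ k n, g (n + a * k) * blk a (d - 1) (fun i => g i - g (i + a)) (n + a * k) =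
        g n * blk a (d - 1) (fun i => g i - g (i + a)) n := by
      intro k n
      induction k with
      | zero => simp
      | succ k ih => rw [mul_add, mul_one, ← add_assoc, S.blk_g_add h2 hl ha hd hd0, ih]
    have e := hR (π j / a) (π j % a)
    rw [Nat.mod_add_div] at e
    have e0 := (h j 0).2
    rw [zero_mul, add_zero, add_zero] at e0
    rw [mul_mul_eq_smul e0 (mul_blk_sub hd hd0 (fun n t => (h n t).2) j), Int.units_mul_self,
      one_smul, e]

/-- The shift by `a` is the action of a product of the rotations of all blocks. Therefore elements
that commute with the shift and permute the rotations of the `g n` commute with the product of the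
rotations of the `f n`. -/
theorem mul_prod_blk_f [Nontrivial R] (h2 : (2 : K) ≠ 0) (hl : l = a * d) (ha : 0 < a)
    (hae : Even a) (hd : Even d) (hd0 : 0 < d) {v v' : R} (hvv' : v * v' = 1) (hv'v : v' * v = 1)
    (hv : ∀ n, v * f n = f (n + a) * v ∧ v * g n = g (n + a) * v)
    {x : R} (hxu : IsUnit x) (hx : IsShiftMonomial l a f g x) (hvx : v * x = x * v)
    (hxm : x ∈ Algebra.adjoin K (Set.range f ∪ Set.range g)) :
    x * (Finset.univ.toList.map fun j : Fin a =>
        blk a (d - 1) (fun i => f i - f (i + a)) (j : ℕ)).prod =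
      (Finset.univ.toList.map fun j : Fin a =>
        blk a (d - 1) (fun i => f i - f (i + a)) (j : ℕ)).prod * x := by
  set Q := fun j : Fin a => blk a (d - 1) (fun i => f i - f (i + a)) (j : ℕ)
  set T := fun j : Fin a => g (j : ℕ) * blk a (d - 1) (fun i => g i - g (i + a)) (j : ℕ)
  have hne : ∀ j k : Fin a, j ≠ k → (j : ℕ) % a ≠ (k : ℕ) % a := fun j k hjk h0 => by
    rw [Nat.mod_eq_of_lt j.2, Nat.mod_eq_of_lt k.2] at h0
    exact hjk (Fin.ext h0)
  have hlen : (Finset.univ : Finset (Fin a)).toList.length = a := by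
    rw [Finset.length_toList, Finset.card_univ, Fintype.card_fin]
  have hneg : ((-1 : ℤˣ) ^ (Finset.univ : Finset (Fin a)).toList.length) = 1 := by
    rw [hlen, hae.neg_one_pow]
  have hmem : ∀ j : Fin a, j ∈ (Finset.univ : Finset (Fin a)).toList := fun j =>
    Finset.mem_toList.2 (Finset.mem_univ j)
  have hiff : ∀ (k : Fin a) (n : ℕ), (k : ℕ) % a = n % a ↔ k = ⟨n % a, Nat.mod_lt _ ha⟩ :=
    fun k n => by rw [Nat.mod_eq_of_lt k.2, Fin.ext_iff]
  have hmod : ∀ n, (n + a) % a = n % a := fun n => Nat.add_mod_right n a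
  have qf : ∀ n, (Finset.univ.toList.map Q).prod * f n =
      f (n + a) * (Finset.univ.toList.map Q).prod := by
    intro n
    have := prod_mul_of_one (L := Finset.univ.toList) (Q := Q) (y := f n) (y' := f (n + a))
      (τ := -1) (j := ⟨n % a, Nat.mod_lt _ ha⟩) (fun k => by
        rw [S.blk_f_mul_f hl ha hd hd0, Units.neg_smul, one_smul]
        simp only [hiff, Q]) (fun k hk => by
        rw [S.blk_f_mul_f hl ha hd hd0, Units.neg_smul, one_smul,
          if_neg (by rw [hmod, hiff]; exact hk)]) (Finset.nodup_toList _)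
    rwa [hneg, one_smul, if_pos (hmem _)] at this
  have qg : ∀ n, (Finset.univ.toList.map Q).prod * g n = g n * (Finset.univ.toList.map Q).prod := by
    intro n
    have := prod_mul_of_one (L := Finset.univ.toList) (Q := Q) (y := g n) (y' := g n) (τ := -1)
      (j := ⟨n % a, Nat.mod_lt _ ha⟩) (fun k => by
        rw [S.blk_f_mul_g hd hd0, Units.neg_smul, one_smul, ite_self]) (fun k hk => by
        rw [S.blk_f_mul_g hd hd0, Units.neg_smul, one_smul]) (Finset.nodup_toList _)
    rwa [hneg, one_smul, if_pos (hmem _)] at this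
  have tg : ∀ n, (Finset.univ.toList.map T).prod * g n =
      g (n + a) * (Finset.univ.toList.map T).prod := by
    intro n
    have := prod_mul_of_one (L := Finset.univ.toList) (Q := T) (y := g n) (y' := g (n + a)) (τ := 1)
      (j := ⟨n % a, Nat.mod_lt _ ha⟩) (fun k => by
        rw [S.blk_g_mul_g hl ha hd hd0, one_smul]
        simp only [hiff, T]) (fun k hk => by
        rw [S.blk_g_mul_g hl ha hd hd0, one_smul,
          if_neg (by rw [hmod, hiff]; exact hk)]) (Finset.nodup_toList _)
    rwa [one_pow, one_smul, if_pos (hmem _)] at this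
  have tf : ∀ n, (Finset.univ.toList.map T).prod * f n = f n * (Finset.univ.toList.map T).prod := by
    intro n
    have := prod_mul_of_one (L := Finset.univ.toList) (Q := T) (y := f n) (y' := f n) (τ := 1)
      (j := ⟨n % a, Nat.mod_lt _ ha⟩) (fun k => by
        rw [S.blk_g_mul_f hd hd0, one_smul, ite_self]) (fun k hk => by
        rw [S.blk_g_mul_f hd hd0, one_smul]) (Finset.nodup_toList _)
    rwa [one_pow, one_smul, if_pos (hmem _)] at this
  obtain ⟨π, μ, ν, hπ, hperm⟩ := S.exists_block_perm h2 hl ha hd hd0 hxu hx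
  obtain ⟨α, hα⟩ := exists_sign_mul_prod_of_perm (Q := Q)
    (fun j k hjk => S.blk_f_anti hl hd hd0 (hne j k hjk)) hπ fun j => (hperm j).2.1
  have hβ := mul_prod_of_perm (Q := T) (fun j k => by
    by_cases hjk : j = k
    · rw [hjk]
    · exact S.blk_g_comm hl ha hd hd0 (hne j k hjk)) hπ fun j => (hperm j).2.2
  set q := (Finset.univ.toList.map Q).prod
  set t := (Finset.univ.toList.map T).prod
  -- `v' * (q * t)` commutes with all `f n` and `g n`, and therefore with `x`.
  have hv' : ∀ n, v' * f (n + a) = f n * v' ∧ v' * g (n + a) = g n * v' := by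
    intro n
    have e : ∀ {b c : R}, v * b = c * v → v' * c = b * v' := fun {b c} hbc => by
      rw [← one_mul (b * v'), ← hv'v, mul_assoc, ← mul_assoc v, hbc, mul_assoc c, hvv', mul_one]
    exact ⟨e (hv n).1, e (hv n).2⟩
  have hz : ∀ y ∈ Algebra.adjoin K (Set.range f ∪ Set.range g),
      v' * (q * t) * y = y * (v' * (q * t)) := by
    intro y hy
    induction hy using Algebra.adjoin_induction with
    | mem y hy =>
      rcases hy with ⟨n, rfl⟩ | ⟨n, rfl⟩
      · rw [mul_assoc, mul_assoc q, tf, ← mul_assoc q, qf, ← mul_assoc, ← mul_assoc v', (hv' n).1]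
        simp only [mul_assoc]
      · rw [mul_assoc, mul_assoc q, tg, ← mul_assoc q, qg, ← mul_assoc, ← mul_assoc v', (hv' n).2]
        simp only [mul_assoc]
    | algebraMap k => exact (Algebra.commutes _ _).symm
    | add b c _ _ hb hc => rw [mul_add, add_mul, hb, hc]
    | mul b c _ _ hb hc => rw [← mul_assoc, hb, mul_assoc, hc, mul_assoc]
  have hqt : x * (q * t) = q * t * x := by
    have h1 := hz x hxm
    have h3 : q * t = v * (v' * (q * t)) := by rw [← mul_assoc, hvv', one_mul]
    conv_lhs => rw [h3, ← mul_assoc, ← hvx, mul_assoc, ← h1, ← mul_assoc, ← h3]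
  have hu : IsUnit (q * t * x) :=
    ((isUnit_list_prod_map (fun j => S.isUnit_blk_f h2 hl ha _) _).mul
      (isUnit_list_prod_map (fun j => S.isUnit_blk_g h2 hl ha _) _)).mul hxu
  have h1 : α • (q * t * x) = (1 : ℤˣ) • (q * t * x) := by
    conv_rhs => rw [one_smul, ← hqt, ← mul_assoc x, hα, smul_mul_assoc, mul_assoc q x, hβ,
      ← mul_assoc q]
  rw [hα, units_eq_of_smul_eq h2 hu h1, one_smul]

end ShiftSystem

/-! ### Common eigenvectors of the block involutions -/

namespace ShiftSystem

variable {K R : Type*} [Field K] [Ring R] [Algebra K R] {l : ℕ} {f g : ℕ → R}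
  (S : ShiftSystem l f g) {a d : ℕ} {σ : ℕ → ℤˣ} {i₀ : K}

/-- `z` is an eigenvector of the products `f n * f (n + a)` and `g n * g (n + a)`, where `n` runs
over the indices of sign `1`, with eigenvalues `-i₀` and `i₀`. -/
def IsEigen (f g : ℕ → R) (a : ℕ) (σ : ℕ → ℤˣ) (i₀ : K) (z : R) : Prop :=
  ∀ n, σ n = 1 → f n * f (n + a) * z = -(i₀ • z) ∧ g n * g (n + a) * z = i₀ • z

theorem sign_mod (hσl : ∀ n, σ (n + l) = σ n) (n : ℕ) : σ (n % l) = σ n := by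
  have key : ∀ k r, σ (r + l * k) = σ r := by
    intro k
    induction k with
    | zero => simp
    | succ k ih =>
      intro r
      rw [mul_add, mul_one, ← add_assoc, hσl, ih]
  rw [← key (n / l) (n % l), Nat.mod_add_div]

theorem blk_mul_of_isEigen (hi : i₀ * i₀ = -1) (hσ : ∀ n, σ (n + a) = -σ n)
    (hfg : ∀ n m, f n * g m = -(g m * f n)) {z : R} (hz : IsEigen f g a σ i₀ z) {n : ℕ}
    (hn : σ n = 1) (k : ℕ) :
    blk a (2 * k) (fun i => f i * g i) n * z = ((-1) ^ k : ℤˣ) • z := by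
  have hpp : ∀ n, σ n = 1 → f n * g n * (f (n + a) * g (n + a)) * z = -z := fun n hn => by
    have e : f n * g n * (f (n + a) * g (n + a)) = -(f n * f (n + a) * (g n * g (n + a))) := by
      rw [mul_assoc, ← mul_assoc (g n), ← neg_neg (g n * f (n + a)), ← hfg]
      simp only [neg_mul, mul_neg, mul_assoc]
    rw [e, neg_mul, mul_assoc, (hz n hn).2, mul_smul_comm, (hz n hn).1, smul_neg, smul_smul, hi,
      neg_smul, one_smul, neg_neg]
  have hs : ∀ k, σ (n + 2 * k * a) = 1 := by
    intro k
    induction k with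
    | zero => simpa using hn
    | succ k ih =>
      rw [show n + 2 * (k + 1) * a = n + 2 * k * a + a + a by ring, hσ, hσ, neg_neg, ih]
  induction k with
  | zero => rw [mul_zero, blk_zero, pow_zero, one_smul, one_mul]
  | succ k ih =>
    rw [show 2 * (k + 1) = 2 * k + 1 + 1 by ring, blk_succ, blk_succ,
      show n + (2 * k + 1) * a = n + 2 * k * a + a by ring, mul_assoc (blk _ _ _ _), mul_assoc,
      hpp _ (hs k), mul_neg, ih, pow_succ, mul_neg_one, Units.neg_smul]

include S

theorem isEigen_of_lt (hl : 0 < l) (hσl : ∀ n, σ (n + l) = σ n) {z : R}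
    (h : ∀ n, n < l → σ n = 1 → f n * f (n + a) * z = -(i₀ • z) ∧ g n * g (n + a) * z = i₀ • z) :
    IsEigen f g a σ i₀ z := by
  intro n
  induction n using Nat.strong_induction_on with
  | _ n ih =>
    intro hn
    by_cases hnl : n < l
    · exact h n hnl hn
    · obtain ⟨r, rfl⟩ : ∃ r, n = r + l := ⟨n - l, by omega⟩
      rw [hσl] at hn
      rw [add_right_comm, S.f_add, S.f_add, S.g_add, S.g_add, neg_mul_neg]
      exact ih r (by omega) hn

/-- The elements `f n`, `i₀ • g n` and `i₀ • f (n + a)`, `-g (n + a)`, for the indices `n < l` of sign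
`1`, form an anticommuting system, whose involutions are multiples of the products of neighbours.
Thus these products have a common eigenvector, which is determined up to a scalar. -/
theorem exists_isEigen [Nontrivial R] (h2 : (2 : K) ≠ 0) (hi : i₀ * i₀ = -1) (hl : 0 < l)
    (hal : a ≤ l) (hσ : ∀ n, σ (n + a) = -σ n) (hσl : ∀ n, σ (n + l) = σ n) :
    ∃ ω : R, ω ≠ 0 ∧ IsEigen f g a σ i₀ ω ∧ ∀ y ∈ Algebra.adjoin K (Set.range f ∪ Set.range g),
      IsEigen f g a σ i₀ (y * ω) → ∃ c : K, y * ω = c • ω := by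
  let F : {n : Fin l // σ n = 1} ⊕ {n : Fin l // σ n = 1} → R :=
    Sum.elim (fun n => f n.1) fun n => i₀ • g n.1
  let G : {n : Fin l // σ n = 1} ⊕ {n : Fin l // σ n = 1} → R :=
    Sum.elim (fun n => i₀ • f (n.1 + a)) fun n => -g (n.1 + a)
  have hne : ∀ n m : {n : Fin l // σ n = 1}, n ≠ m → (n.1 : ℕ) % l ≠ m.1 % l := by
    intro n m hnm h
    rw [Nat.mod_eq_of_lt n.1.2, Nat.mod_eq_of_lt m.1.2] at h
    exact hnm (Subtype.ext (Fin.ext h))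
  have hne' : ∀ n m : {n : Fin l // σ n = 1}, n ≠ m → ((n.1 : ℕ) + a) % l ≠ (m.1 + a) % l :=
    fun n m hnm h => hne n m hnm (Nat.ModEq.add_right_cancel' a h)
  have hna : ∀ n m : {n : Fin l // σ n = 1}, (n.1 : ℕ) % l ≠ (m.1 + a) % l := by
    intro n m h
    have h1 : σ (n.1 % l) = σ ((m.1 + a) % l) := by rw [h]
    rw [sign_mod hσl, sign_mod hσl, hσ, n.2, m.2] at h1
    exact absurd h1 (by decide)
  have hA : AntiSystem F G := by
    constructor
    · rintro (n | n)
      · exact S.f_sq _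
      · simp only [F, Sum.elim_inr]
        rw [smul_mul_smul_comm, hi, S.g_sq, neg_smul, one_smul]
    · rintro (n | n)
      · simp only [G, Sum.elim_inl]
        rw [smul_mul_smul_comm, hi, S.f_sq, neg_smul, one_smul, neg_neg]
      · simp only [G, Sum.elim_inr]
        rw [neg_mul_neg, S.g_sq]
    · rintro (n | n) (m | m) hnm
      · exact S.f_f _ _ (hne n m fun h => hnm (by rw [h]))
      · simp only [F, Sum.elim_inl, Sum.elim_inr]
        rw [mul_smul_comm, smul_mul_assoc, S.f_g, smul_neg]
      · simp only [F, Sum.elim_inl, Sum.elim_inr]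
        rw [mul_smul_comm, smul_mul_assoc, S.g_f, smul_neg]
      · simp only [F, Sum.elim_inr]
        rw [smul_mul_smul_comm, smul_mul_smul_comm, S.g_g _ _ (hne n m fun h => hnm (by rw [h])),
          smul_neg]
    · rintro (n | n) (m | m) hnm
      · simp only [G, Sum.elim_inl]
        rw [smul_mul_smul_comm, smul_mul_smul_comm, S.f_f _ _ (hne' n m fun h => hnm (by rw [h])),
          smul_neg]
      · simp only [G, Sum.elim_inl, Sum.elim_inr]
        rw [mul_neg, neg_mul, mul_smul_comm, smul_mul_assoc, S.f_g, smul_neg]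
      · simp only [G, Sum.elim_inl, Sum.elim_inr]
        rw [mul_neg, neg_mul, mul_smul_comm, smul_mul_assoc, S.g_f, smul_neg]
      · simp only [G, Sum.elim_inr]
        rw [neg_mul_neg, neg_mul_neg]
        exact S.g_g _ _ (hne' n m fun h => hnm (by rw [h]))
    · rintro (n | n) (m | m)
      · simp only [F, G, Sum.elim_inl]
        rw [mul_smul_comm, smul_mul_assoc, S.f_f _ _ (hna n m), smul_neg]
      · simp only [F, G, Sum.elim_inl, Sum.elim_inr]
        rw [mul_neg, neg_mul, S.f_g]
      · simp only [F, G, Sum.elim_inl, Sum.elim_inr]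
        rw [smul_mul_smul_comm, smul_mul_smul_comm, S.g_f, smul_neg]
      · simp only [F, G, Sum.elim_inr]
        rw [mul_neg, neg_mul, mul_smul_comm, smul_mul_assoc, S.g_g _ _ (hna n m), smul_neg]
  obtain ⟨ω, hω0, hω, hy⟩ := exists_eigenvector hA h2 fun _ => 1
  have hiff : ∀ b z : R, i₀ • (b * z) = z ↔ b * z = -(i₀ • z) := by
    intro b z
    constructor
    · intro h
      nth_rewrite 2 [← h]
      rw [smul_smul, hi, neg_smul, one_smul, neg_neg]
    · intro h
      rw [h, smul_neg, smul_smul, hi, neg_smul, one_smul, neg_neg]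
  have hiff' : ∀ b z : R, -(i₀ • (b * z)) = z ↔ b * z = i₀ • z := by
    intro b z
    rw [← smul_neg, ← neg_mul, hiff, neg_mul, neg_inj]
  have e1 : ∀ (n : {n : Fin l // σ n = 1}) (z : R),
      F (Sum.inl n) * G (Sum.inl n) * z = i₀ • (f n.1 * f (n.1 + a) * z) := fun n z => by
    simp only [F, G, Sum.elim_inl]
    rw [mul_smul_comm, smul_mul_assoc]
  have e3 : ∀ (n : {n : Fin l // σ n = 1}) (z : R),
      F (Sum.inr n) * G (Sum.inr n) * z = -(i₀ • (g n.1 * g (n.1 + a) * z)) := fun n z => by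
    simp only [F, G, Sum.elim_inr]
    rw [mul_neg, neg_mul, smul_mul_assoc, smul_mul_assoc]
  refine ⟨ω, hω0, S.isEigen_of_lt hl hσl fun n hnl hn => ⟨?_, ?_⟩, fun y hyA hyω => hy y ?_ ?_⟩
  · have := hω (Sum.inl ⟨⟨n, hnl⟩, hn⟩)
    rwa [e1, one_smul, hiff] at this
  · have := hω (Sum.inr ⟨⟨n, hnl⟩, hn⟩)
    rwa [e3, one_smul, hiff'] at this
  · refine Algebra.adjoin_le ?_ hyA
    have hF : ∀ x, F x ∈ Algebra.adjoin K (Set.range F ∪ Set.range G) := fun x =>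
      Algebra.subset_adjoin (Or.inl ⟨x, rfl⟩)
    have hG : ∀ x, G x ∈ Algebra.adjoin K (Set.range F ∪ Set.range G) := fun x =>
      Algebra.subset_adjoin (Or.inr ⟨x, rfl⟩)
    have hc : ∀ {b : R}, i₀ • b ∈ Algebra.adjoin K (Set.range F ∪ Set.range G) →
        b ∈ Algebra.adjoin K (Set.range F ∪ Set.range G) := fun {b} hb => by
      have := Subalgebra.smul_mem _ hb i₀
      rwa [smul_smul, hi, neg_smul, one_smul, neg_mem_iff] at this
    have hu : ∀ {b c : R}, (∃ ε : ℤˣ, b = ε • c) →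
        c ∈ Algebra.adjoin K (Set.range F ∪ Set.range G) →
        b ∈ Algebra.adjoin K (Set.range F ∪ Set.range G) := by
      rintro b c ⟨ε, rfl⟩ hcm
      rcases Int.units_eq_one_or ε with rfl | rfl
      · rwa [one_smul]
      · rw [Units.neg_smul, one_smul]
        exact neg_mem hcm
    have key : ∀ n, σ n = 1 → ∀ b ∈ ({f n, f (n + a), g n, g (n + a)} : Set R),
        b ∈ Algebra.adjoin K (Set.range F ∪ Set.range G) := by
      intro n hn b hb
      have hm : σ (n % l) = 1 := by rw [sign_mod hσl, hn]
      have hmm : (n + a) % l = (n % l + a) % l := (Nat.mod_add_mod n l a).symm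
      rcases hb with rfl | rfl | rfl | rfl
      · rw [← S.f_mod]
        exact hF (Sum.inl ⟨⟨n % l, Nat.mod_lt _ hl⟩, hm⟩)
      · rw [← S.f_mod, hmm, S.f_mod]
        exact hc (hG (Sum.inl ⟨⟨n % l, Nat.mod_lt _ hl⟩, hm⟩))
      · exact hu (S.g_mod n) (hc (hF (Sum.inr ⟨⟨n % l, Nat.mod_lt _ hl⟩, hm⟩)))
      · exact hu (S.g_of_mod_eq hmm)
          (neg_mem_iff.1 (hG (Sum.inr ⟨⟨n % l, Nat.mod_lt _ hl⟩, hm⟩)))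
    have hmem : ∀ n, f n ∈ Algebra.adjoin K (Set.range F ∪ Set.range G) ∧
        g n ∈ Algebra.adjoin K (Set.range F ∪ Set.range G) := by
      intro n
      rcases Int.units_eq_one_or (σ n) with hn | hn
      · exact ⟨key n hn _ (by simp), key n hn _ (by simp)⟩
      · -- an index of sign `-1` is `r + a`, modulo `l`, for an index `r` of sign `1`
        have hr : n + l - a + a = n + l := by omega
        have hs : σ (n + l - a) = 1 := by
          have := hσ (n + l - a)
          rw [hr, hσl, hn, neg_inj] at this
          exact this.symm
        constructor
        · have := key _ hs (f (n + l - a + a)) (by simp)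
          rwa [hr, S.f_add] at this
        · have := key _ hs (g (n + l - a + a)) (by simp)
          rwa [hr, S.g_add, neg_mem_iff] at this
    rintro _ (⟨n, rfl⟩ | ⟨n, rfl⟩)
    exacts [(hmem n).1, (hmem n).2]
  · rintro (n | n)
    · rw [e1, one_smul, hiff]
      exact (hyω _ n.2).1
    · rw [e3, one_smul, hiff']
      exact (hyω _ n.2).2

/-- A common eigenvector of the block involutions for given signs, whose line is stable under the
shift monomial units that respect the signs. -/
theorem exists_block_eigenvector [Nontrivial R] (h2 : (2 : K) ≠ 0) (hi : i₀ * i₀ = -1)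
    (hl : l = a * d) (ha : 0 < a) (hd : Even d) (hd0 : 0 < d) (s : Fin a → ℤˣ) :
    ∃ ω : R, ω ≠ 0 ∧
      (∃ c : ℤˣ, ∀ j : Fin a, blk a d (fun i => f i * g i) j * ω = (c * s j) • ω) ∧
      ∀ y ∈ Algebra.adjoin K (Set.range f ∪ Set.range g), IsUnit y → IsShiftMonomial l a f g y →
        (∀ j : Fin a, ∃ k : Fin a, y * (s j • blk a d (fun i => f i * g i) j) =
          (s k • blk a d (fun i => f i * g i) k) * y) → ∃ c : K, y * ω = c • ω := by
  have hl0 : 0 < l := by rw [hl]; exact Nat.mul_pos ha hd0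
  let r : ℕ → Fin a := fun n => ⟨n % a, Nat.mod_lt _ ha⟩
  -- the signs, extended to all indices like the block involutions
  let σ : ℕ → ℤˣ := fun n => s (r n) * (-1) ^ (n / a)
  have hσ : ∀ n, σ (n + a) = -σ n := fun n => by
    simp only [σ, r, Nat.add_mod_right, Nat.add_div_right n ha, pow_succ, mul_neg,
      mul_one]
  have hσl : ∀ n, σ (n + l) = σ n := fun n => by
    simp only [σ, r, hl, Nat.add_mul_mod_self_left, Nat.add_mul_div_left _ _ ha, pow_add,
      hd.neg_one_pow, mul_one]
  have hσj : ∀ j : Fin a, σ j = s j := fun j => by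
    simp only [σ, r, Nat.mod_eq_of_lt j.2, Nat.div_eq_of_lt j.2, pow_zero, mul_one, Fin.eta]
  have hP : ∀ n, σ n • blk a d (fun i => f i * g i) n =
      s (r n) • blk a d (fun i => f i * g i) (r n : ℕ) := fun n => by
    rw [eq_smul_mod (S.blk_p_add hl hd0) n, smul_smul, mul_assoc, Int.units_mul_self, mul_one]
  obtain ⟨ω, hω0, hω, hy⟩ := S.exists_isEigen (σ := σ) (i₀ := i₀) (a := a) h2 hi hl0
    (by rw [hl]; exact Nat.le_mul_of_pos_right a hd0) hσ hσl
  refine ⟨ω, hω0, ⟨(-1) ^ (d / 2), fun j => ?_⟩, fun y hyA hyu hym hyP => hy y hyA ?_⟩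
  · have hdd : 2 * (d / 2) = d := Nat.two_mul_div_two_of_even hd
    have key : ∀ n, σ n = 1 → blk a d (fun i => f i * g i) n * ω = ((-1) ^ (d / 2) : ℤˣ) • ω :=
      fun n hn => by
        have := blk_mul_of_isEigen hi hσ S.f_g hω hn (d / 2)
        rwa [hdd] at this
    rw [← hσj]
    rcases Int.units_eq_one_or (σ j) with h | h
    · rw [h, mul_one, key _ h]
    · have := key (j + a) (by rw [hσ, h, neg_neg])
      rw [S.blk_p_add hl hd0, neg_mul, neg_eq_iff_eq_neg] at this
      rw [h, mul_neg_one, Units.neg_smul, this]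
  · obtain ⟨π, ε, δ, hπ, hm⟩ := hym
    have hσπ : ∀ n, σ (π n) = σ n := by
      intro n
      obtain ⟨k, hk⟩ := hyP (r n)
      rw [← hP, mul_smul_comm, mul_blk_p hd hm] at hk
      have h1 : blk a d (fun i => f i * g i) (π n) =
          (σ (π n) * s (r (π n))) • blk a d (fun i => f i * g i) (r (π n) : ℕ) := by
        rw [mul_smul, ← hP, smul_smul, Int.units_mul_self, one_smul]
      rw [h1, ← smul_mul_assoc, smul_smul] at hk
      have hk' := hyu.mul_right_cancel hk
      have hj := S.blk_p_injective h2 hl ha hd hd0 hk'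
      rw [hj] at hk'
      have h3 := units_eq_of_smul_eq h2
        (r := blk a d (fun i => f i * g i) (k : ℕ)) ⟨⟨_, _, S.blk_p_sq _ _, S.blk_p_sq _ _⟩, rfl⟩
        hk'
      rw [← mul_assoc, mul_eq_right] at h3
      exact (mul_eq_one_iff_eq_inv.1 h3 |>.trans (Int.units_inv_eq_self _)).symm
    refine S.isEigen_of_lt hl0 hσl fun n hnl hn => ?_
    obtain ⟨m, rfl⟩ := hπ n hnl
    rw [hσπ] at hn
    have h0 := hm m 0
    have h1 := hm m 1
    simp only [zero_mul, add_zero, one_mul] at h0 h1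
    have hf := mul_mul_eq_smul h0.1 h1.1
    have hg := mul_mul_eq_smul h0.2 h1.2
    rw [Int.units_mul_self, one_smul] at hf hg
    constructor
    · rw [← mul_assoc, ← hf, mul_assoc, (hω m hn).1, mul_neg, mul_smul_comm]
    · rw [← mul_assoc, ← hg, mul_assoc, (hω m hn).2, mul_smul_comm]

end ShiftSystem

/-! ### The block system of the twisted fixed points -/

section Twisted

variable {K : Type*} [Field K] {l : ℕ}

theorem smul_clF_eq (hl : 0 < l) (i : Fin l) : ∃ ε : ℤˣ, clF K l i = ε • shiftF K hl i := by
  have : idx hl (i : ℕ) = i := Fin.ext (Nat.mod_eq_of_lt i.2)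
  exact ⟨(-1) ^ ((i : ℕ) % l), by rw [shiftF, this, smul_smul, Int.units_mul_self, one_smul]⟩

theorem smul_clG_eq (hl : 0 < l) (i : Fin l) : ∃ ε : ℤˣ, clG K l i = ε • shiftG K hl i := by
  have : idx hl (i : ℕ) = i := Fin.ext (Nat.mod_eq_of_lt i.2)
  exact ⟨(-1) ^ ((i : ℕ) % l + i / l), by
    rw [shiftG, this, smul_smul, Int.units_mul_self, one_smul]⟩

theorem shift_p_eq (hl : 0 < l) (n : ℕ) : ∃ ε : ℤˣ,
    shiftF K hl n * shiftG K hl n = ε • (clF K l (idx hl n) * clG K l (idx hl n)) :=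
  ⟨_, by rw [shiftF, shiftG, smul_mul_smul_comm]⟩

theorem shiftSystem (hl : 0 < l) : ShiftSystem l (shiftF K hl) (shiftG K hl) where
  f_sq n := by
    rw [shiftF, smul_mul_smul_comm, Int.units_mul_self, one_smul, antiSystem_clF_clG.F_sq]
  g_sq n := by
    rw [shiftG, smul_mul_smul_comm, Int.units_mul_self, one_smul, antiSystem_clF_clG.G_sq]
  f_f n m h := by
    rw [shiftF, shiftF, smul_mul_smul_comm, smul_mul_smul_comm, mul_comm ((-1) ^ _ : ℤˣ),
      antiSystem_clF_clG.F_F _ _ fun h0 => h (congrArg Fin.val h0), smul_neg]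
  g_g n m h := by
    rw [shiftG, shiftG, smul_mul_smul_comm, smul_mul_smul_comm, mul_comm ((-1) ^ _ : ℤˣ),
      antiSystem_clF_clG.G_G _ _ fun h0 => h (congrArg Fin.val h0), smul_neg]
  f_g n m := by
    rw [shiftF, shiftG, smul_mul_smul_comm, smul_mul_smul_comm, mul_comm ((-1) ^ _ : ℤˣ),
      antiSystem_clF_clG.F_G, smul_neg]
  f_add := shiftF_add hl
  g_add := shiftG_add hl

theorem adjoin_le_adjoin_shift (hl : 0 < l) :
    Algebra.adjoin K (Set.range (clF K l) ∪ Set.range (clG K l)) ≤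
      Algebra.adjoin K (Set.range (shiftF K hl) ∪ Set.range (shiftG K hl)) := by
  have hu : ∀ {b c : Cl K l}, (∃ ε : ℤˣ, b = ε • c) →
      c ∈ Algebra.adjoin K (Set.range (shiftF K hl) ∪ Set.range (shiftG K hl)) →
      b ∈ Algebra.adjoin K (Set.range (shiftF K hl) ∪ Set.range (shiftG K hl)) := by
    rintro b c ⟨ε, rfl⟩ hc
    rcases Int.units_eq_one_or ε with rfl | rfl
    · rwa [one_smul]
    · rw [Units.neg_smul, one_smul]
      exact neg_mem hc
  refine Algebra.adjoin_le ?_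
  rintro _ (⟨i, rfl⟩ | ⟨i, rfl⟩)
  · exact hu (smul_clF_eq hl i) (Algebra.subset_adjoin (Or.inl ⟨_, rfl⟩))
  · exact hu (smul_clG_eq hl i) (Algebra.subset_adjoin (Or.inr ⟨_, rfl⟩))

/-- An element that commutes with a shift acts on the translates of a member of the shifted sequence
as it acts on this member. -/
theorem mul_translate {R : Type*} [Ring R] {f : ℕ → R} {a : ℕ} {v x : R} (hvu : IsUnit v)
    (hv : ∀ n, v * f n = f (n + a) * v) (hvx : v * x = x * v) {n m : ℕ} {ε : ℤˣ}
    (h : x * f n = ε • (f m * x)) (t : ℕ) : x * f (n + t * a) = ε • (f (m + t * a) * x) := by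
  induction t with
  | zero => simpa using h
  | succ t ih =>
    refine hvu.mul_right_cancel ?_
    rw [show n + (t + 1) * a = n + t * a + a by ring, show m + (t + 1) * a = m + t * a + a by ring,
      mul_assoc, ← hv, ← mul_assoc, ← hvx, mul_assoc, ih, mul_smul_comm, ← mul_assoc, hv, mul_assoc,
      hvx, smul_mul_assoc, mul_assoc]

/-- An element of `V` that commutes with `v₀ ^ a` permutes the residues modulo `l` compatibly with the
translation by `a`, which is the action of `v₀ ^ a`. -/
theorem isShiftMonomial_of_mem_extWeyl (h2 : (2 : K) ≠ 0) (hl : 0 < l) (a : ℕ) {x : Spin K l}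
    (hx : x ∈ extWeyl K l) (hvx : v₀ K l ^ a * x = x * v₀ K l ^ a) :
    IsShiftMonomial l a (shiftF K hl) (shiftG K hl) (coeHom K l x) := by
  obtain ⟨π, ε, δ, h⟩ := isMonomial_of_mem_extWeyl h2 hx
  have hu : IsUnit (coeHom K l (v₀ K l ^ a)) := (Group.isUnit _).map _
  have hvx' : coeHom K l (v₀ K l ^ a) * coeHom K l x = coeHom K l x * coeHom K l (v₀ K l ^ a) := by
    rw [← map_mul, hvx, map_mul]
  have hF : ∀ n, ∃ η : ℤˣ, coeHom K l x * shiftF K hl n =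
      η • (shiftF K hl (π (idx hl n)) * coeHom K l x) := fun n => by
    obtain ⟨η, hη⟩ := smul_clF_eq (K := K) hl (π (idx hl n))
    exact ⟨_, by rw [shiftF, mul_smul_comm, coeHom_apply, (h _).1, hη, smul_mul_assoc, smul_smul,
      smul_smul]⟩
  have hG : ∀ n, ∃ η : ℤˣ, coeHom K l x * shiftG K hl n =
      η • (shiftG K hl (π (idx hl n)) * coeHom K l x) := fun n => by
    obtain ⟨η, hη⟩ := smul_clG_eq (K := K) hl (π (idx hl n))
    exact ⟨_, by rw [shiftG, mul_smul_comm, coeHom_apply, (h _).2, hη, smul_mul_assoc, smul_smul,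
      smul_smul]⟩
  choose ε' hε' using hF
  choose δ' hδ' using hG
  refine ⟨fun n => π (idx hl n), ε', δ', fun i hi => ⟨π.symm ⟨i, hi⟩, ?_⟩, fun n t => ⟨?_, ?_⟩⟩
  · have : idx hl (π.symm ⟨i, hi⟩ : ℕ) = π.symm ⟨i, hi⟩ := Fin.ext (Nat.mod_eq_of_lt (Fin.is_lt _))
    simp only [this, Equiv.apply_symm_apply]
  · exact mul_translate hu (fun n => (pow_mul_shift h2 hl a n).1) hvx' (hε' n) t
  · exact mul_translate hu (fun n => (pow_mul_shift h2 hl a n).2) hvx' (hδ' n) t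

/-- The involutions of blocks of even length are images of elements of the toral part. -/
theorem exists_blk (h2 : (2 : K) ≠ 0) (hl : 0 < l) (a k n : ℕ) : ∃ g ∈ toralPart K l,
    coeHom K l g = blk a (2 * k) (fun i => shiftF K hl i * shiftG K hl i) n := by
  obtain ⟨m, hm, hm'⟩ := exists_neg (K := K) h2 hl
  have hpair : ∀ n n', ∃ g ∈ toralPart K l, coeHom K l g =
      shiftF K hl n * shiftG K hl n * (shiftF K hl n' * shiftG K hl n') := by
    intro n n'
    obtain ⟨ε, hε⟩ := shift_p_eq (K := K) hl n
    obtain ⟨ε', hε'⟩ := shift_p_eq (K := K) hl n'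
    obtain ⟨g, hg, hg'⟩ := exists_pair (K := K) h2 (idx hl n) (idx hl n')
    rw [hε, hε', smul_mul_smul_comm, ← hg']
    rcases Int.units_eq_one_or (ε * ε') with h | h
    · exact ⟨g, hg, by rw [h, one_smul]⟩
    · exact ⟨m * g, mul_mem hm hg, by rw [h, map_mul, hm', Units.neg_smul, one_smul, neg_one_mul]⟩
  induction k with
  | zero => exact ⟨1, one_mem _, by rw [map_one, mul_zero, blk_zero]⟩
  | succ k ih =>
    obtain ⟨g, hg, hg'⟩ := ih
    obtain ⟨g', hgm, hgg⟩ := hpair (n + 2 * k * a) (n + (2 * k + 1) * a)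
    exact ⟨g * g', mul_mem hg hgm, by
      rw [map_mul, hg', hgg, show 2 * (k + 1) = 2 * k + 1 + 1 by ring, blk_succ, blk_succ,
        mul_assoc (blk _ _ _ _)]⟩

theorem blk_p_mem_adjoin (hl : 0 < l) (a k n : ℕ) :
    blk a k (fun i => shiftF K hl i * shiftG K hl i) n ∈
      Algebra.adjoin K (Set.range fun i => clF K l i * clG K l i) := by
  refine Subalgebra.list_prod_mem _ fun x hx => ?_
  obtain ⟨t, _, rfl⟩ := List.mem_map.1 hx
  obtain ⟨ε, hε⟩ := shift_p_eq (K := K) hl (n + t * a)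
  simp only [hε]
  rcases Int.units_eq_one_or ε with rfl | rfl
  · rw [one_smul]
    exact clp_mem_adjoin _
  · rw [Units.neg_smul, one_smul]
    exact neg_mem (clp_mem_adjoin _)

variable {a d : ℕ}

/-- The shift by `a` negates the block involutions, which are antiperiodic with period `a`. -/
theorem v₀_pow_mul_blk (h2 : (2 : K) ≠ 0) (hl : 0 < l) (hla : l = a * d) (hd0 : 0 < d) (n : ℕ) :
    coeHom K l (v₀ K l ^ a) * blk a d (fun i => shiftF K hl i * shiftG K hl i) n =
      -(blk a d (fun i => shiftF K hl i * shiftG K hl i) n * coeHom K l (v₀ K l ^ a)) := by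
  rw [mul_blk (m := n + a) (ε := 1) fun t _ => ?_, one_pow, one_smul,
    (shiftSystem hl).blk_p_add hla hd0, neg_mul]
  obtain ⟨h1, h3⟩ := pow_mul_shift (K := K) h2 hl a (n + t * a)
  rw [← mul_assoc, h1, mul_assoc, h3, ← mul_assoc, add_right_comm, one_smul]

/-- The centralizer of the involution-negating element `v₀ ^ a` in the toral part is generated by
`-1` and the products of two block involutions. -/
theorem eq_closure_blk (h2 : (2 : K) ≠ 0) (hl : 0 < l) (hla : l = a * d) (ha : 0 < a) (hd0 : 0 < d)
    {H : Subgroup (Spin K l)}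
    (hH : ∀ x, x ∈ H ↔ x ∈ toralPart K l ∧ v₀ K l ^ a * x = x * v₀ K l ^ a)
    {m : Spin K l} (hm : m ∈ H) (hm' : coeHom K l m = -1) {pair : Fin a → Fin a → Spin K l}
    (hpair : ∀ j k, pair j k ∈ H)
    (hpair' : ∀ j k : Fin a, coeHom K l (pair j k) =
      blk a d (fun i => shiftF K hl i * shiftG K hl i) j *
        blk a d (fun i => shiftF K hl i * shiftG K hl i) k) :
    H = Subgroup.closure (insert m {g | ∃ j k, g = pair j k}) := by
  have S := shiftSystem (K := K) hl
  have hu : IsUnit (coeHom K l (v₀ K l ^ a)) := (Group.isUnit _).map _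
  have hvx : ∀ x ∈ H, coeHom K l (v₀ K l ^ a) * coeHom K l x =
      coeHom K l x * coeHom K l (v₀ K l ^ a) := fun x hx => by
    rw [← map_mul, ((hH x).1 hx).2, map_mul]
  have hF : ∀ {y : Cl K l}, (∀ n, y * shiftF K hl n = shiftF K hl n * y) →
      ∀ i, y * clF K l i = clF K l i * y := fun {y} hy i => by
    obtain ⟨ε, hε⟩ := smul_clF_eq (K := K) hl i
    rw [hε, mul_smul_comm, hy, smul_mul_assoc]
  refine eq_closure_of_blocks (coeHom K l) H ⟨0, ha⟩
    (fun j : Fin a => blk a d (fun i => shiftF K hl i * shiftG K hl i) j) m pair hm hpair hpair'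
    (shiftF K hl) (fun n => ⟨n % a, Nat.mod_lt _ ha⟩) (fun i n => ?_) (fun x hx => ?_)
    (fun x hx hxF => eq_one_or_of_commute h2 hm' ((hH x).1 hx).1 (hF hxF)) fun x hx hxF => ?_
  · rw [S.blk_p_mul_f hla ha hd0, Nat.mod_eq_of_lt i.2]
    simp only [Fin.ext_iff, eq_comm]
  · obtain ⟨ε, hε⟩ := exists_sign_of_mem_toralPart h2 ((hH x).1 hx).1
    refine ⟨fun j => ε (idx hl j), fun n => ?_⟩
    have h1 : coeHom K l x * shiftF K hl (n % a) =
        ε (idx hl (n % a)) • (shiftF K hl (n % a) * coeHom K l x) := by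
      rw [shiftF, mul_smul_comm, hε, smul_mul_assoc, smul_comm]
    have h3 := mul_translate hu (fun n => (pow_mul_shift h2 hl a n).1) (hvx x hx) h1 (n / a)
    rwa [mul_comm (n / a), Nat.mod_add_div] at h3
  · exact not_commute_of_anticomm h2 ((hH x).1 hx).1 (blk_p_mem_adjoin hl a d _)
      (S.blk_p_sq d _) hu (v₀_pow_mul_blk h2 hl hla hd0 _) (hvx x hx) (hF hxF)

/-- Elements of the submonoid generated by the image of `V`. -/
theorem exists_of_mem_closure {A R : Type*} [Group A] [Ring R] {ρ : A →* R} {V : Subgroup A} {v : A}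
    (hv : v ∈ V) {y : R} (hy : y ∈ Submonoid.closure (insert (ρ v) (ρ '' V))) :
    ∃ x ∈ V, ρ x = y := by
  have : Submonoid.closure (insert (ρ v) (ρ '' V)) ≤ V.toSubmonoid.map ρ := by
    refine Submonoid.closure_le.2 ?_
    rintro _ (rfl | ⟨x, hx, rfl⟩)
    exacts [⟨v, hv, rfl⟩, ⟨x, hx, rfl⟩]
  exact this hy

/-- The block system of the centralizer of `v₀ ^ a` in the extended Weyl group, where `l = a * d`
with `d` even: the blocks are the residue classes modulo `a`. -/
def blockSystemTwist [IsAlgClosed K] (h2 : (2 : K) ≠ 0) (hl : 0 < l) (hla : l = a * d) (ha : 0 < a)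
    (hd : Even d) (hd0 : 0 < d) (V H : Subgroup (Spin K l))
    (hV : ∀ x, x ∈ V ↔ x ∈ extWeyl K l ∧ v₀ K l ^ a * x = x * v₀ K l ^ a)
    (hH : ∀ x, x ∈ H ↔ x ∈ toralPart K l ∧ v₀ K l ^ a * x = x * v₀ K l ^ a) :
    BlockSystem K (Fin a) (coeHom K l) V H :=
  have S := shiftSystem (K := K) hl
  have hvV : v₀ K l ^ a ∈ V := (hV _).2 ⟨pow_mem (v₀_mem K l) a, rfl⟩
  have hu : ∀ x, IsUnit (coeHom K l x) := fun x => (Group.isUnit x).map _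
  have hadj : ∀ x ∈ V, coeHom K l x ∈
      Algebra.adjoin K (Set.range (shiftF K hl) ∪ Set.range (shiftG K hl)) := fun x hx =>
    adjoin_le_adjoin_shift hl (coe_mem_of_mem_extWeyl h2 ((hV x).1 hx).1)
  have hmon : ∀ x ∈ V, IsShiftMonomial l a (shiftF K hl) (shiftG K hl) (coeHom K l x) :=
    fun x hx => isShiftMonomial_of_mem_extWeyl h2 hl a ((hV x).1 hx).1 ((hV x).1 hx).2
  have hblk : ∀ j : Fin a, ∃ g ∈ toralPart K l, coeHom K l g =
      blk a d (fun i => shiftF K hl i * shiftG K hl i) j := fun j => by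
    have := exists_blk (K := K) h2 hl a (d / 2) j
    rwa [Nat.two_mul_div_two_of_even hd] at this
  have hnegH : (exists_neg (K := K) h2 hl).choose ∈ H := (hH _).2
    ⟨(exists_neg h2 hl).choose_spec.1, coeHom_injective (by
      rw [map_mul, map_mul, (exists_neg h2 hl).choose_spec.2, mul_neg, neg_mul, mul_one, one_mul])⟩
  have hcoe : ∀ j k : Fin a, coeHom K l ((hblk j).choose * (hblk k).choose) =
      blk a d (fun i => shiftF K hl i * shiftG K hl i) j *
        blk a d (fun i => shiftF K hl i * shiftG K hl i) k := fun j k => by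
    rw [map_mul, (hblk j).choose_spec.2, (hblk k).choose_spec.2]
  have hpairH : ∀ j k : Fin a, (hblk j).choose * (hblk k).choose ∈ H := fun j k => (hH _).2
    ⟨mul_mem (hblk j).choose_spec.1 (hblk k).choose_spec.1, coeHom_injective (by
      rw [map_mul, map_mul _ _ (v₀ K l ^ a), hcoe, ← mul_assoc,
        v₀_pow_mul_blk h2 hl hla hd0, neg_mul, mul_assoc, v₀_pow_mul_blk h2 hl hla hd0, mul_neg, neg_neg, mul_assoc])⟩
  { P := fun j => blk a d (fun i => shiftF K hl i * shiftG K hl i) j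
    Q := fun j => blk a (d - 1) (fun i => shiftF K hl i - shiftF K hl (i + a)) j
    neg := (exists_neg h2 hl).choose
    pair := fun j k => (hblk j).choose * (hblk k).choose
    flip := coeHom K l (v₀ K l ^ a)
    P_sq := fun j => S.blk_p_sq d j
    P_comm := fun j k => S.blk_p_comm d d j k
    P_Q := fun j k => by
      have := S.blk_p_mul_blk_f hla ha hd hd0 j k
      simpa only [Nat.mod_eq_of_lt (Fin.is_lt _), ← Fin.ext_iff] using this
    Q_anti := fun j k hjk => S.blk_f_anti hla hd hd0 (by
      rw [Nat.mod_eq_of_lt j.2, Nat.mod_eq_of_lt k.2]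
      exact fun h => hjk (Fin.ext h))
    Q_unit := fun j => S.isUnit_blk_f h2 hla ha j
    coe_neg := (exists_neg h2 hl).choose_spec.2
    coe_pair := hcoe
    H_eq := eq_closure_blk h2 hl hla ha hd0 hH hnegH (exists_neg h2 hl).choose_spec.2 hpairH hcoe
    H_le := fun x hx => (hV x).2 ⟨((hH x).1 hx).1.2, ((hH x).1 hx).2⟩
    monomial := fun x hx => by
      have := nontrivial_cl (l := l) h2
      obtain ⟨π, μ, ν, -, h⟩ := S.exists_block_perm h2 hla ha hd hd0 (hu x) (hmon x hx)
      exact ⟨π, μ, ν, fun j => ⟨(h j).1, (h j).2.1⟩⟩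
    prod_comm := fun he x hx => by
      have := nontrivial_cl (l := l) h2
      rw [Fintype.card_fin] at he
      exact S.mul_prod_blk_f h2 hla ha he hd hd0 (v := coeHom K l (v₀ K l ^ a))
        (v' := coeHom K l (v₀ K l ^ a)⁻¹) (by rw [← map_mul, mul_inv_cancel, map_one])
        (by rw [← map_mul, inv_mul_cancel, map_one]) (fun n => pow_mul_shift h2 hl a n) (hu x)
        (hmon x hx) (by rw [← map_mul, ((hV x).1 hx).2, map_mul]) (hadj x hx)
    flip_unit := hu _
    flip_P := fun j => v₀_pow_mul_blk h2 hl hla hd0 j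
    flip_comm := fun x hx => by rw [← map_mul, ((hV x).1 hx).2, map_mul]
    vacuum := fun s => by
      have := nontrivial_cl (l := l) h2
      obtain ⟨i₀, hi⟩ := IsAlgClosed.exists_eq_mul_self (-1 : K)
      obtain ⟨ω, hω0, hω, hy⟩ := S.exists_block_eigenvector h2 hi.symm hla ha hd hd0 s
      refine ⟨ω, hω0, hω, fun y hyV hyP => ?_⟩
      obtain ⟨x, hx, rfl⟩ := exists_of_mem_closure hvV hyV
      exact hy _ (hadj x hx) (hu x) (hmon x hx) hyP }

theorem signExtendible_twist [IsAlgClosed K] (h2 : (2 : K) ≠ 0) (hl : 0 < l) (hla : l = a * d)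
    (ha : 0 < a) (hd : Even d) (hd0 : 0 < d) (V H : Subgroup (Spin K l))
    (hV : ∀ x, x ∈ V ↔ x ∈ extWeyl K l ∧ v₀ K l ^ a * x = x * v₀ K l ^ a)
    (hH : ∀ x, x ∈ H ↔ x ∈ toralPart K l ∧ v₀ K l ^ a * x = x * v₀ K l ^ a) :
    SignExtendible K H V := by
  have := nontrivial_cl (l := l) h2
  have : Nonempty (Fin a) := ⟨⟨0, ha⟩⟩
  intro θ S hS h
  exact (blockSystemTwist h2 hl hla ha hd hd0 V H hV hH).exists_extension coeHom_injective h2 hS θ h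

/-- The sign characters of the twisted fixed points in the toral part extend to their inertia groups
in the twisted fixed points of the extended Weyl group, for all divisors `d` of `2 * l`. -/
theorem signExtendible_of_dvd [IsAlgClosed K] (h2 : (2 : K) ≠ 0) (hl : 0 < l) (hd : d ∣ 2 * l)
    (V H : Subgroup (Spin K l))
    (hV : ∀ x, x ∈ V ↔ x ∈ extWeyl K l ∧ twist K l d * x = x * twist K l d)
    (hH : ∀ x, x ∈ H ↔ x ∈ toralPart K l ∧ twist K l d * x = x * twist K l d) :
    SignExtendible K H V := by
  obtain ⟨b, hb⟩ := hd
  have hd0 : 0 < d := Nat.pos_of_ne_zero fun h => by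
    rw [h, zero_mul] at hb
    omega
  have htw : twist K l d = v₀ K l ^ b :=
    congrArg (v₀ K l ^ ·) (Nat.div_eq_of_eq_mul_right hd0 hb)
  have hb0 : 0 < b := Nat.pos_of_ne_zero fun h => by
    rw [h, mul_zero] at hb
    omega
  -- an odd power of the twist that is a power of `v₀ ^ l`
  have odd_case : ∀ n k, Odd n → b * n = l * k → SignExtendible K H V := by
    intro n k hn hnk
    refine SignExtendible.of_odd (H := toralPart K l) (V := extWeyl K l) (v := twist K l d)
      (fun x hx h hh => conj_mem_toralPart h2 hl hx hh) (twist_mem K l d)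
      (fun x hx y hy => (sq_of_mem_toralPart h2 hl hx hy).2)
      (fun x hx => (sq_of_mem_toralPart h2 hl hx hx).1) hn (fun h hh => ?_) hH
      (fun x hx => (hV x).1 hx) (signExtendible_extWeyl K l h2 hl)
    rw [htw, ← pow_mul, hnk, pow_mul]
    exact (Commute.pow_left (show Commute _ _ from v₀_pow_comm h2 hl hh) k).eq
  rcases Nat.even_or_odd d with ⟨e, he⟩ | hd
  · have hl' : l = b * e := by
      have : 2 * l = 2 * (b * e) := by rw [hb, he]; ring
      omega
    rcases Nat.even_or_odd e with hee | heo
    · rw [htw] at hV hH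
      exact signExtendible_twist h2 hl hl' hb0 hee (by omega) V H hV hH
    · exact odd_case e 1 heo (by rw [mul_one, hl'])
  · exact odd_case d 2 hd (by rw [mul_comm, ← hb, mul_comm])

end Twisted

end TypeB

theorem mainTheorem9 (p : ℕ) [Fact p.Prime] (m : ℕ) (hm : 0 < m) (hq : p ^ m ≡ 1 [MOD 8])
    (l : ℕ) (hl : 3 ≤ l) (d : ℕ) (hd : d ∣ 2 * l) :
    TypeB.MaximalExtendibility
      (TypeB.Hd (TypeB.Fbar p) l p m (TypeB.twist (TypeB.Fbar p) l d))
      (TypeB.Vd (TypeB.Fbar p) l p m (TypeB.twist (TypeB.Fbar p) l d)) ∧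
    TypeB.ExtensionMapCondition (TypeB.Fbar p) l p m d (TypeB.twist (TypeB.Fbar p) l d)
      (TypeB.twist_mem (TypeB.Fbar p) l d) := by
  have hl0 : 0 < l := by omega
  have h2 : (2 : TypeB.Fbar p) ≠ 0 := by
    intro h
    have hp2 : p = 2 := by
      have h1 : ((2 : ℕ) : TypeB.Fbar p) = 0 := by exact_mod_cast h
      rw [CharP.cast_eq_zero_iff (TypeB.Fbar p) p] at h1
      exact (Nat.prime_dvd_prime_iff_eq Fact.out Nat.prime_two).1 h1
    obtain ⟨k, rfl⟩ : ∃ k, m = k + 1 := ⟨m - 1, by omega⟩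
    rw [hp2, Nat.ModEq, pow_succ] at hq
    omega
  have hV := fun x => TypeB.mem_Vd_iff (TypeB.Fbar p) l p m
    (v := TypeB.twist (TypeB.Fbar p) l d) (x := x)
  have hH := fun x => TypeB.mem_Hd_iff (TypeB.Fbar p) l p m
    (v := TypeB.twist (TypeB.Fbar p) l d) (x := x)
  refine TypeB.maximalExtendibility_and_extensionMapCondition (TypeB.Fbar p) l p h2 m d _ _
    (TypeB.normalIn_iff.2 ⟨TypeB.Hd_le_Vd _ _ _ _ _, fun x hx h hh => ?_⟩) (fun y hy => ?_)
    (TypeB.signExtendible_of_dvd h2 hl0 hd _ _ hV hH)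
  · obtain ⟨hxV, hxv⟩ := (hV x).1 hx
    obtain ⟨hhH, hhv⟩ := (hH h).1 hh
    have hc : Commute (TypeB.twist (TypeB.Fbar p) l d) (x * h * x⁻¹) :=
      ((show Commute _ x from hxv).mul_right hhv).mul_right (show Commute _ x from hxv).inv_right
    exact (hH _).2 ⟨TypeB.conj_mem_toralPart h2 hl0 hxV hhH, hc⟩
  · have := ((hH y).1 hy).1
    exact (TypeB.sq_of_mem_toralPart h2 hl0 this this).1
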